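/- **Setting.** Let $(r,\theta,z)$ be cylindrical coordinates on $\Omega=\{|x|>1\}\times\mathbb R\subset\mathbb R^3$, with unit vectors $\mathbf e_r,\mathbf e_\theta,\mathbf e_z$. For an axisymmetric field $v=v^r(r,z)\mathbf e_r+v^\theta(r,z)\mathbf e_\theta+v^z(r,z)\mathbf e_z$ put $\operatorname{div}v=\frac1r\partial_r(rv^r)+\partial_zv^z$ and $(\operatorname{rot}v)^\theta=\partial_zv^r-\partial_rv^z$ (weak derivatives); $v$ has no swirl if $v^\theta=0$. For $\sigma\ge0$ let $L^\infty_\sigma$ be the space of (complex-valued) functions on $(1,\infty)$ with $\|f\|_{L^\infty_\sigma}=\operatorname{ess\,sup}_{r>1}r^\sigma|f(r)|<\infty$. Let $\mathrm X(\mathbb R,L^\infty_\sigma)$ be the space of $L^\infty_\sigma$-valued measures $h\,\mathrm d\Lambda+\sum_{m\in\mathbb Z}b_m\delta_m$ on $\mathbb R$, where $\Lambda$ is Lebesgue measure, $h\in L^1(\mathbb R,L^\infty_\sigma)$ and $\{b_m\}\in l^1(\mathbb Z,L^\infty_\sigma)$. Let $\mathrm{FX}(\mathbb R,L^\infty_\sigma)$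 be the space of functions $u(r,z)$ whose Fourier transform in $z$ is such a measure, i.e. $$u(\cdot,z)=\frac1{\sqrt{2\pi}}\Big(\int_{\mathbb R}e^{\mathrm iz\zeta}h(\cdot,\zeta)\,\mathrm d\zeta+\sum_{m\in\mathbb Z}e^{\mathrm imz}b_m\Big),\qquad \hat u=h\,\mathrm d\Lambda+\sum_{m\in\mathbb Z}b_m\delta_m .$$ Let $I_1,K_1$ be the modified Bessel functions of order one. For $\hat\omega=h\,\mathrm d\Lambda+\sum_mb_m\delta_m\in \mathrm X(\mathbb R,L^\infty_\rho)$ with $2<\rho<3$, define $$d[h](\zeta)=\frac{I_1(|\zeta|)}{K_1(|\zeta|)}\int_1^\infty K_1(|\zeta|s)\,s\,h(s,\zeta)\,\mathrm ds\quad(\zeta\ne0),$$ $$d[b_0]=\frac12\int_1^\infty b_0(s)\,\mathrm ds,\qquad d[b_m]=\frac{I_1(|m|)}{K_1(|m|)}\int_1^\infty K_1(|m|s)\,s\,b_m(s)\,\mathrm ds\quad(m\ne0),$$ $$\hat\psi[h](r,\zeta)=-d[h](\zeta)K_1(|\zeta|r)+K_1(|\zeta|r)\int_1^rI_1(|\zeta|s)\,s\,h(s,\zeta)\,\mathrm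 ds+I_1(|\zeta|r)\int_r^\infty K_1(|\zeta|s)\,s\,h(s,\zeta)\,\mathrm ds\quad(\zeta\neq0),$$ let $\hat\psi[b_m](r)$ for $m\ne0$ be given by the same formula with $m$, $b_m(s)$, $d[b_m]$ in place of $\zeta$, $h(s,\zeta)$, $d[h](\zeta)$, and let $$\hat\psi[b_0](r)=-\frac{d[b_0]}{r}+\frac1{2r}\int_1^rs^2b_0(s)\,\mathrm ds+\frac r2\int_r^\infty b_0(s)\,\mathrm ds .$$ The streamfunction $\psi$ of $\omega$ is the inverse Fourier transform of $\hat\psi[h]\,\mathrm d\Lambda+\sum_m\hat\psi[b_m]\delta_m$, and the axisymmetric Biot–Savart law is $$\mathcal V[\omega]=-\partial_z\psi\,\mathbf e_r+\frac1r\partial_r(r\psi)\,\mathbf e_z .$$ **Proposition 3.4.** Let $2<\rho<3$ and let $v\in\mathrm{FX}(\mathbb R,L^\infty_{\rho-1})^3\cap W^{1,2}_{\rm loc}(\overline\Omega)^3$ have no swirl. Suppose that $\omega:=(\operatorname{rot}v)^\theta\in\mathrm{FX}(\mathbb R,L^\infty_\rho)$, with $\hat\omega=h\,\mathrm d\Lambda+\sum_{m\in\mathbb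 Z}b_m\delta_m$, that $\operatorname{div}v=0$, and that $v=0$ on $\{1\}\times\mathbb R$. Then: 1. The streamfunction $\psi$ is differentiable in $r$ and in $z$ at every point of $(1,\infty)\times\mathbb R$; it belongs to $\mathrm{FX}(\mathbb R,L^\infty_{\rho-2})$ and to $W^{1,2}_{\rm loc}$ up to $r=1$, and solves, in the weak sense, $$-\Big(\partial_r^2+\frac1r\partial_r+\partial_z^2-\frac1{r^2}\Big)\psi=\omega\ \text{ in }(1,\infty)\times\mathbb R,\qquad\psi=0\ \text{ on }\{1\}\times\mathbb R;$$ moreover $v=\mathcal V[\omega]$ (almost everywhere). 2. $d[h](\zeta)=0$ for almost every $\zeta\in\mathbb R$, and $d[b_m]=0$ for all $m\in\mathbb Z$. -/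

import Mathlib

open MeasureTheory Set Filter

noncomputable section

namespace AxisymBS

/-! ### Modified Bessel functions of order one (real positive argument) -/

/-- `I₁(x) = ∑ₖ (x/2)^(2k+1) / (k! (k+1)!)`. -/
def besselI1 (x : ℝ) : ℝ :=
  ∑' k : ℕ, (x / 2) ^ (2 * k + 1) / ((k.factorial : ℝ) * ((k + 1).factorial : ℝ))

/-- `K₁(x) = ∫₀^∞ exp(-x cosh t) cosh t dt` for `x > 0`. -/
def besselK1 (x : ℝ) : ℝ :=
  ∫ t in Ioi (0 : ℝ), Real.exp (-x * Real.cosh t) * Real.cosh t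

/-! ### The spaces `L^∞_ρ`, `X(ℝ, L^∞_ρ)` and `FX(ℝ, L^∞_ρ)` -/

/-- `L^∞(1, ∞)`, complex valued. The weighted space `L^∞_ρ` (norm `ess sup r^ρ |f(r)|`) is
represented through the isometry `f ↦ r^ρ f` onto this Banach space. -/
abbrev LInf : Type := Lp ℂ ⊤ (volume.restrict (Ioi (1 : ℝ)))

/-- The function `r ↦ r^(-ρ) F(r)` of `L^∞_ρ` that is represented by `F ∈ L^∞`. -/
def unweight (ρ : ℝ) (F : LInf) (r : ℝ) : ℂ := ((r ^ (-ρ) : ℝ) : ℂ) * F r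

/-- The measures `h dΛ + ∑ₘ bₘ δₘ`, with `h` Bochner integrable with values in `L^∞_ρ` and `(bₘ)`
absolutely summable in `L^∞_ρ`. The fields hold the weighted functions `r^ρ h` and `r^ρ bₘ`. -/
structure XMeas (ρ : ℝ) where
  /-- `ζ ↦ r^ρ h(r, ζ)` -/
  g : ℝ → LInf
  /-- `m ↦ r^ρ bₘ(r)` -/
  a : ℤ → LInf
  integrable_g : Integrable g volume
  summable_a : Summable fun m => ‖a m‖

/-- The density `h(r, ζ)`. -/
def XMeas.dens {ρ : ℝ} (μ : XMeas ρ) (ζ r : ℝ) : ℂ := unweight ρ (μ.g ζ) r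

/-- The coefficient `bₘ(r)` of the Dirac mass at `m`. -/
def XMeas.atom {ρ : ℝ} (μ : XMeas ρ) (m : ℤ) (r : ℝ) : ℂ := unweight ρ (μ.a m) r

/-- `r^ρ` times the value at `z` of the inverse Fourier transform
`(2π)^(-1/2) (∫ e^{izζ} h(·, ζ) dζ + ∑ₘ e^{imz} bₘ)`, an element of `L^∞`. -/
def XMeas.invFourier {ρ : ℝ} (μ : XMeas ρ) (z : ℝ) : LInf :=
  (((Real.sqrt (2 * Real.pi))⁻¹ : ℝ) : ℂ) •
    ((∫ ζ : ℝ, Complex.exp (Complex.I * z * ζ) • μ.g ζ) +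
      ∑' m : ℤ, Complex.exp (Complex.I * m * z) • μ.a m)

/-- The half plane `(1, ∞) × ℝ` of the variables `(r, z)`. -/
def halfPlane : Set (ℝ × ℝ) := Ioi (1 : ℝ) ×ˢ univ

/-- Lebesgue measure on the half plane. -/
def hpVol : Measure (ℝ × ℝ) := (volume : Measure (ℝ × ℝ)).restrict halfPlane

/-- The Fourier transform of `u` in the variable `z` is the measure `μ`, that is, `u` is (as a class
of functions on the half plane) the inverse Fourier transform of `μ`. -/
def IsFourierTransform {ρ : ℝ} (u : ℝ × ℝ → ℂ) (μ : XMeas ρ) : Prop :=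
  AEStronglyMeasurable u hpVol ∧
    ∀ᵐ z : ℝ, ∀ᵐ r ∂((volume : Measure ℝ).restrict (Ioi 1)),
      u (r, z) = unweight ρ (μ.invFourier z) r

/-- `u ∈ FX(ℝ, L^∞_ρ)`. Since `X` is invariant under the reflection `ζ ↦ -ζ`, transforms and inverse
transforms of elements of `X` form the same space. -/
def MemFX (ρ : ℝ) (u : ℝ × ℝ → ℂ) : Prop := ∃ μ : XMeas ρ, IsFourierTransform u μ

/-! ### Weak derivatives, local Sobolev functions up to the boundary, traces -/

/-- `p` is the weak derivative of `u` in the direction `e` in the half plane: `(1, 0)` gives `∂_r`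
and `(0, 1)` gives `∂_z`. -/
def HasWeakPartial (e : ℝ × ℝ) (u p : ℝ × ℝ → ℂ) : Prop :=
  LocallyIntegrableOn u halfPlane ∧ LocallyIntegrableOn p halfPlane ∧
    ∀ φ : ℝ × ℝ → ℝ, ContDiff ℝ ((⊤ : ℕ∞) : WithTop ℕ∞) φ → HasCompactSupport φ → tsupport φ ⊆ halfPlane →
      ∫ x, ((fderiv ℝ φ x e : ℝ) : ℂ) * u x ∂hpVol = - ∫ x, (φ x : ℂ) * p x ∂hpVol

/-- Square integrable on bounded subsets of the half plane (up to the boundary `r = 1`). -/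
def MemL2loc (u : ℝ × ℝ → ℂ) : Prop :=
  ∀ R : ℝ, MemLp u 2 ((volume : Measure (ℝ × ℝ)).restrict (halfPlane ∩ Metric.closedBall 0 R))

/-- `u ∈ W^{1,2}_loc` up to the boundary `r = 1`. -/
def MemW12loc (u : ℝ × ℝ → ℂ) : Prop :=
  MemL2loc u ∧ ∃ p q : ℝ × ℝ → ℂ, MemL2loc p ∧ MemL2loc q ∧
    HasWeakPartial (1, 0) u p ∧ HasWeakPartial (0, 1) u q

/-- `γ` is the trace of `u` on `{1} × ℝ`, in the sense of Green's formula
`∫ (u ∂_r φ + φ ∂_r u) = - ∫ φ(1, z) γ(z) dz` for all test functions on the plane. -/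
def HasTrace (u : ℝ × ℝ → ℂ) (γ : ℝ → ℂ) : Prop :=
  MemL2loc u ∧ LocallyIntegrable γ volume ∧
    ∃ p : ℝ × ℝ → ℂ, MemL2loc p ∧ HasWeakPartial (1, 0) u p ∧
      ∀ φ : ℝ × ℝ → ℝ, ContDiff ℝ ((⊤ : ℕ∞) : WithTop ℕ∞) φ → HasCompactSupport φ →
        ∫ x, (((fderiv ℝ φ x (1, 0) : ℝ) : ℂ) * u x + (φ x : ℂ) * p x) ∂hpVol =
          - ∫ z : ℝ, (φ (1, z) : ℂ) * γ z

/-- `u = 0` on `{1} × ℝ` in the sense of traces. -/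
def VanishesOnBoundary (u : ℝ × ℝ → ℂ) : Prop := HasTrace u 0

/-! ### Axisymmetric vector fields -/

/-- An axisymmetric vector field `v^r e_r + v^θ e_θ + v^z e_z` on the exterior `{r > 1}` of the
cylinder, given by its components as functions of `(r, z)`. -/
structure AxisymField where
  r : ℝ × ℝ → ℂ
  θ : ℝ × ℝ → ℂ
  z : ℝ × ℝ → ℂ

namespace AxisymField

/-- `v ∈ FX(ℝ, L^∞_ρ)³`. -/
def MemFX3 (ρ : ℝ) (v : AxisymField) : Prop := MemFX ρ v.r ∧ MemFX ρ v.θ ∧ MemFX ρ v.z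

/-- `v ∈ W^{1,2}_loc` up to the boundary. On bounded sets `1 < r < R` this is the same as
the three-dimensional condition, as `|∇v|² = ∑ᵢ (|∂_r vⁱ|² + |∂_z vⁱ|²) + (|v^r|² + |v^θ|²) / r²`. -/
def W12loc (v : AxisymField) : Prop := MemW12loc v.r ∧ MemW12loc v.θ ∧ MemW12loc v.z

/-- `v^θ = 0`. -/
def NoSwirl (v : AxisymField) : Prop := v.θ =ᵐ[hpVol] 0

/-- `div v = (1/r) ∂_r (r v^r) + ∂_z v^z = 0`. -/
def DivFree (v : AxisymField) : Prop :=
  ∃ p q : ℝ × ℝ → ℂ, HasWeakPartial (1, 0) (fun x => (x.1 : ℂ) * v.r x) p ∧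
    HasWeakPartial (0, 1) v.z q ∧ ∀ᵐ x ∂hpVol, 1 / (x.1 : ℂ) * p x + q x = 0

/-- `(rot v)^θ = ∂_z v^r - ∂_r v^z = ω`. -/
def IsRotTheta (v : AxisymField) (ω : ℝ × ℝ → ℂ) : Prop :=
  ∃ p q : ℝ × ℝ → ℂ, HasWeakPartial (0, 1) v.r p ∧ HasWeakPartial (1, 0) v.z q ∧
    ω =ᵐ[hpVol] fun x => p x - q x

/-- `v = 0` on `{1} × ℝ`. -/
def ZeroOnBoundary (v : AxisymField) : Prop :=
  VanishesOnBoundary v.r ∧ VanishesOnBoundary v.θ ∧ VanishesOnBoundary v.z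

/-- Equality almost everywhere. -/
def EqAE (v w : AxisymField) : Prop :=
  v.r =ᵐ[hpVol] w.r ∧ v.θ =ᵐ[hpVol] w.θ ∧ v.z =ᵐ[hpVol] w.z

end AxisymField

/-! ### The streamfunction and the axisymmetric Biot-Savart law -/

/-- `(I₁(κ)/K₁(κ)) ∫₁^∞ K₁(κ s) s f(s) ds` (used with `κ = |ζ| > 0`). -/
def dPos (κ : ℝ) (f : ℝ → ℂ) : ℂ :=
  ((besselI1 κ / besselK1 κ : ℝ) : ℂ) * ∫ s in Ioi (1 : ℝ), ((besselK1 (κ * s) * s : ℝ) : ℂ) * f s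

/-- `(1/2) ∫₁^∞ f(s) ds` (frequency zero). -/
def dZero (f : ℝ → ℂ) : ℂ := 1 / 2 * ∫ s in Ioi (1 : ℝ), f s

/-- The decaying solution, for the frequency `κ = |ζ| > 0`, of
`-φ'' - φ'/r + (κ² + 1/r²) φ = f` on `r > 1` with `φ(1) = 0`. -/
def psiHatPos (κ : ℝ) (f : ℝ → ℂ) (r : ℝ) : ℂ :=
  -dPos κ f * (besselK1 (κ * r) : ℂ)
    + (besselK1 (κ * r) : ℂ) * (∫ s in Ioc 1 r, ((besselI1 (κ * s) * s : ℝ) : ℂ) * f s)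
    + (besselI1 (κ * r) : ℂ) * ∫ s in Ioi r, ((besselK1 (κ * s) * s : ℝ) : ℂ) * f s

/-- The decaying solution of `-φ'' - φ'/r + φ/r² = f` on `r > 1` with `φ(1) = 0`. -/
def psiHatZero (f : ℝ → ℂ) (r : ℝ) : ℂ :=
  -dZero f * (r : ℂ)⁻¹
    + (r : ℂ)⁻¹ / 2 * (∫ s in Ioc 1 r, ((s ^ 2 : ℝ) : ℂ) * f s)
    + (r : ℂ) / 2 * ∫ s in Ioi r, f s

/-- `d[h](ζ)`, for `ζ ≠ 0`. -/
def dDens {ρ : ℝ} (μ : XMeas ρ) (ζ : ℝ) : ℂ := dPos |ζ| (μ.dens ζ)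

/-- `d[bₘ]`. -/
def dAtom {ρ : ℝ} (μ : XMeas ρ) (m : ℤ) : ℂ :=
  if m = 0 then dZero (μ.atom 0) else dPos |(m : ℝ)| (μ.atom m)

/-- `ψ̂[h](r, ζ)`, for `ζ ≠ 0`. -/
def psiDens {ρ : ℝ} (μ : XMeas ρ) (ζ r : ℝ) : ℂ := psiHatPos |ζ| (μ.dens ζ) r

/-- `ψ̂[bₘ](r)`. -/
def psiAtom {ρ : ℝ} (μ : XMeas ρ) (m : ℤ) (r : ℝ) : ℂ :=
  if m = 0 then psiHatZero (μ.atom 0) r else psiHatPos |(m : ℝ)| (μ.atom m) r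

/-- The streamfunction `ψ`: the inverse Fourier transform of `ψ̂[h] dΛ + ∑ₘ ψ̂[bₘ] δₘ`, where
`μ = h dΛ + ∑ₘ bₘ δₘ` is the Fourier transform of `ω`. -/
def streamfunction {ρ : ℝ} (μ : XMeas ρ) (x : ℝ × ℝ) : ℂ :=
  (((Real.sqrt (2 * Real.pi))⁻¹ : ℝ) : ℂ) *
    ((∫ ζ : ℝ, Complex.exp (Complex.I * x.2 * ζ) * psiDens μ ζ x.1) +
      ∑' m : ℤ, Complex.exp (Complex.I * m * x.2) * psiAtom μ m x.1)

/-- The Biot-Savart field `𝒱 = -∂_z ψ e_r + (1/r) ∂_r (r ψ) e_z`, `ψ` the streamfunction. -/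
def biotSavart {ρ : ℝ} (μ : XMeas ρ) : AxisymField where
  r := fun x => -deriv (fun z : ℝ => streamfunction μ (x.1, z)) x.2
  θ := 0
  z := fun x => 1 / (x.1 : ℂ) * deriv (fun r : ℝ => (r : ℂ) * streamfunction μ (r, x.2)) x.1

/-- `ψ ∈ FX(ℝ, L^∞_{ρ-2}) ∩ W^{1,2}_loc` is a weak solution of
`-(∂_r² + (1/r) ∂_r + ∂_z² - 1/r²) ψ = ω` in `(1, ∞) × ℝ`, `ψ = 0` on `{1} × ℝ`. -/
def SolvesStreamEq (ρ : ℝ) (ω ψ : ℝ × ℝ → ℂ) : Prop :=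
  MemFX (ρ - 2) ψ ∧ MemL2loc ψ ∧ VanishesOnBoundary ψ ∧
    ∃ p q : ℝ × ℝ → ℂ, MemL2loc p ∧ MemL2loc q ∧
      HasWeakPartial (1, 0) ψ p ∧ HasWeakPartial (0, 1) ψ q ∧
      ∀ φ : ℝ × ℝ → ℝ, ContDiff ℝ ((⊤ : ℕ∞) : WithTop ℕ∞) φ → HasCompactSupport φ → tsupport φ ⊆ halfPlane →
        ∫ x, (x.1 : ℂ) * (((fderiv ℝ φ x (1, 0) : ℝ) : ℂ) * p x +
            ((fderiv ℝ φ x (0, 1) : ℝ) : ℂ) * q x + (φ x : ℂ) * ψ x / (x.1 : ℂ) ^ 2) ∂hpVol =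
          ∫ x, (x.1 : ℂ) * ((φ x : ℂ) * ω x) ∂hpVol

end AxisymBS

end

open AxisymBS

noncomputable section

namespace AxisymBS

open scoped Topology

/-! ### The modified Bessel functions of orders zero and one -/

/-! ### Power series: `I₀`, `I₁` and their first-order recurrences -/

section BesselSeries

/-! The velocity itself provides the streamfunction, namely `ψ = r⁻¹ ∫₁^r s v^z ds`; what has to be
shown is that the Bessel formula for `ψ̂` gives the same function.

Since `v` has zero trace, `div v = 0` and `(rot v)^θ = ω` may be tested with functions that do not
vanish at `r = 1`. Testing with products `χ(r) η(z)` and using uniqueness of Fourier transforms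
(`ae_eq_of_weak_deriv_invFT`) gives, at Lebesgue-almost every real frequency `ζ` and at every
integer, weak equations for the transforms `a`, `c` of `v^r`, `v^z`: `(r a)' = -iζ r c` and `c' = iζ
a - h`, with `a(1) = c(1) = 0`. `freqMeasure` treats both kinds of frequency at once, and the du
Bois-Reymond lemma `ae_ae_eq_primitive`, which needs only countably many `χ`, puts the equations in
integrated form (`ae_isFreqSolution`).

Put `P(r) = ∫₁^r s c ds`. Then `r a = -iζ P` and `c = ∫₁^r (ζ² P/s - h) ds`, so `P/r` solves the
radial equation for `ψ̂` with two conditions at `r = 1`: both it and its derivative vanish. The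
problem is overdetermined. Integrating `h` by parts twice against `s K₁(|ζ|s)` leaves no term at
`1`, and none at infinity because `r c → 0` and `P → 0`: the first follows from the decay of `v^z`,
the second from that of `v^r` through `P = i r a / ζ`, and both use `ρ > 2`. Hence `∫ K₁ s h = 0`,
which is `d = 0`. The same computation with `I₁`, together with the Wronskian of `I₁` and `K₁`,
gives `ψ̂ = P/r`. At `ζ = 0` the kernels are powers of `r` and `r c → 0` suffices
(`IsFreqSolution.coefficients`).

No estimate of the Bessel formula in `ζ` is then needed. The quantities `c` and `ζ P/r` are
continuous representatives of `v̂^z` and, up to a constant factor, of `v̂^r`, so their suprema are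
bounded by norms that are integrable in `ζ`. This justifies differentiating `ψ` under the frequency
integral and identifies `-∂_z ψ` and `r⁻¹ ∂_r (r ψ)` with `v^r` and `v^z`. The condition `ρ < 3`
makes `r⁻¹ ∫₁^r s · ds` bounded from `L^∞_{ρ-1}` to `L^∞_{ρ-2}`. The weak equation for `ψ` is the
rotation identity tested with `r φ`. -/

lemma summable_pow_div_factorial_sq (y : ℝ) :
    Summable fun k : ℕ => y ^ k / ((k.factorial : ℝ) * k.factorial) := by
  refine Summable.of_norm_bounded (Real.summable_pow_div_factorial |y|) fun k => ?_
  rw [norm_div, norm_pow, Real.norm_eq_abs, norm_mul, Real.norm_natCast]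
  have h : (1 : ℝ) ≤ k.factorial := by exact_mod_cast k.factorial_pos
  gcongr
  nlinarith

lemma summable_pow_div_factorial_mul_succ (y : ℝ) :
    Summable fun k : ℕ => y ^ k / ((k.factorial : ℝ) * (k + 1).factorial) := by
  refine Summable.of_norm_bounded (Real.summable_pow_div_factorial |y|) fun k => ?_
  rw [norm_div, norm_pow, Real.norm_eq_abs, norm_mul, Real.norm_natCast, Real.norm_natCast]
  have h : (1 : ℝ) ≤ k.factorial := by exact_mod_cast k.factorial_pos
  have h' : (1 : ℝ) ≤ (k + 1).factorial := by exact_mod_cast (k + 1).factorial_pos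
  gcongr
  nlinarith

/-- `∑ₖ y^k / (k!)²`, so that `I₀(x) = besselE0 (x² / 4)`. -/
def besselE0 (y : ℝ) : ℝ := ∑' k : ℕ, y ^ k / ((k.factorial : ℝ) * k.factorial)

/-- `∑ₖ y^k / (k! (k+1)!)`, so that `I₁(x) = (x / 2) besselE1 (x² / 4)`. -/
def besselE1 (y : ℝ) : ℝ := ∑' k : ℕ, y ^ k / ((k.factorial : ℝ) * (k + 1).factorial)

lemma hasDerivAt_besselE0 (y : ℝ) : HasDerivAt besselE0 (besselE1 y) y := by
  -- The added `1` puts `y` inside the open ball and gives `R ≥ 1`, so that `|x|^(k-1) ≤ R^k`, also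
  -- at `k = 0`, where `k - 1` truncates to `0`.
  set R : ℝ := |y| + 1
  have hy : y ∈ Metric.ball (0 : ℝ) R := by simp [R]
  have key := hasDerivAt_tsum_of_isPreconnected (𝕜 := ℝ) (F := ℝ)
    (g := fun (k : ℕ) (y : ℝ) => y ^ k / ((k.factorial : ℝ) * k.factorial))
    (g' := fun (k : ℕ) (y : ℝ) => (k * y ^ (k - 1)) / ((k.factorial : ℝ) * k.factorial))
    (Real.summable_pow_div_factorial R) Metric.isOpen_ball
    (convex_ball (0 : ℝ) R).isPreconnected
    (fun k y _ => (hasDerivAt_pow k y).div_const _) ?_ hy (summable_pow_div_factorial_sq y) hy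
  · convert! key using 1
    have hs : Summable fun k : ℕ => (k * y ^ (k - 1)) / ((k.factorial : ℝ) * k.factorial) := by
      refine (summable_nat_add_iff 1).1 ((summable_pow_div_factorial_mul_succ y).congr fun k => ?_)
      rw [Nat.factorial_succ]
      push_cast
      field_simp
    rw [hs.tsum_eq_zero_add, besselE1]
    simp only [Nat.cast_zero, zero_mul, zero_div, zero_add]
    refine tsum_congr fun k => ?_
    rw [Nat.factorial_succ]
    push_cast
    field_simp
  · intro k x hx
    have hx' : |x| ≤ R := by simpa using (Metric.mem_ball.1 hx).le
    have hR : 1 ≤ R := by simp [R]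
    rw [norm_div, norm_mul, Real.norm_natCast, norm_pow, Real.norm_eq_abs, norm_mul,
      Real.norm_natCast]
    have h0 : (0 : ℝ) < k.factorial := by exact_mod_cast k.factorial_pos
    have hk : (k : ℝ) ≤ k.factorial := by exact_mod_cast k.self_le_factorial
    have hp : |x| ^ (k - 1) ≤ R ^ k :=
      (pow_le_pow_left₀ (abs_nonneg x) hx' _).trans (pow_le_pow_right₀ hR (Nat.sub_le k 1))
    rw [div_le_div_iff₀ (by positivity) h0]
    have : (k : ℝ) * |x| ^ (k - 1) ≤ k.factorial * R ^ k := by gcongr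
    nlinarith

/-- Termwise differentiation, the factor `k + 1` cancelling against `(k + 1)!`. Under `y = x²/4`
this and the derivative of `besselE0` become `(x I₁)' = x I₀` and `I₀' = I₁`; the second-order
Bessel equation is never needed. -/
lemma hasDerivAt_mul_besselE1 (y : ℝ) :
    HasDerivAt (fun y => y * besselE1 y) (besselE0 y) y := by
  set R : ℝ := |y| + 1
  have hy : y ∈ Metric.ball (0 : ℝ) R := by simp [R]
  have hsum (y : ℝ) : Summable fun k : ℕ =>
      y ^ (k + 1) / ((k.factorial : ℝ) * (k + 1).factorial) :=
    ((summable_pow_div_factorial_mul_succ y).mul_left y).congr fun k => by ring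
  have key := hasDerivAt_tsum_of_isPreconnected (𝕜 := ℝ) (F := ℝ)
    (g := fun (k : ℕ) (y : ℝ) => y ^ (k + 1) / ((k.factorial : ℝ) * (k + 1).factorial))
    (g' := fun (k : ℕ) (y : ℝ) => y ^ k / ((k.factorial : ℝ) * k.factorial))
    (Real.summable_pow_div_factorial R) Metric.isOpen_ball
    (convex_ball (0 : ℝ) R).isPreconnected ?_ ?_ hy (hsum y) hy
  · convert! key using 1
    ext x
    rw [besselE1, ← tsum_mul_left]
    exact tsum_congr fun k => by ring
  · intro k x _
    convert! (hasDerivAt_pow (k + 1) x).div_const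
      ((k.factorial : ℝ) * (k + 1).factorial) using 1
    rw [Nat.factorial_succ]
    push_cast
    field_simp
  · intro k x hx
    have hx' : |x| ≤ R := by simpa using (Metric.mem_ball.1 hx).le
    rw [norm_div, norm_pow, Real.norm_eq_abs, norm_mul, Real.norm_natCast]
    have h : (1 : ℝ) ≤ k.factorial := by exact_mod_cast k.factorial_pos
    gcongr
    nlinarith

/-- The modified Bessel function `I₀`. -/
def besselI0 (x : ℝ) : ℝ := besselE0 (x ^ 2 / 4)

lemma besselI1_eq (x : ℝ) : besselI1 x = x / 2 * besselE1 (x ^ 2 / 4) := by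
  rw [besselI1, besselE1, ← tsum_mul_left]
  refine tsum_congr fun k => ?_
  have : x ^ 2 / 4 = (x / 2) ^ 2 := by ring
  rw [this, ← pow_mul, pow_succ]
  ring

lemma hasDerivAt_sq_div_four (x : ℝ) : HasDerivAt (fun x : ℝ => x ^ 2 / 4) (x / 2) x := by
  convert! (hasDerivAt_pow 2 x).div_const 4 using 1
  simp
  ring

lemma hasDerivAt_besselI0 (x : ℝ) : HasDerivAt besselI0 (besselI1 x) x := by
  rw [besselI1_eq, mul_comm]
  exact (hasDerivAt_besselE0 _).comp x (hasDerivAt_sq_div_four x)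

lemma hasDerivAt_mul_besselI1 (x : ℝ) :
    HasDerivAt (fun x => x * besselI1 x) (x * besselI0 x) x := by
  have h := ((hasDerivAt_mul_besselE1 _).comp x (hasDerivAt_sq_div_four x)).const_mul 2
  convert! h using 1
  · ext y
    simp only [besselI1_eq, Function.comp]
    ring
  · rw [besselI0]
    ring

lemma continuous_besselI0 : Continuous besselI0 :=
  continuous_iff_continuousAt.2 fun x => (hasDerivAt_besselI0 x).continuousAt

lemma hasDerivAt_besselI1 {x : ℝ} (hx : x ≠ 0) :
    HasDerivAt besselI1 (besselI0 x - besselI1 x / x) x := by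
  have h := (hasDerivAt_mul_besselI1 x).div (hasDerivAt_id x) hx
  refine (h.congr_of_eventuallyEq ?_).congr_deriv ?_
  · filter_upwards [isOpen_ne.mem_nhds hx] with y hy
    simp only [Pi.div_apply, id]
    exact (mul_div_cancel_left₀ _ hy).symm
  · simp only [id]
    field_simp

lemma tendsto_besselI1_zero : Tendsto besselI1 (𝓝[>] 0) (𝓝 0) := by
  have h : Tendsto (fun x : ℝ => x / 2 * besselE1 (x ^ 2 / 4)) (𝓝[>] 0) (𝓝 0) := by
    have hb : ∀ᶠ x : ℝ in 𝓝[>] 0, ‖x / 2 * besselE1 (x ^ 2 / 4)‖ ≤ x * besselE1 1 := by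
      filter_upwards [Ioo_mem_nhdsGT (zero_lt_one : (0 : ℝ) < 1)] with x hx
      have hx0 := hx.1
      have hE : 0 ≤ besselE1 (x ^ 2 / 4) := tsum_nonneg fun k => by positivity
      have hE1 : besselE1 (x ^ 2 / 4) ≤ besselE1 1 := by
        refine (summable_pow_div_factorial_mul_succ _).tsum_le_tsum (fun k => ?_)
          (summable_pow_div_factorial_mul_succ 1)
        have : x ^ 2 / 4 ≤ 1 := by nlinarith [hx.2]
        gcongr
      rw [Real.norm_of_nonneg (by positivity)]
      nlinarith
    refine squeeze_zero_norm' hb ?_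
    have : Tendsto (fun x : ℝ => x * besselE1 1) (𝓝 0) (𝓝 (0 * besselE1 1)) :=
      tendsto_id.mul_const _
    rw [zero_mul] at this
    exact this.mono_left nhdsWithin_le_nhds
  exact h.congr fun x => (besselI1_eq x).symm

end BesselSeries

/-! ### Integral representation: `K₀`, `K₁`, recurrences and bounds -/

section BesselIntegral

/-- `∫₀^∞ exp(-x cosh t) (cosh t)^n dt`. -/
def coshMoment (n : ℕ) (x : ℝ) : ℝ :=
  ∫ t in Ioi (0 : ℝ), Real.exp (-x * Real.cosh t) * Real.cosh t ^ n

lemma besselK1_eq (x : ℝ) : besselK1 x = coshMoment 1 x := by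
  simp [besselK1, coshMoment]

/-- Half of the exponent absorbs the power, by `y^n / n! ≤ e^y` with `y = (x/2) cosh t`; the other
half decays because `cosh t ≥ t`. -/
lemma exp_mul_cosh_pow_le (n : ℕ) {x t : ℝ} (hx : 0 < x) (ht : 0 ≤ t) :
    Real.exp (-x * Real.cosh t) * Real.cosh t ^ n ≤
      n.factorial * (2 / x) ^ n * Real.exp (-(x / 2) * t) := by
  have hc : t ≤ Real.cosh t := (Real.self_le_sinh_iff.2 ht).trans (Real.sinh_lt_cosh t).le
  have hc0 : 0 < Real.cosh t := Real.cosh_pos t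
  have h1 := Real.pow_div_factorial_le_exp (x / 2 * Real.cosh t) (by positivity) n
  have hf : (0 : ℝ) < n.factorial := by exact_mod_cast n.factorial_pos
  have h2 : Real.cosh t ^ n ≤ n.factorial * (2 / x) ^ n * Real.exp (x / 2 * Real.cosh t) := by
    rw [div_le_iff₀ hf, mul_pow] at h1
    have : Real.cosh t ^ n = (2 / x) ^ n * ((x / 2) ^ n * Real.cosh t ^ n) := by
      rw [← mul_assoc, ← mul_pow]
      field_simp
      simp
    rw [this]
    calc (2 / x) ^ n * ((x / 2) ^ n * Real.cosh t ^ n)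
        ≤ (2 / x) ^ n * (Real.exp (x / 2 * Real.cosh t) * n.factorial) := by gcongr
      _ = _ := by ring
  calc Real.exp (-x * Real.cosh t) * Real.cosh t ^ n
      ≤ Real.exp (-x * Real.cosh t) *
          (n.factorial * (2 / x) ^ n * Real.exp (x / 2 * Real.cosh t)) := by gcongr
    _ = n.factorial * (2 / x) ^ n * (Real.exp (-x * Real.cosh t) * Real.exp (x / 2 * Real.cosh t)) := by
        ring
    _ = n.factorial * (2 / x) ^ n * Real.exp (-(x / 2) * Real.cosh t) := by
        rw [← Real.exp_add]
        ring_nf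
    _ ≤ _ := by
        have : Real.exp (-(x / 2) * Real.cosh t) ≤ Real.exp (-(x / 2) * t) :=
          Real.exp_le_exp.2 (by nlinarith)
        gcongr

lemma integrableOn_exp_mul_cosh_pow (n : ℕ) {x : ℝ} (hx : 0 < x) :
    IntegrableOn (fun t => Real.exp (-x * Real.cosh t) * Real.cosh t ^ n) (Ioi 0) := by
  have hg : IntegrableOn
      (fun t : ℝ => n.factorial * (2 / x) ^ n * Real.exp (-(x / 2) * t)) (Ioi 0) :=
    (exp_neg_integrableOn_Ioi 0 (by positivity : 0 < x / 2)).const_mul _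
  refine Integrable.mono' hg (by fun_prop) ?_
  filter_upwards [ae_restrict_mem measurableSet_Ioi] with t ht
  rw [Real.norm_of_nonneg (by have := Real.cosh_pos t; positivity)]
  exact exp_mul_cosh_pow_le n hx (mem_Ioi.1 ht).le

lemma hasDerivAt_coshMoment (n : ℕ) {x : ℝ} (hx : 0 < x) :
    HasDerivAt (coshMoment n) (-coshMoment (n + 1) x) x := by
  -- On this neighbourhood the integrand at `x / 2` is a majorant that does not depend on the point.
  have hs : Ioi (x / 2) ∈ 𝓝 x := Ioi_mem_nhds (by linarith)
  have key := (hasDerivAt_integral_of_dominated_loc_of_deriv_le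
    (μ := volume.restrict (Ioi (0 : ℝ)))
    (F := fun x t => Real.exp (-x * Real.cosh t) * Real.cosh t ^ n)
    (F' := fun x t => -(Real.exp (-x * Real.cosh t) * Real.cosh t ^ (n + 1)))
    (bound := fun t => Real.exp (-(x / 2) * Real.cosh t) * Real.cosh t ^ (n + 1))
    hs (Eventually.of_forall fun y => by fun_prop) (integrableOn_exp_mul_cosh_pow n hx)
    (by fun_prop) ?_ (integrableOn_exp_mul_cosh_pow (n + 1) (by positivity)) ?_).2
  · rw [integral_neg] at key
    exact key
  · refine Eventually.of_forall fun t y hy => ?_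
    have hc := Real.cosh_pos t
    rw [norm_neg, Real.norm_of_nonneg (by positivity)]
    have : Real.exp (-y * Real.cosh t) ≤ Real.exp (-(x / 2) * Real.cosh t) :=
      Real.exp_le_exp.2 (by nlinarith [mem_Ioi.1 hy])
    gcongr
  · refine Eventually.of_forall fun t y _ => ?_
    have h := (((hasDerivAt_id y).neg.mul_const (Real.cosh t)).exp).mul_const (Real.cosh t ^ n)
    refine h.congr_deriv ?_
    simp
    ring

/-- The integrand is the derivative of `exp(-x cosh t) sinh t`, once `sinh²` is replaced by `cosh² -
1`, and this function vanishes at `0` and at infinity. It expresses the second moment through `K₀`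
and `K₁`, which gives `K₁' = -K₀ - K₁/x`. -/
lemma coshMoment_relation {x : ℝ} (hx : 0 < x) :
    coshMoment 1 x - x * coshMoment 2 x + x * coshMoment 0 x = 0 := by
  have hd : ∀ t ∈ Ioi (0 : ℝ), HasDerivAt (fun t => Real.exp (-x * Real.cosh t) * Real.sinh t)
      (Real.exp (-x * Real.cosh t) * Real.cosh t ^ 1
        - x * (Real.exp (-x * Real.cosh t) * Real.cosh t ^ 2)
        + x * (Real.exp (-x * Real.cosh t) * Real.cosh t ^ 0)) t := by
    intro t _
    have h := (((Real.hasDerivAt_cosh t).const_mul (-x)).exp).mul (Real.hasDerivAt_sinh t)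
    refine h.congr_deriv ?_
    have := Real.cosh_sq t
    simp only [pow_one, pow_zero, this]
    ring
  have h1 := integrableOn_exp_mul_cosh_pow 1 hx
  have h2 := (integrableOn_exp_mul_cosh_pow 2 hx).const_mul x
  have h0 := (integrableOn_exp_mul_cosh_pow 0 hx).const_mul x
  have hlim : Tendsto (fun t => Real.exp (-x * Real.cosh t) * Real.sinh t) atTop (𝓝 0) := by
    have hb : Tendsto (fun t : ℝ => (1 : ℕ).factorial * (2 / x) ^ 1 * Real.exp (-(x / 2) * t))
        atTop (𝓝 (((1 : ℕ).factorial : ℝ) * (2 / x) ^ 1 * 0)) := by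
      refine Tendsto.const_mul _ (Real.tendsto_exp_atBot.comp ?_)
      exact tendsto_id.const_mul_atTop_of_neg (by linarith)
    rw [mul_zero] at hb
    refine squeeze_zero_norm' ?_ hb
    filter_upwards [eventually_ge_atTop (0 : ℝ)] with t ht
    have hs : 0 ≤ Real.sinh t := Real.sinh_nonneg_iff.2 ht
    rw [Real.norm_of_nonneg (by positivity)]
    refine le_trans ?_ (exp_mul_cosh_pow_le 1 hx ht)
    rw [pow_one]
    have := (Real.sinh_lt_cosh t).le
    gcongr
  have key := integral_Ioi_of_hasDerivAt_of_tendsto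
    (by fun_prop : Continuous _).continuousWithinAt hd ((h1.sub h2).add h0) hlim
  rw [integral_add (by exact h1.sub h2) h0, integral_sub h1 h2, integral_const_mul,
    integral_const_mul] at key
  simpa [coshMoment] using key

/-- The modified Bessel function `K₀`, for positive arguments. -/
def besselK0 (x : ℝ) : ℝ := coshMoment 0 x

lemma hasDerivAt_besselK0 {x : ℝ} (hx : 0 < x) : HasDerivAt besselK0 (-besselK1 x) x := by
  rw [besselK1_eq]
  exact hasDerivAt_coshMoment 0 hx

lemma hasDerivAt_besselK1 {x : ℝ} (hx : 0 < x) :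
    HasDerivAt besselK1 (-besselK0 x - besselK1 x / x) x := by
  rw [show besselK1 = coshMoment 1 from funext besselK1_eq, besselK0]
  refine (hasDerivAt_coshMoment 1 hx).congr_deriv ?_
  have := coshMoment_relation hx
  field_simp
  linarith

lemma coshMoment_nonneg (n : ℕ) (x : ℝ) : 0 ≤ coshMoment n x :=
  integral_nonneg fun t => by have := Real.cosh_pos t; positivity

lemma coshMoment_antitoneOn (n : ℕ) : AntitoneOn (coshMoment n) (Ioi 0) := by
  intro x hx y hy hxy
  refine setIntegral_mono_on (integrableOn_exp_mul_cosh_pow n hy)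
    (integrableOn_exp_mul_cosh_pow n hx) measurableSet_Ioi fun t _ => ?_
  have hc := Real.cosh_pos t
  have : Real.exp (-y * Real.cosh t) ≤ Real.exp (-x * Real.cosh t) :=
    Real.exp_le_exp.2 (by nlinarith)
  gcongr

lemma besselK0_le_besselK1 {x : ℝ} (hx : 0 < x) : besselK0 x ≤ besselK1 x := by
  rw [besselK1_eq]
  refine setIntegral_mono_on (integrableOn_exp_mul_cosh_pow 0 hx)
    (integrableOn_exp_mul_cosh_pow 1 hx) measurableSet_Ioi fun t _ => ?_
  rw [pow_zero, pow_one]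
  have := Real.one_le_cosh t
  gcongr

/-- Replacing `cosh t` by `sinh t` in the exponent makes the integral explicit: `x cosh t exp(-x
sinh t)` is an exact derivative with integral `1`. The bounds come from `sinh t ≤ cosh t ≤ sinh t +
1`. They give `x K₁(x) → 1` at `0`, which normalises the Wronskian. -/
lemma mul_besselK1_bounds {x : ℝ} (hx : 0 < x) :
    Real.exp (-x) ≤ x * besselK1 x ∧ x * besselK1 x ≤ 1 := by
  have hd : ∀ t ∈ Ioi (0 : ℝ), HasDerivAt (fun t => -Real.exp (-x * Real.sinh t))
      (x * (Real.cosh t * Real.exp (-x * Real.sinh t))) t := by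
    intro t _
    refine (((Real.hasDerivAt_sinh t).const_mul (-x)).exp).neg.congr_deriv ?_
    ring
  have hpos : ∀ t ∈ Ioi (0 : ℝ), 0 ≤ x * (Real.cosh t * Real.exp (-x * Real.sinh t)) :=
    fun t _ => by have := Real.cosh_pos t; positivity
  have hlim : Tendsto (fun t => -Real.exp (-x * Real.sinh t)) atTop (𝓝 0) := by
    rw [← neg_zero]
    refine (Real.tendsto_exp_atBot.comp ?_).neg
    refine Tendsto.const_mul_atTop_of_neg (by linarith) ?_
    refine tendsto_atTop_mono' _ ?_ tendsto_id
    filter_upwards [eventually_ge_atTop (0 : ℝ)] with t ht using Real.self_le_sinh_iff.2 ht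
  have hcont : ContinuousWithinAt (fun t => -Real.exp (-x * Real.sinh t)) (Ici 0) 0 :=
    (by fun_prop : Continuous _).continuousWithinAt
  have hint := integrableOn_Ioi_deriv_of_nonneg hcont hd hpos hlim
  have hval := integral_Ioi_of_hasDerivAt_of_nonneg hcont hd hpos hlim
  simp only [Real.sinh_zero, mul_zero, Real.exp_zero, sub_neg_eq_add, zero_add] at hval
  have hK := (integrableOn_exp_mul_cosh_pow 1 hx).const_mul x
  have hxK : x * besselK1 x =
      ∫ t in Ioi (0 : ℝ), x * (Real.exp (-x * Real.cosh t) * Real.cosh t ^ 1) := by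
    rw [integral_const_mul, besselK1_eq, coshMoment]
  constructor
  · rw [hxK, ← mul_one (Real.exp (-x)), ← hval, ← integral_const_mul]
    refine setIntegral_mono_on (hint.const_mul _) hK measurableSet_Ioi fun t ht => ?_
    have hc := Real.cosh_pos t
    have hsc : Real.cosh t ≤ Real.sinh t + 1 := by
      have := Real.cosh_sub_sinh t
      have : Real.exp (-t) ≤ 1 := Real.exp_le_one_iff.2 (by linarith [mem_Ioi.1 ht])
      linarith
    have : Real.exp (-x) * Real.exp (-x * Real.sinh t) ≤ Real.exp (-x * Real.cosh t) := by
      rw [← Real.exp_add]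
      exact Real.exp_le_exp.2 (by nlinarith)
    calc Real.exp (-x) * (x * (Real.cosh t * Real.exp (-x * Real.sinh t)))
        = x * ((Real.exp (-x) * Real.exp (-x * Real.sinh t)) * Real.cosh t ^ 1) := by ring
      _ ≤ _ := by gcongr
  · rw [hxK, ← hval]
    refine setIntegral_mono_on hK hint measurableSet_Ioi fun t _ => ?_
    have hc := Real.cosh_pos t
    have : Real.exp (-x * Real.cosh t) ≤ Real.exp (-x * Real.sinh t) :=
      Real.exp_le_exp.2 (by nlinarith [Real.sinh_lt_cosh t])
    rw [pow_one, mul_comm (Real.cosh t)]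
    gcongr

end BesselIntegral

/-- The Wronskian identity for the modified Bessel functions. -/
lemma besselI0_mul_besselK1_add {x : ℝ} (hx : 0 < x) :
    x * (besselI0 x * besselK1 x + besselI1 x * besselK0 x) = 1 := by
  set W : ℝ → ℝ := fun x => x * (besselI0 x * besselK1 x + besselI1 x * besselK0 x) with hW
  have hd : ∀ x ∈ Ioi (0 : ℝ), HasDerivAt W 0 x := by
    intro x hx
    have hx0 : x ≠ 0 := (mem_Ioi.1 hx).ne'
    have h := (hasDerivAt_id x).mul
      (((hasDerivAt_besselI0 x).mul (hasDerivAt_besselK1 hx)).add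
        ((hasDerivAt_besselI1 hx0).mul (hasDerivAt_besselK0 hx)))
    refine h.congr_deriv ?_
    simp only [id, Pi.add_apply, Pi.mul_apply]
    field_simp
    ring
  -- The recurrences make `W` constant; its value is read off at `0⁺`, where `x K₁ → 1`, `I₀ → 1`,
  -- and `I₁ · x K₀ → 0` because `x K₀ ≤ x K₁ ≤ 1`.
  have hlim : Tendsto W (𝓝[>] 0) (𝓝 1) := by
    have h1 : Tendsto (fun x : ℝ => x * besselK1 x) (𝓝[>] 0) (𝓝 1) := by
      have he : Tendsto (fun x : ℝ => Real.exp (-x)) (𝓝[>] 0) (𝓝 1) := by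
        have : Tendsto (fun x : ℝ => Real.exp (-x)) (𝓝 0) (𝓝 (Real.exp (-0))) :=
          (by fun_prop : Continuous fun x : ℝ => Real.exp (-x)).tendsto 0
        simp only [neg_zero, Real.exp_zero] at this
        exact this.mono_left nhdsWithin_le_nhds
      refine tendsto_of_tendsto_of_tendsto_of_le_of_le' he tendsto_const_nhds ?_ ?_
      · filter_upwards [self_mem_nhdsWithin] with x hx using (mul_besselK1_bounds hx).1
      · filter_upwards [self_mem_nhdsWithin] with x hx using (mul_besselK1_bounds hx).2
    have h2 : Tendsto besselI0 (𝓝[>] 0) (𝓝 1) := by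
      have : Tendsto besselI0 (𝓝 0) (𝓝 (besselI0 0)) := continuous_besselI0.tendsto 0
      have h0 : besselI0 0 = 1 := by
        rw [besselI0, besselE0, tsum_eq_single 0]
        · simp
        · intro k hk
          simp [hk]
      rw [h0] at this
      exact this.mono_left nhdsWithin_le_nhds
    have h3 : Tendsto (fun x : ℝ => besselI1 x * (x * besselK0 x)) (𝓝[>] 0) (𝓝 0) := by
      refine tendsto_besselI1_zero.zero_mul_isBoundedUnder_le
        (isBoundedUnder_of_eventually_le (a := 1) ?_)
      filter_upwards [self_mem_nhdsWithin] with x hx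
      have hx0 : 0 < x := hx
      have hK : 0 ≤ besselK0 x := coshMoment_nonneg 0 x
      simp only [Function.comp]
      rw [Real.norm_of_nonneg (by positivity)]
      exact (mul_le_mul_of_nonneg_left (besselK0_le_besselK1 hx0) hx0.le).trans
        (mul_besselK1_bounds hx0).2
    have := (h2.mul h1).add h3
    rw [mul_one, add_zero] at this
    refine this.congr fun x => ?_
    simp only [hW]
    ring
  have hconst : ∀ y ∈ Ioi (0 : ℝ), W y = W x := fun y hy =>
    isOpen_Ioi.is_const_of_deriv_eq_zero isPreconnected_Ioi
      (fun z hz => (hd z hz).differentiableAt.differentiableWithinAt)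
      (fun z hz => (hd z hz).deriv) hy hx
  have : Tendsto W (𝓝[>] 0) (𝓝 (W x)) := tendsto_const_nhds.congr' (by
    filter_upwards [self_mem_nhdsWithin] with y hy using (hconst y hy).symm)
  exact tendsto_nhds_unique this hlim

end AxisymBS

end

noncomputable section

namespace AxisymBS

open scoped Topology

/-! ### Primitives on `(1, ∞)` and a countable du Bois-Reymond lemma -/

/-- Both factors are absolutely continuous: `k` is Lipschitz because `k'` is bounded on `[a, b]`,
and the other factor is the primitive of an integrable function. Its derivative is `w` only almost
everywhere. -/
lemma integral_deriv_mul_primitive_real {k k' w : ℝ → ℝ} {a b : ℝ} (hab : a ≤ b)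
    (hk : ∀ x ∈ Icc a b, HasDerivAt k (k' x) x) (hk' : ContinuousOn k' (Icc a b))
    (hw : IntervalIntegrable w volume a b) :
    (∫ x in a..b, k' x * ∫ t in a..x, w t) + ∫ x in a..b, k x * w x = k b * ∫ t in a..b, w t := by
  have hkc : ContinuousOn k (uIcc a b) := by
    rw [uIcc_of_le hab]
    exact fun x hx => (hk x hx).continuousAt.continuousWithinAt
  have hkac : AbsolutelyContinuousOnInterval k a b := by
    obtain ⟨C, hC⟩ := isCompact_Icc.exists_bound_of_continuousOn hk'
    refine LipschitzOnWith.absolutelyContinuousOnInterval (K := Real.toNNReal C) ?_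
    rw [uIcc_of_le hab]
    refine (convex_Icc a b).lipschitzOnWith_of_nnnorm_hasDerivWithin_le
      (fun x hx => (hk x hx).hasDerivWithinAt) fun x hx => ?_
    rw [← norm_toNNReal]
    exact Real.toNNReal_le_toNNReal (hC x hx)
  have hWac : AbsolutelyContinuousOnInterval (fun x => ∫ t in a..x, w t) a b :=
    hw.absolutelyContinuousOnInterval_intervalIntegral left_mem_uIcc
  have key := hkac.integral_deriv_mul_eq_sub hWac
  simp only [intervalIntegral.integral_same, mul_zero, sub_zero] at key
  rw [← key, ← intervalIntegral.integral_add]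
  · refine intervalIntegral.integral_congr_ae ?_
    filter_upwards [hw.ae_hasDerivAt_integral] with x hx hxm
    have hx' := uIoc_subset_uIcc hxm
    rw [(hx hx' a left_mem_uIcc).deriv, (hk x (by rwa [uIcc_of_le hab] at hx')).deriv]
  · refine ContinuousOn.intervalIntegrable ?_
    rw [uIcc_of_le hab]
    refine hk'.mul ?_
    have := hWac.continuousOn
    rwa [uIcc_of_le hab] at this
  · exact hw.continuousOn_mul hkc

/-- Integration by parts against a primitive of an integrable function. -/
lemma integral_deriv_mul_primitive {k k' : ℝ → ℝ} {w : ℝ → ℂ} {a b : ℝ} (hab : a ≤ b)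
    (hk : ∀ x ∈ Icc a b, HasDerivAt k (k' x) x) (hk' : ContinuousOn k' (Icc a b))
    (hw : IntervalIntegrable w volume a b) :
    (∫ x in a..b, (k' x : ℂ) * ∫ t in a..x, w t) + ∫ x in a..b, (k x : ℂ) * w x =
      (k b : ℂ) * ∫ t in a..b, w t := by
  have hkc : ContinuousOn k (Icc a b) := fun x hx => (hk x hx).continuousAt.continuousWithinAt
  have hw1 : IntegrableOn w (Ioc a b) := (intervalIntegrable_iff_integrableOn_Ioc_of_le hab).1 hw
  have hWc : ContinuousOn (fun x => ∫ t in a..x, w t) (Icc a b) := by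
    have := intervalIntegral.continuousOn_primitive_interval (μ := volume) (f := w) (a := a) (b := b)
      (by rw [uIcc_of_le hab]; exact (integrableOn_Icc_iff_integrableOn_Ioc).2 hw1)
    rwa [uIcc_of_le hab] at this
  have hA : IntegrableOn (fun x => (k' x : ℂ) * ∫ t in a..x, w t) (Ioc a b) :=
    (((Complex.continuous_ofReal.comp_continuousOn hk').mul hWc).integrableOn_Icc).mono_set
      Ioc_subset_Icc_self
  have hB : IntegrableOn (fun x => (k x : ℂ) * w x) (Ioc a b) := by
    have := hw.continuousOn_mul (g := fun x => (k x : ℂ))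
      (by rw [uIcc_of_le hab]; exact Complex.continuous_ofReal.comp_continuousOn hkc)
    exact (intervalIntegrable_iff_integrableOn_Ioc_of_le hab).1 this
  have hsub (x : ℝ) (hx : x ∈ Ioc a b) : IntegrableOn w (Ioc a x) :=
    hw1.mono_set (Ioc_subset_Ioc_right hx.2)
  -- As `k` is real, the real formula applies separately to the real and imaginary parts of `w`.
  apply Complex.ext
  · have hre : IntervalIntegrable (fun x => (w x).re) volume a b :=
      (intervalIntegrable_iff_integrableOn_Ioc_of_le hab).2 hw1.re
    have key := integral_deriv_mul_primitive_real hab hk hk' hre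
    simp only [intervalIntegral.integral_of_le hab] at key ⊢
    have e1 := integral_re (𝕜 := ℂ) hA
    have e2 := integral_re (𝕜 := ℂ) hB
    have e3 := integral_re (𝕜 := ℂ) hw1
    simp only [RCLike.re_eq_complex_re, Complex.re_ofReal_mul] at e1 e2 e3
    rw [Complex.add_re, Complex.re_ofReal_mul, ← e1, ← e2, ← e3, ← key]
    congr 1
    refine setIntegral_congr_fun measurableSet_Ioc fun x hx => ?_
    have e4 := integral_re (𝕜 := ℂ) (hsub x hx)
    simp only [RCLike.re_eq_complex_re] at e4
    simp only [intervalIntegral.integral_of_le hx.1.le, e4]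
  · have him : IntervalIntegrable (fun x => (w x).im) volume a b :=
      (intervalIntegrable_iff_integrableOn_Ioc_of_le hab).2 hw1.im
    have key := integral_deriv_mul_primitive_real hab hk hk' him
    simp only [intervalIntegral.integral_of_le hab] at key ⊢
    have e1 := integral_im (𝕜 := ℂ) hA
    have e2 := integral_im (𝕜 := ℂ) hB
    have e3 := integral_im (𝕜 := ℂ) hw1
    simp only [RCLike.im_eq_complex_im, Complex.im_ofReal_mul] at e1 e2 e3
    rw [Complex.add_im, Complex.im_ofReal_mul, ← e1, ← e2, ← e3, ← key]
    congr 1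
    refine setIntegral_congr_fun measurableSet_Ioc fun x hx => ?_
    have e4 := integral_im (𝕜 := ℂ) (hsub x hx)
    simp only [RCLike.im_eq_complex_im] at e4
    simp only [intervalIntegral.integral_of_le hx.1.le, e4]

/-- Smooth functions with values in `[0, 1]`, supported in `(p, q)`, that increase to its
indicator. -/
def plateau (p q : ℝ) (n : ℕ) (s : ℝ) : ℝ :=
  Real.smoothTransition (n * (s - p) - 1) * Real.smoothTransition (n * (q - s) - 1)

lemma contDiff_plateau (p q : ℝ) (n : ℕ) {m : ℕ∞} : ContDiff ℝ m (plateau p q n) :=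
  (Real.smoothTransition.contDiff.comp (by fun_prop)).mul
    (Real.smoothTransition.contDiff.comp (by fun_prop))

lemma norm_plateau_le (p q : ℝ) (n : ℕ) (s : ℝ) : ‖plateau p q n s‖ ≤ 1 := by
  have h1 := Real.smoothTransition.nonneg (n * (s - p) - 1)
  have h2 := Real.smoothTransition.nonneg (n * (q - s) - 1)
  have h3 := Real.smoothTransition.le_one (n * (s - p) - 1)
  have h4 := Real.smoothTransition.le_one (n * (q - s) - 1)
  rw [plateau, Real.norm_of_nonneg (by positivity)]
  nlinarith

lemma plateau_eq_zero_of_le {p q : ℝ} (n : ℕ) {s : ℝ} (h : s ≤ p) : plateau p q n s = 0 := by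
  have : (n : ℝ) * (s - p) ≤ 0 := mul_nonpos_of_nonneg_of_nonpos (by positivity) (by linarith)
  rw [plateau, Real.smoothTransition.zero_of_nonpos (by linarith), zero_mul]

lemma plateau_eq_zero_of_ge {p q : ℝ} (n : ℕ) {s : ℝ} (h : q ≤ s) : plateau p q n s = 0 := by
  have : (n : ℝ) * (q - s) ≤ 0 := mul_nonpos_of_nonneg_of_nonpos (by positivity) (by linarith)
  rw [plateau, Real.smoothTransition.zero_of_nonpos (x := n * (q - s) - 1) (by linarith), mul_zero]

lemma tendsto_plateau (p q s : ℝ) :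
    Tendsto (fun n => plateau p q n s) atTop (𝓝 ((Ioo p q).indicator 1 s)) := by
  by_cases hs : s ∈ Ioo p q
  · rw [indicator_of_mem hs]
    refine tendsto_const_nhds.congr' ?_
    have h1 := (tendsto_natCast_atTop_atTop (R := ℝ)).atTop_mul_const (sub_pos.2 hs.1)
    have h2 := (tendsto_natCast_atTop_atTop (R := ℝ)).atTop_mul_const (sub_pos.2 hs.2)
    filter_upwards [h1.eventually_ge_atTop 2, h2.eventually_ge_atTop 2] with n hn1 hn2
    rw [plateau, Real.smoothTransition.one_of_one_le (by linarith),
      Real.smoothTransition.one_of_one_le (by linarith), mul_one, Pi.one_apply]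
  · rw [indicator_of_notMem hs]
    refine tendsto_const_nhds.congr fun n => ?_
    by_cases h : s ≤ p
    · exact (plateau_eq_zero_of_le n h).symm
    · exact (plateau_eq_zero_of_ge n (not_lt.1 fun h' => hs ⟨not_le.1 h, h'⟩)).symm

/-- A compactly supported primitive of `plateau p q n` on `(1, ∞)`. -/
def plateauPrimitive (p q : ℝ) (n : ℕ) (r : ℝ) : ℝ :=
  Real.smoothTransition (2 * r) * ((∫ s in (0 : ℝ)..r, plateau p q n s) -
    ∫ s in (0 : ℝ)..q, plateau p q n s)

lemma hasDerivAt_integral_plateau (p q : ℝ) (n : ℕ) (r : ℝ) :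
    HasDerivAt (fun r => ∫ s in (0 : ℝ)..r, plateau p q n s) (plateau p q n r) r :=
  ((contDiff_plateau p q n (m := 0)).continuous.integral_hasStrictDerivAt 0 r).hasDerivAt

lemma contDiff_plateauPrimitive (p q : ℝ) (n : ℕ) :
    ContDiff ℝ ((⊤ : ℕ∞) : WithTop ℕ∞) (plateauPrimitive p q n) := by
  have h : ContDiff ℝ ((⊤ : ℕ∞) : WithTop ℕ∞) (fun r => ∫ s in (0 : ℝ)..r, plateau p q n s) := by
    rw [contDiff_infty_iff_deriv]
    refine ⟨fun r => (hasDerivAt_integral_plateau p q n r).differentiableAt, ?_⟩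
    rw [show deriv (fun r => ∫ s in (0 : ℝ)..r, plateau p q n s) = plateau p q n from
      funext fun r => (hasDerivAt_integral_plateau p q n r).deriv]
    exact contDiff_plateau p q n
  exact (Real.smoothTransition.contDiff.comp (by fun_prop)).mul (h.sub contDiff_const)

/-- The subtracted constant is chosen to produce zero beyond `q`. At `r = 1` the function is in
general not zero, and it is this that lets the test functions detect the boundary value. -/
lemma plateauPrimitive_eq_zero_of_ge {p q : ℝ} (n : ℕ) {r : ℝ} (h : q ≤ r) :
    plateauPrimitive p q n r = 0 := by
  have hi (a b : ℝ) : IntervalIntegrable (plateau p q n) volume a b :=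
    (contDiff_plateau p q n (m := 0)).continuous.intervalIntegrable a b
  rw [plateauPrimitive, intervalIntegral.integral_interval_sub_left (hi 0 r) (hi 0 q),
    intervalIntegral.integral_zero_ae, mul_zero]
  refine Eventually.of_forall fun s hs => plateau_eq_zero_of_ge n ?_
  rw [uIoc_of_le h] at hs
  exact hs.1.le

lemma hasCompactSupport_plateauPrimitive (p q : ℝ) (n : ℕ) :
    HasCompactSupport (plateauPrimitive p q n) := by
  refine HasCompactSupport.intro (K := Icc 0 q) isCompact_Icc fun r hr => ?_
  by_cases h : r < 0
  · rw [plateauPrimitive, Real.smoothTransition.zero_of_nonpos (by linarith), zero_mul]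
  · exact plateauPrimitive_eq_zero_of_ge n (not_lt.1 fun h' => hr ⟨not_lt.1 h, h'.le⟩)

lemma hasDerivAt_plateauPrimitive (p q : ℝ) (n : ℕ) {r : ℝ} (hr : 1 ≤ r) :
    HasDerivAt (plateauPrimitive p q n) (plateau p q n r) r := by
  refine ((hasDerivAt_integral_plateau p q n r).sub_const
    (∫ s in (0 : ℝ)..q, plateau p q n s)).congr_of_eventuallyEq ?_
  filter_upwards [Ioi_mem_nhds (show (1 / 2 : ℝ) < r by linarith)] with s hs
  rw [plateauPrimitive, Real.smoothTransition.one_of_one_le (by linarith [mem_Ioi.1 hs]), one_mul]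

lemma continuousOn_primitive_Ici {w : ℝ → ℂ} {a : ℝ}
    (hw : ∀ R, a ≤ R → IntervalIntegrable w volume a R) :
    ContinuousOn (fun r => ∫ s in a..r, w s) (Ici a) := by
  intro r hr
  have h1 : IntegrableOn w (uIcc a (r + 1)) := by
    have hr' : a ≤ r + 1 := by linarith [mem_Ici.1 hr]
    rw [uIcc_of_le hr', integrableOn_Icc_iff_integrableOn_Ioc]
    exact (intervalIntegrable_iff_integrableOn_Ioc_of_le hr').1 (hw _ hr')
  have h2 := intervalIntegral.continuousOn_primitive_interval h1
  rw [uIcc_of_le (by linarith [mem_Ici.1 hr])] at h2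
  refine (h2 r ⟨hr, by linarith⟩).mono_of_mem_nhdsWithin ?_
  filter_upwards [self_mem_nhdsWithin, mem_nhdsWithin_of_mem_nhds (Iio_mem_nhds (lt_add_one r))]
    with s hs1 hs2 using ⟨hs1, (mem_Iio.1 hs2).le⟩

/-- The derivative of a primitive, almost everywhere. -/
lemma ae_hasDerivAt_primitive {w : ℝ → ℂ} {a : ℝ}
    (hw : ∀ R, a ≤ R → IntervalIntegrable w volume a R) :
    ∀ᵐ r ∂(volume.restrict (Ioi a)), HasDerivAt (fun r => ∫ s in a..r, w s) (w r) r := by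
  rw [ae_restrict_iff' measurableSet_Ioi]
  have h : ∀ᵐ r : ℝ, ∀ N : ℕ, r ∈ uIcc a (a + N) → ∀ c ∈ uIcc a (a + N),
      HasDerivAt (fun r => ∫ s in c..r, w s) (w r) r :=
    ae_all_iff.2 fun N => (hw (a + N) (by simp)).ae_hasDerivAt_integral
  filter_upwards [h] with r hr hra
  obtain ⟨N, hN⟩ := exists_nat_ge (r - a)
  refine hr N ?_ a left_mem_uIcc
  rw [uIcc_of_le (by simp)]
  exact ⟨(mem_Ioi.1 hra).le, by linarith⟩

/-- Difference of the tested identity and an integration by parts for `∫₁^r w`. The latter has no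
boundary terms: the primitive of `w` vanishes at `1`, the test function at `q`. -/
lemma integral_plateau_mul_sub_primitive_eq_zero {f w : ℝ → ℂ}
    (hf : ∀ R, 1 ≤ R → IntervalIntegrable f volume 1 R)
    (hw : ∀ R, 1 ≤ R → IntervalIntegrable w volume 1 R) {p q : ℝ} (hp : 1 < p) (hpq : p < q) (n : ℕ)
    (h : ∫ r in Ioi (1 : ℝ), ((deriv (plateauPrimitive p q n) r : ℝ) : ℂ) * f r
      + (plateauPrimitive p q n r : ℂ) * w r = 0) :
    ∫ r in (1 : ℝ)..q, (plateau p q n r : ℂ) * (f r - ∫ s in (1 : ℝ)..r, w s) = 0 := by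
  have hq : 1 ≤ q := by linarith
  have hpc : Continuous (plateau p q n) := (contDiff_plateau p q n (m := 0)).continuous
  have hPc : Continuous (plateauPrimitive p q n) := (contDiff_plateauPrimitive p q n).continuous
  have e1 : ∫ r in Ioi (1 : ℝ), ((deriv (plateauPrimitive p q n) r : ℝ) : ℂ) * f r
      + (plateauPrimitive p q n r : ℂ) * w r =
      ∫ r in (1 : ℝ)..q, ((plateau p q n r : ℂ) * f r + (plateauPrimitive p q n r : ℂ) * w r) := by
    rw [intervalIntegral.integral_of_le hq]
    symm
    rw [← setIntegral_eq_of_subset_of_forall_sdiff_eq_zero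
      measurableSet_Ioi (s := Ioc 1 q) Ioc_subset_Ioi_self]
    · refine setIntegral_congr_fun measurableSet_Ioi fun r hr => ?_
      simp only [(hasDerivAt_plateauPrimitive p q n (mem_Ioi.1 hr).le).deriv]
    · intro r hr
      have hr1 : 1 < r := hr.1
      have hqr : q ≤ r := (not_le.1 fun h => hr.2 ⟨hr1, h⟩).le
      rw [plateau_eq_zero_of_ge n hqr, plateauPrimitive_eq_zero_of_ge n hqr]
      simp
  have hWc : ContinuousOn (fun r => ∫ s in (1 : ℝ)..r, w s) (uIcc 1 q) := by
    rw [uIcc_of_le hq]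
    exact (continuousOn_primitive_Ici hw).mono Icc_subset_Ici_self
  have hpf : IntervalIntegrable (fun r => (plateau p q n r : ℂ) * f r) volume 1 q :=
    (hf q hq).continuousOn_mul (by fun_prop)
  have hPw : IntervalIntegrable (fun r => (plateauPrimitive p q n r : ℂ) * w r) volume 1 q :=
    (hw q hq).continuousOn_mul (by fun_prop)
  have hpW : IntervalIntegrable (fun r => (plateau p q n r : ℂ) * ∫ s in (1 : ℝ)..r, w s)
      volume 1 q :=
    ContinuousOn.intervalIntegrable ((by fun_prop : Continuous fun r => (plateau p q n r : ℂ)).continuousOn.mul hWc)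
  have e2 := integral_deriv_mul_primitive hq
    (fun x hx => hasDerivAt_plateauPrimitive p q n hx.1) hpc.continuousOn (hw q hq)
  rw [plateauPrimitive_eq_zero_of_ge n le_rfl, Complex.ofReal_zero, zero_mul] at e2
  rw [e1, intervalIntegral.integral_add hpf hPw] at h
  simp only [mul_sub]
  rw [intervalIntegral.integral_sub hpf hpW]
  linear_combination h - e2

/-- The difference `D = f - ∫₁^r w` has integral zero against every plateau, hence over every
interval with rational endpoints in `(1, ∞)`. Its own primitive is therefore constant, and Lebesgue
differentiation gives `D = 0`. -/
lemma ae_eq_primitive_of_plateau {f w : ℝ → ℂ}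
    (hf : ∀ R, 1 ≤ R → IntervalIntegrable f volume 1 R)
    (hw : ∀ R, 1 ≤ R → IntervalIntegrable w volume 1 R)
    (h : ∀ (p q : ℚ) (n : ℕ), 1 < p → p < q →
      ∫ r in Ioi (1 : ℝ), ((deriv (plateauPrimitive p q n) r : ℝ) : ℂ) * f r
        + (plateauPrimitive p q n r : ℂ) * w r = 0) :
    ∀ᵐ r ∂(volume.restrict (Ioi (1 : ℝ))), f r = ∫ s in (1 : ℝ)..r, w s := by
  set D : ℝ → ℂ := fun r => f r - ∫ s in (1 : ℝ)..r, w s with hD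
  have hDi : ∀ R, 1 ≤ R → IntervalIntegrable D volume 1 R := fun R hR => by
    refine (hf R hR).sub (ContinuousOn.intervalIntegrable ?_)
    rw [uIcc_of_le hR]
    exact (continuousOn_primitive_Ici hw).mono Icc_subset_Ici_self
  have hDi' (a b : ℝ) (ha : 1 ≤ a) (hb : 1 ≤ b) : IntervalIntegrable D volume a b :=
    (hDi a ha).symm.trans (hDi b hb)
  have hzero : ∀ p q : ℚ, 1 < p → p < q → ∫ r in (p : ℝ)..q, D r = 0 := by
    intro p q hp hpq
    have hp' : (1 : ℝ) < p := by exact_mod_cast hp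
    have hpq' : (p : ℝ) < q := by exact_mod_cast hpq
    have hq' : (1 : ℝ) ≤ q := by linarith
    have hlim : Tendsto (fun n : ℕ => ∫ r in (1 : ℝ)..q, (plateau p q n r : ℂ) * D r) atTop
        (𝓝 (∫ r in (1 : ℝ)..q, (((Ioo (p : ℝ) q).indicator (1 : ℝ → ℝ) r : ℝ) : ℂ) * D r)) := by
      refine intervalIntegral.tendsto_integral_filter_of_dominated_convergence (fun r => ‖D r‖)
        (Eventually.of_forall fun n => ?_) (Eventually.of_forall fun n => ?_) (hDi q hq').norm ?_
      · have hc : Continuous fun r => (plateau p q n r : ℂ) :=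
          Complex.continuous_ofReal.comp (contDiff_plateau p q n (m := 0)).continuous
        exact hc.aestronglyMeasurable.mul (by
          have := (hDi q hq').aestronglyMeasurable
          rwa [uIoc_of_le hq'])
      · refine Eventually.of_forall fun r _ => ?_
        rw [norm_mul, Complex.norm_real]
        exact mul_le_of_le_one_left (norm_nonneg _) (norm_plateau_le p q n r)
      · refine Eventually.of_forall fun r _ => ?_
        exact ((Complex.continuous_ofReal.tendsto _).comp (tendsto_plateau p q r)).mul_const _
    have h0 : (fun n : ℕ => ∫ r in (1 : ℝ)..q, (plateau p q n r : ℂ) * D r) = fun _ => 0 :=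
      funext fun n => integral_plateau_mul_sub_primitive_eq_zero hf hw hp' hpq' n (h p q n hp hpq)
    rw [h0] at hlim
    have h1 := tendsto_nhds_unique hlim tendsto_const_nhds
    rw [intervalIntegral.integral_of_le hpq'.le, integral_Ioc_eq_integral_Ioo, ← h1,
      intervalIntegral.integral_of_le hq', ← integral_indicator measurableSet_Ioo,
      ← integral_indicator measurableSet_Ioc]
    congr 1
    ext r
    by_cases hr : r ∈ Ioo (p : ℝ) q
    · rw [indicator_of_mem hr, indicator_of_mem (show r ∈ Ioc (1 : ℝ) q from ⟨hp'.trans hr.1, hr.2.le⟩), indicator_of_mem hr]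
      simp
    · rw [indicator_of_notMem hr, indicator_apply, indicator_of_notMem hr]
      simp
  set Φ : ℝ → ℂ := fun r => ∫ s in (1 : ℝ)..r, D s with hΦ
  have hΦc : ContinuousOn Φ (Ioi 1) := (continuousOn_primitive_Ici hDi).mono Ioi_subset_Ici_self
  -- The reference point `2` may be any rational number in `(1, ∞)`. Density and continuity extend
  -- the equality to all of `(1, ∞)`.
  have hEq : EqOn Φ (fun _ => Φ 2) (Ioi 1 ∩ range ((↑) : ℚ → ℝ)) := by
    rintro _ ⟨hr, p, rfl⟩
    have hr' : (1 : ℝ) < p := hr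
    have hp : (1 : ℚ) < p := by exact_mod_cast hr'
    have e : (∫ s in (p : ℝ)..((2 : ℚ) : ℝ), D s) = 0 := by
      rcases lt_trichotomy p 2 with h2 | h2 | h2
      · exact hzero p 2 hp h2
      · simp [h2]
      · rw [intervalIntegral.integral_symm, hzero 2 p (by norm_num) h2, neg_zero]
    have := intervalIntegral.integral_add_adjacent_intervals (hDi p hr'.le)
      (hDi' p ((2 : ℚ) : ℝ) hr'.le (by norm_num))
    rw [e, add_zero] at this
    simpa [hΦ] using this
  have hEq' : EqOn Φ (fun _ => Φ 2) (Ioi 1) :=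
    hEq.of_subset_closure hΦc continuousOn_const inter_subset_left
      (Rat.denseRange_cast.open_subset_closure_inter isOpen_Ioi)
  filter_upwards [ae_hasDerivAt_primitive hDi, ae_restrict_mem measurableSet_Ioi] with r hr hr1
  have h0 : HasDerivAt Φ 0 r := (hasDerivAt_const r (Φ 2)).congr_of_eventuallyEq (by
    filter_upwards [isOpen_Ioi.mem_nhds hr1] with s hs using hEq' hs)
  exact sub_eq_zero.1 (hr.unique h0)

/-- A du Bois-Reymond lemma with parameters: if `f' = w` weakly on `(1, ∞)`, with `f(1) = 0`, for
almost every parameter depending on the test function, then `f` is a primitive of `w` for almost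
every parameter. -/
theorem ae_ae_eq_primitive {X : Type*} [MeasurableSpace X] {ν : Measure X} {f w : X → ℝ → ℂ}
    (hf : ∀ x, ∀ R, 1 ≤ R → IntervalIntegrable (f x) volume 1 R)
    (hw : ∀ x, ∀ R, 1 ≤ R → IntervalIntegrable (w x) volume 1 R)
    (h : ∀ χ : ℝ → ℝ, ContDiff ℝ ((⊤ : ℕ∞) : WithTop ℕ∞) χ → HasCompactSupport χ →
      ∀ᵐ x ∂ν, ∫ r in Ioi (1 : ℝ), ((deriv χ r : ℝ) : ℂ) * f x r + (χ r : ℂ) * w x r = 0) :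
    ∀ᵐ x ∂ν, ∀ᵐ r ∂(volume.restrict (Ioi (1 : ℝ))), f x r = ∫ s in (1 : ℝ)..r, w x s := by
  -- Only countably many test functions are used, so their exceptional sets of parameters have a
  -- null union.
  have : ∀ᵐ x ∂ν, ∀ (p q : ℚ) (n : ℕ),
      ∫ r in Ioi (1 : ℝ), ((deriv (plateauPrimitive p q n) r : ℝ) : ℂ) * f x r
        + (plateauPrimitive p q n r : ℂ) * w x r = 0 := by
    simp only [ae_all_iff]
    exact fun p q n => h _ (contDiff_plateauPrimitive p q n) (hasCompactSupport_plateauPrimitive p q n)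
  filter_upwards [this] with x hx
  exact ae_eq_primitive_of_plateau (hf x) (hw x) fun p q n _ _ => hx p q n

end AxisymBS

end

noncomputable section

namespace AxisymBS

open scoped Topology

/-! ### The Green representation for one frequency -/

section Green

variable {κ : ℝ} {h C P : ℝ → ℂ}

/-- Two integrations by parts, from `h = κ² P/s - C'` to `C` and, since `s C = P'`, from `C` to `P`;
the remaining integrals cancel by the recurrences of `b₀`, `b₁`. No term survives at `1`, as `P(1) =
C(1) = 0`. The sign `ε` is `1` for the pair `I₀, I₁` and `-1` for `K₀, K₁`. -/
lemma integral_kernel_mul_eq {ε : ℝ} {b₀ b₁ : ℝ → ℝ} (hε : ε * ε = 1)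
    (hb₀ : ∀ s, 1 ≤ s → HasDerivAt b₀ (ε * κ * b₁ s) s)
    (hb₁ : ∀ s, 1 ≤ s → HasDerivAt (fun s => b₁ s * s) (ε * κ * (s * b₀ s)) s)
    (hh : ∀ R, 1 ≤ R → IntervalIntegrable h volume 1 R)
    (hP : ∀ r, 1 ≤ r → P r = ∫ s in (1 : ℝ)..r, (s : ℂ) * C s)
    (hC : ∀ r, 1 ≤ r → C r = ∫ s in (1 : ℝ)..r, ((κ : ℂ) ^ 2 * (P s / s) - h s))
    (hPc : ContinuousOn P (Ici 1)) (hCc : ContinuousOn C (Ici 1)) {r : ℝ} (hr : 1 ≤ r) :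
    ∫ s in (1 : ℝ)..r, ((b₁ s * s : ℝ) : ℂ) * h s =
      (ε * κ * b₀ r : ℝ) * P r - ((b₁ r * r : ℝ) : ℂ) * C r := by
  have hb₀c : ContinuousOn b₀ (Ici 1) := fun s hs => (hb₀ s hs).continuousAt.continuousWithinAt
  have hb₁c : ContinuousOn (fun s => b₁ s * s) (Ici 1) :=
    fun s hs => (hb₁ s hs).continuousAt.continuousWithinAt
  have hb₁c' : ContinuousOn b₁ (Ici 1) := by
    refine (hb₁c.div continuousOn_id fun s hs => ?_).congr fun s hs => ?_
    · exact (zero_lt_one.trans_le (mem_Ici.1 hs)).ne'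
    · have : s ≠ 0 := (zero_lt_one.trans_le (mem_Ici.1 hs)).ne'
      exact (mul_div_cancel_right₀ (b₁ s) this).symm
  have hofReal {f : ℝ → ℝ} (hf : ContinuousOn f (Ici 1)) : ContinuousOn (fun s => (f s : ℂ)) (Ici 1) :=
    Complex.continuous_ofReal.comp_continuousOn hf
  have hsub : uIcc 1 r ⊆ Ici 1 := by
    rw [uIcc_of_le hr]
    exact Icc_subset_Ici_self
  have hPs : ContinuousOn (fun s : ℝ => (κ : ℂ) ^ 2 * (P s / s)) (Ici 1) := by
    refine continuousOn_const.mul (hPc.div (hofReal continuousOn_id) fun s hs => ?_)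
    exact_mod_cast (zero_lt_one.trans_le (mem_Ici.1 hs)).ne'
  have hCi : IntervalIntegrable (fun s : ℝ => (κ : ℂ) ^ 2 * (P s / s) - h s) volume 1 r :=
    ((hPs.mono hsub).intervalIntegrable).sub (hh r hr)
  have key := integral_deriv_mul_primitive hr (fun s hs => hb₁ s hs.1)
    ((continuousOn_const.mul (continuousOn_id.mul hb₀c)).mono Icc_subset_Ici_self) hCi
  rw [← hC r hr] at key
  have e1 : ∫ s in (1 : ℝ)..r, ((ε * κ * (s * b₀ s) : ℝ) : ℂ) *
      ∫ t in (1 : ℝ)..s, ((κ : ℂ) ^ 2 * (P t / t) - h t) =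
      ∫ s in (1 : ℝ)..r, ((ε * κ * (s * b₀ s) : ℝ) : ℂ) * C s := by
    refine intervalIntegral.integral_congr fun s hs => ?_
    simp only [hC s (hsub hs)]
  have hi1 : IntervalIntegrable (fun s => ((ε * κ * (s * b₀ s) : ℝ) : ℂ) * C s) volume 1 r :=
    (((hofReal (continuousOn_const.mul (continuousOn_id.mul hb₀c))).mul hCc).mono
      hsub).intervalIntegrable
  have hi2 : IntervalIntegrable (fun s => ((b₁ s : ℝ) : ℂ) * ((κ : ℂ) ^ 2 * P s)) volume 1 r :=
    (((hofReal hb₁c').mul (continuousOn_const.mul hPc)).mono hsub).intervalIntegrable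
  have hi3 : IntervalIntegrable (fun s => ((b₁ s * s : ℝ) : ℂ) * h s) volume 1 r :=
    (hh r hr).continuousOn_mul ((hofReal hb₁c).mono hsub)
  have e2 : ∫ s in (1 : ℝ)..r, ((b₁ s * s : ℝ) : ℂ) * ((κ : ℂ) ^ 2 * (P s / s) - h s) =
      (∫ s in (1 : ℝ)..r, ((b₁ s : ℝ) : ℂ) * ((κ : ℂ) ^ 2 * P s)) -
      ∫ s in (1 : ℝ)..r, ((b₁ s * s : ℝ) : ℂ) * h s := by
    rw [← intervalIntegral.integral_sub hi2 hi3]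
    refine intervalIntegral.integral_congr fun s hs => ?_
    have : (s : ℂ) ≠ 0 := by exact_mod_cast (zero_lt_one.trans_le (mem_Ici.1 (hsub hs))).ne'
    simp only [Complex.ofReal_mul]
    field_simp
  have hPd : ∀ s ∈ Ioo 1 r, HasDerivAt P ((s : ℂ) * C s) s := by
    intro s hs
    have hcs : ContinuousOn (fun s : ℝ => (s : ℂ) * C s) (Ici 1) := (hofReal continuousOn_id).mul hCc
    have hd := intervalIntegral.integral_hasDerivAt_right
      ((hcs.mono (by rw [uIcc_of_le hs.1.le]; exact Icc_subset_Ici_self :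
        uIcc 1 s ⊆ Ici 1)).intervalIntegrable (μ := volume))
      (hcs.stronglyMeasurableAtFilter_nhdsWithin measurableSet_Ici s |>.filter_mono
        (by rw [nhdsWithin_eq_nhds.2 (Ici_mem_nhds hs.1)]))
      (hcs.continuousAt (Ici_mem_nhds hs.1))
    refine hd.congr_of_eventuallyEq ?_
    filter_upwards [Ici_mem_nhds hs.1] with t ht using hP t ht
  have hi4 : IntervalIntegrable (fun s : ℝ => ((b₁ s : ℝ) : ℂ) * ((κ : ℂ) ^ 2 * P s) +
      ((ε * κ * (s * b₀ s) : ℝ) : ℂ) * C s) volume 1 r := hi2.add hi1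
  have hP1 : P 1 = 0 := by rw [hP 1 le_rfl, intervalIntegral.integral_same]
  -- The second integration by parts. Differentiating `ε κ b₀` produces `ε² κ² b₁`, which equals the
  -- term `κ² b₁ P` left by the first one.
  have e3 := intervalIntegral.integral_eq_sub_of_hasDerivAt_of_le hr
    (f := fun s => ((ε * κ * b₀ s : ℝ) : ℂ) * P s)
    (((hofReal (continuousOn_const.mul hb₀c)).mul hPc).mono Icc_subset_Ici_self)
    (fun s hs => by
      refine ((((hb₀ s hs.1.le).const_mul (ε * κ)).ofReal_comp).mul (hPd s hs)).congr_deriv ?_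
      have h2 : (ε : ℂ) * ε = 1 := by exact_mod_cast hε
      push_cast
      linear_combination ((κ : ℂ) ^ 2 * b₁ s * P s) * h2) hi4
  rw [intervalIntegral.integral_add hi2 hi1, hP1, mul_zero, sub_zero] at e3
  rw [e1, e2] at key
  linear_combination e3 - key

variable (hκ : 0 < κ) (hh : ∀ R, 1 ≤ R → IntervalIntegrable h volume 1 R)
    (hhi : IntegrableOn (fun s : ℝ => (s : ℂ) * h s) (Ioi 1))
    (hP : ∀ r, 1 ≤ r → P r = ∫ s in (1 : ℝ)..r, (s : ℂ) * C s)
    (hC : ∀ r, 1 ≤ r → C r = ∫ s in (1 : ℝ)..r, ((κ : ℂ) ^ 2 * (P s / s) - h s))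
    (hPc : ContinuousOn P (Ici 1)) (hCc : ContinuousOn C (Ici 1))
    (hC0 : Tendsto (fun r : ℝ => (r : ℂ) * C r) atTop (𝓝 0))

include hκ hh hP hC hPc hCc in
lemma integral_besselK1_mul {r : ℝ} (hr : 1 ≤ r) :
    ∫ s in (1 : ℝ)..r, ((besselK1 (κ * s) * s : ℝ) : ℂ) * h s =
      (-1 * κ * besselK0 (κ * r) : ℝ) * P r - ((besselK1 (κ * r) * r : ℝ) : ℂ) * C r := by
  refine integral_kernel_mul_eq (ε := -1) (b₀ := fun s => besselK0 (κ * s))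
    (b₁ := fun s => besselK1 (κ * s)) (by norm_num) (fun s hs => ?_) (fun s hs => ?_)
    hh hP hC hPc hCc hr
  · have hs0 : 0 < s := by linarith
    refine ((hasDerivAt_besselK0 (by positivity : 0 < κ * s)).comp s
      ((hasDerivAt_id s).const_mul κ)).congr_deriv ?_
    simp
    ring
  · have hs0 : 0 < s := by linarith
    refine (((hasDerivAt_besselK1 (by positivity : 0 < κ * s)).comp s
      ((hasDerivAt_id s).const_mul κ)).mul (hasDerivAt_id s)).congr_deriv ?_
    simp only [id, Function.comp]
    field_simp
    ring

include hκ hh hP hC hPc hCc in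
lemma integral_besselI1_mul {r : ℝ} (hr : 1 ≤ r) :
    ∫ s in (1 : ℝ)..r, ((besselI1 (κ * s) * s : ℝ) : ℂ) * h s =
      (1 * κ * besselI0 (κ * r) : ℝ) * P r - ((besselI1 (κ * r) * r : ℝ) : ℂ) * C r := by
  refine integral_kernel_mul_eq (ε := 1) (b₀ := fun s => besselI0 (κ * s))
    (b₁ := fun s => besselI1 (κ * s)) (by norm_num) (fun s hs => ?_) (fun s hs => ?_)
    hh hP hC hPc hCc hr
  · refine ((hasDerivAt_besselI0 (κ * s)).comp s
      ((hasDerivAt_id s).const_mul κ)).congr_deriv ?_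
    simp
    ring
  · have hs0 : 0 < s := by linarith
    refine (((hasDerivAt_besselI1 (by positivity : κ * s ≠ 0)).comp s
      ((hasDerivAt_id s).const_mul κ)).mul (hasDerivAt_id s)).congr_deriv ?_
    simp only [id, Function.comp]
    field_simp
    ring

include hκ hhi in
lemma integrableOn_besselK1_mul :
    IntegrableOn (fun s : ℝ => ((besselK1 (κ * s) * s : ℝ) : ℂ) * h s) (Ioi 1) := by
  have hm : AEStronglyMeasurable (fun s : ℝ => (besselK1 (κ * s) : ℂ)) (volume.restrict (Ioi 1)) := by
    refine ContinuousOn.aestronglyMeasurable (fun s hs => ?_) measurableSet_Ioi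
    have hs0 : 0 < s := zero_lt_one.trans (mem_Ioi.1 hs)
    have h1 : ContinuousAt (fun s => besselK1 (κ * s)) s :=
      ((hasDerivAt_besselK1 (by positivity : 0 < κ * s)).comp s
        ((hasDerivAt_id s).const_mul κ)).continuousAt
    exact (Complex.continuous_ofReal.continuousAt.comp h1).continuousWithinAt
  have hb := hhi.bdd_mul (c := besselK1 κ) hm ?_
  · refine hb.congr (Eventually.of_forall fun s => ?_)
    push_cast
    ring
  · filter_upwards [ae_restrict_mem measurableSet_Ioi] with s hs
    rw [Complex.norm_real, besselK1_eq, besselK1_eq, Real.norm_of_nonneg (coshMoment_nonneg _ _)]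
    have hs0 : 1 < s := hs
    exact coshMoment_antitoneOn 1 hκ (by simp only [mem_Ioi]; positivity) (by nlinarith)

include hκ hh hhi hP hC hPc hCc hC0 in
-- As `r → ∞` the boundary terms `κ K₀(κr) P` and `K₁(κr) r C` vanish. Boundedness of `K₀` and `K₁`
-- on `[κ, ∞)` is enough here; the decay comes from `P` and `r C`.
lemma integral_Ioi_besselK1_mul (hP0 : Tendsto P atTop (𝓝 0)) :
    ∫ s in Ioi (1 : ℝ), ((besselK1 (κ * s) * s : ℝ) : ℂ) * h s = 0 := by
  have h1 := intervalIntegral_tendsto_integral_Ioi 1 (integrableOn_besselK1_mul hκ hhi) tendsto_id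
  have hbdd (n : ℕ) (f : ℝ → ℂ) (hf : Tendsto f atTop (𝓝 0)) :
      Tendsto (fun r : ℝ => (coshMoment n (κ * r) : ℂ) * f r) atTop (𝓝 0) := by
    refine hf.zero_mul_isBoundedUnder_le (f := f) (g := fun r => (coshMoment n (κ * r) : ℂ))
      (isBoundedUnder_of_eventually_le (a := coshMoment n κ) ?_) |>.congr fun r => mul_comm _ _
    filter_upwards [eventually_ge_atTop 1] with r hr
    simp only [Function.comp]
    rw [Complex.norm_real, Real.norm_of_nonneg (coshMoment_nonneg _ _)]
    have : 0 < r := by linarith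
    exact coshMoment_antitoneOn n hκ (by simp only [mem_Ioi]; positivity) (by nlinarith)
  have h2 : Tendsto (fun r : ℝ => ∫ s in (1 : ℝ)..r, ((besselK1 (κ * s) * s : ℝ) : ℂ) * h s)
      atTop (𝓝 0) := by
    have h3 := ((hbdd 0 P hP0).const_mul (-(κ : ℂ))).sub (hbdd 1 _ hC0)
    rw [mul_zero, sub_zero] at h3
    refine h3.congr' ?_
    filter_upwards [eventually_ge_atTop 1] with r hr
    rw [integral_besselK1_mul hκ hh hP hC hPc hCc hr, besselK0, besselK1_eq]
    push_cast
    ring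
  exact tendsto_nhds_unique h1 h2

include hκ hh hhi hP hC hPc hCc hC0 in
/-- For an overdetermined solution the boundary coefficient vanishes and `ψ̂` is `P / r`. -/
theorem dPos_eq_zero_and_psiHatPos_eq (hP0 : Tendsto P atTop (𝓝 0)) :
    dPos κ h = 0 ∧ ∀ r, 1 < r → psiHatPos κ h r = P r / r := by
  have h0 := integral_Ioi_besselK1_mul hκ hh hhi hP hC hPc hCc hC0 hP0
  have hd : dPos κ h = 0 := by rw [dPos, h0, mul_zero]
  refine ⟨hd, fun r hr => ?_⟩
  have hr0 : 0 < r := by linarith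
  have hi := integrableOn_besselK1_mul hκ hhi
  -- The total integral is zero, so the integral over `(r, ∞)` is minus the one over `(1, r]`, which
  -- is known explicitly.
  have hsplit := setIntegral_union (Ioc_disjoint_Ioi_same (a := 1) (b := r)) measurableSet_Ioi
    (hi.mono_set Ioc_subset_Ioi_self) (hi.mono_set (Ioi_subset_Ioi hr.le))
  rw [Ioc_union_Ioi_eq_Ioi hr.le, h0, ← intervalIntegral.integral_of_le hr.le,
    integral_besselK1_mul hκ hh hP hC hPc hCc hr.le] at hsplit
  have hI := integral_besselI1_mul hκ hh hP hC hPc hCc hr.le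
  rw [intervalIntegral.integral_of_le hr.le] at hI
  -- In `ψ̂` the terms with `C` cancel, and `P` is multiplied by `κ (I₀ K₁ + I₁ K₀)`, which is `1 /
  -- r` by the Wronskian identity.
  have hW : (κ : ℂ) * r * ((besselI0 (κ * r) : ℂ) * besselK1 (κ * r) +
      besselI1 (κ * r) * besselK0 (κ * r)) = 1 := by
    exact_mod_cast besselI0_mul_besselK1_add (by positivity : 0 < κ * r)
  have hrc : (r : ℂ) ≠ 0 := by exact_mod_cast hr0.ne'
  rw [psiHatPos, hd, hI, eq_div_iff hrc]
  push_cast at hsplit ⊢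
  linear_combination (P r) * hW - (besselI1 (κ * r) : ℂ) * r * hsplit

include hh hhi hP hC0 in
/-- The case of frequency zero. -/
theorem dZero_eq_zero_and_psiHatZero_eq
    (hC : ∀ r, 1 ≤ r → C r = ∫ s in (1 : ℝ)..r, - h s) :
    dZero h = 0 ∧ ∀ r, 1 < r → psiHatZero h r = P r / r := by
  have hhi' : IntegrableOn h (Ioi 1) := by
    refine Integrable.mono hhi (by
      have hm : AEStronglyMeasurable (fun s : ℝ => (s : ℂ)⁻¹ * ((s : ℂ) * h s)) (volume.restrict (Ioi 1)) :=
        (by fun_prop : Measurable fun s : ℝ => (s : ℂ)⁻¹).aestronglyMeasurable.mul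
          hhi.aestronglyMeasurable
      refine hm.congr ?_
      filter_upwards [ae_restrict_mem measurableSet_Ioi] with s hs
      have : (s : ℂ) ≠ 0 := by exact_mod_cast (zero_lt_one.trans (mem_Ioi.1 hs)).ne'
      field_simp) ?_
    filter_upwards [ae_restrict_mem measurableSet_Ioi] with s hs
    have hs1 : 1 < s := hs
    rw [norm_mul, Complex.norm_real, Real.norm_of_nonneg (by linarith)]
    nlinarith [norm_nonneg (h s)]
  have hC0' : Tendsto C atTop (𝓝 0) := by
    refine squeeze_zero_norm' ?_ (tendsto_norm_zero.comp hC0)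
    filter_upwards [eventually_ge_atTop 1] with r hr
    simp only [Function.comp]
    rw [norm_mul, Complex.norm_real, Real.norm_of_nonneg (by linarith)]
    nlinarith [norm_nonneg (C r)]
  have h1 := intervalIntegral_tendsto_integral_Ioi 1 hhi' tendsto_id
  have h2 : Tendsto (fun r : ℝ => ∫ s in (1 : ℝ)..r, h s) atTop (𝓝 0) := by
    rw [← neg_zero]
    refine hC0'.neg.congr' ?_
    filter_upwards [eventually_ge_atTop 1] with r hr
    rw [hC r hr, intervalIntegral.integral_neg, neg_neg]
  have h0 : ∫ s in Ioi (1 : ℝ), h s = 0 := tendsto_nhds_unique h1 h2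
  have hd : dZero h = 0 := by rw [dZero, h0, mul_zero]
  refine ⟨hd, fun r hr => ?_⟩
  have hr0 : 0 < r := by linarith
  have hsplit := setIntegral_union (Ioc_disjoint_Ioi_same (a := 1) (b := r)) measurableSet_Ioi
    (hhi'.mono_set Ioc_subset_Ioi_self) (hhi'.mono_set (Ioi_subset_Ioi hr.le))
  have hCr := hC r hr.le
  rw [intervalIntegral.integral_neg] at hCr
  rw [Ioc_union_Ioi_eq_Ioi hr.le, h0, ← intervalIntegral.integral_of_le hr.le] at hsplit
  -- With the weight `s²` this reads `2 P - ∫₁^r s² h = r² C`, while the integral of `h` over `(r,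
  -- ∞)` is `C`. The two integrals in `ψ̂` then add up to `P / r`.
  have key := integral_deriv_mul_primitive hr.le (k := fun s => s ^ 2) (k' := fun s => 2 * s)
    (fun s _ => by simpa using hasDerivAt_pow 2 s) (by fun_prop) (hh r hr.le).neg
  have e1 : ∫ s in (1 : ℝ)..r, ((2 * s : ℝ) : ℂ) * ∫ t in (1 : ℝ)..s, (-h) t = 2 * P r := by
    rw [hP r hr.le, ← intervalIntegral.integral_const_mul]
    refine intervalIntegral.integral_congr fun s hs => ?_
    rw [uIcc_of_le hr.le] at hs
    simp only [Pi.neg_apply]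
    rw [← hC s hs.1]
    push_cast
    ring
  have e2 : ∫ s in (1 : ℝ)..r, ((s ^ 2 : ℝ) : ℂ) * (-h) s =
      - ∫ s in Ioc (1 : ℝ) r, ((s ^ 2 : ℝ) : ℂ) * h s := by
    rw [intervalIntegral.integral_of_le hr.le, ← integral_neg]
    simp
  rw [e1, e2] at key
  simp only [Pi.neg_apply] at key
  rw [← hC r hr.le] at key
  have hrc : (r : ℂ) ≠ 0 := by exact_mod_cast hr0.ne'
  rw [psiHatZero, hd]
  push_cast at key ⊢
  field_simp
  linear_combination -(r : ℂ) ^ 2 * hCr - key - (r : ℂ) ^ 2 * hsplit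

end Green

end AxisymBS

end

noncomputable section

namespace AxisymBS

open scoped Topology

/-! ### The frequency measure and uniqueness for its Fourier transforms -/

/-- Lebesgue measure plus the counting measure of the integers. -/
def freqMeasure : Measure ℝ := volume + Measure.sum fun m : ℤ => Measure.dirac (m : ℝ)

instance : SFinite freqMeasure := by
  unfold freqMeasure
  infer_instance

lemma ae_freqMeasure_iff {p : ℝ → Prop} :
    (∀ᵐ ζ ∂freqMeasure, p ζ) ↔ (∀ᵐ ζ : ℝ, p ζ) ∧ ∀ m : ℤ, p m := by
  simp [freqMeasure, ae_add_measure_iff, ae_dirac_eq]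

/-- The function that equals `b m` at each integer `m` and `f` elsewhere. -/
def glue {E : Type*} (f : ℝ → E) (b : ℤ → E) (ζ : ℝ) : E :=
  open Classical in if (⌊ζ⌋ : ℝ) = ζ then b ⌊ζ⌋ else f ζ

@[simp] lemma glue_intCast {E : Type*} (f : ℝ → E) (b : ℤ → E) (m : ℤ) : glue f b m = b m := by
  simp [glue]

/-- The integers are Lebesgue-null. This allows a measure with a density and atoms to be treated as
one density with respect to `freqMeasure`. -/
lemma glue_ae_eq {E : Type*} (f : ℝ → E) (b : ℤ → E) : glue f b =ᵐ[volume] f := by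
  have h : ∀ᵐ ζ : ℝ, ζ ∉ range ((↑) : ℤ → ℝ) :=
    (countable_range ((↑) : ℤ → ℝ)).ae_notMem volume
  filter_upwards [h] with ζ hζ
  rw [glue, if_neg fun h' => hζ ⟨_, h'⟩]

lemma integrable_freqMeasure_iff {E : Type*} [NormedAddCommGroup E] {F : ℝ → E} :
    Integrable F freqMeasure ↔ Integrable F volume ∧ Summable fun m : ℤ => ‖F m‖ := by
  rw [freqMeasure, integrable_add_measure, integrable_sum_measure_iff]
  simp [integrable_dirac]

lemma integrable_glue {E : Type*} [NormedAddCommGroup E] {f : ℝ → E} {b : ℤ → E}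
    (hf : Integrable f volume) (hb : Summable fun m => ‖b m‖) :
    Integrable (glue f b) freqMeasure :=
  integrable_freqMeasure_iff.2 ⟨hf.congr (glue_ae_eq f b).symm, by simpa using hb⟩

lemma integral_freqMeasure {E : Type*} [NormedAddCommGroup E] [NormedSpace ℝ E]
    [CompleteSpace E] {F : ℝ → E} (hF : Integrable F freqMeasure) :
    ∫ ζ, F ζ ∂freqMeasure = (∫ ζ, F ζ) + ∑' m : ℤ, F m := by
  have hF' := hF
  rw [freqMeasure, integrable_add_measure] at hF'
  rw [freqMeasure, integral_add_measure hF'.1 hF'.2, integral_sum_measure hF'.2]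
  simp [integral_dirac]

/-- `∫ e^{izζ} α(ζ) dζ` with respect to `freqMeasure`. -/
def invFT {E : Type*} [NormedAddCommGroup E] [NormedSpace ℂ E] (α : ℝ → E) (z : ℝ) : E :=
  ∫ ζ, Complex.exp (Complex.I * z * ζ) • α ζ ∂freqMeasure

lemma norm_exp_I_mul_mul (z ζ : ℝ) : ‖Complex.exp (Complex.I * z * ζ)‖ = 1 := by
  rw [show Complex.I * z * ζ = ((z * ζ : ℝ) : ℂ) * Complex.I by push_cast; ring]
  exact Complex.norm_exp_ofReal_mul_I _

section

variable {E : Type*} [NormedAddCommGroup E] [NormedSpace ℂ E] {α : ℝ → E}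

lemma integrable_exp_smul (hα : Integrable α freqMeasure) (z : ℝ) :
    Integrable (fun ζ : ℝ => Complex.exp (Complex.I * z * ζ) • α ζ) freqMeasure :=
  hα.bdd_smul 1 (by fun_prop : Continuous fun ζ : ℝ => Complex.exp (Complex.I * z * ζ)).aestronglyMeasurable
    (Eventually.of_forall fun ζ => (norm_exp_I_mul_mul z ζ).le)

lemma norm_invFT_le (z : ℝ) : ‖invFT α z‖ ≤ ∫ ζ, ‖α ζ‖ ∂freqMeasure := by
  refine (norm_integral_le_integral_norm _).trans_eq ?_
  simp only [norm_smul, norm_exp_I_mul_mul, one_mul]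

lemma continuous_invFT (hα : Integrable α freqMeasure) : Continuous (invFT α) := by
  refine continuous_of_dominated (bound := fun ζ => ‖α ζ‖)
    (fun z => (integrable_exp_smul hα z).aestronglyMeasurable) (fun z => ?_) hα.norm ?_
  · refine Eventually.of_forall fun ζ => ?_
    rw [norm_smul, norm_exp_I_mul_mul, one_mul]
  · exact Eventually.of_forall fun ζ => by fun_prop

/-- Bounded operators commute with the Bochner integral. Scalar information is extracted from
`L^∞`-valued transforms through functionals, point evaluation not being defined. -/
lemma map_invFT {F : Type*} [NormedAddCommGroup F] [NormedSpace ℂ F] [CompleteSpace E]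
    [CompleteSpace F]
    (L : E →L[ℂ] F) (hα : Integrable α freqMeasure) (z : ℝ) :
    L (invFT α z) = invFT (fun ζ => L (α ζ)) z := by
  rw [invFT, ← L.integral_comp_comm (integrable_exp_smul hα z)]
  simp [invFT]

end

/-- A smooth cutoff, equal to one near zero. -/
def cutoff (n : ℕ) (z : ℝ) : ℝ :=
  Real.smoothTransition (2 - z / (n + 1)) * Real.smoothTransition (2 + z / (n + 1))

lemma contDiff_cutoff (n : ℕ) {m : ℕ∞} : ContDiff ℝ m (cutoff n) :=
  (Real.smoothTransition.contDiff.comp (by fun_prop)).mul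
    (Real.smoothTransition.contDiff.comp (by fun_prop))

lemma cutoff_nonneg (n : ℕ) (z : ℝ) : 0 ≤ cutoff n z :=
  mul_nonneg (Real.smoothTransition.nonneg _) (Real.smoothTransition.nonneg _)

lemma cutoff_le_one (n : ℕ) (z : ℝ) : cutoff n z ≤ 1 :=
  mul_le_one₀ (Real.smoothTransition.le_one _) (Real.smoothTransition.nonneg _)
    (Real.smoothTransition.le_one _)

lemma hasCompactSupport_cutoff (n : ℕ) : HasCompactSupport (cutoff n) := by
  have hn : (0 : ℝ) < n + 1 := by positivity
  refine HasCompactSupport.intro (K := Icc (-(2 * (n + 1))) (2 * (n + 1))) isCompact_Icc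
    fun z hz => ?_
  rw [mem_Icc, not_and_or, not_le, not_le] at hz
  rcases hz with h | h
  · have : z / (n + 1) ≤ -2 := by rw [div_le_iff₀ hn]; linarith
    rw [cutoff, Real.smoothTransition.zero_of_nonpos (x := 2 + z / (n + 1)) (by linarith), mul_zero]
  · have : 2 ≤ z / (n + 1) := by rw [le_div_iff₀ hn]; linarith
    rw [cutoff, Real.smoothTransition.zero_of_nonpos (by linarith), zero_mul]

lemma cutoff_eq_one {n : ℕ} {z : ℝ} (h : |z| ≤ n + 1) : cutoff n z = 1 := by
  have hn : (0 : ℝ) < n + 1 := by positivity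
  have h1 : z / (n + 1) ≤ 1 := by rw [div_le_iff₀ hn]; linarith [le_abs_self z]
  have h2 : -1 ≤ z / (n + 1) := by rw [le_div_iff₀ hn]; linarith [neg_abs_le z]
  rw [cutoff, Real.smoothTransition.one_of_one_le (by linarith),
    Real.smoothTransition.one_of_one_le (by linarith), mul_one]

lemma eventually_cutoff_eq_one (z : ℝ) : ∀ᶠ n : ℕ in atTop, cutoff n =ᶠ[𝓝 z] fun _ => 1 := by
  obtain ⟨N, hN⟩ := exists_nat_ge |z|
  filter_upwards [eventually_ge_atTop N] with n hn
  have hn' : (N : ℝ) ≤ n := by exact_mod_cast hn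
  filter_upwards [continuous_abs.continuousAt.eventually_lt continuousAt_const
    (show |z| < n + 1 by linarith)] with y hy using cutoff_eq_one hy.le

/-- Each cutoff is the first one dilated by `n + 1`, so its derivative carries the factor `(n + 1)⁻¹
≤ 1`. -/
lemma exists_norm_deriv_cutoff_le : ∃ M : ℝ, ∀ n z, ‖deriv (cutoff n) z‖ ≤ M := by
  set f : ℝ → ℝ := cutoff 0 with hf
  have hfd : Continuous (deriv f) := (contDiff_cutoff 0 (m := 1)).continuous_deriv le_rfl
  obtain ⟨M, hM⟩ := hfd.bounded_above_of_compact_support (hasCompactSupport_cutoff 0).deriv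
  refine ⟨M, fun n z => ?_⟩
  have e : cutoff n = fun z => f ((n + 1 : ℝ)⁻¹ * z) := by
    ext z
    simp [hf, cutoff, div_eq_inv_mul]
  have hd : HasDerivAt (cutoff n) (deriv f ((n + 1 : ℝ)⁻¹ * z) * (n + 1 : ℝ)⁻¹) z := by
    rw [e]
    have h1 : HasDerivAt f (deriv f ((n + 1 : ℝ)⁻¹ * z)) ((n + 1 : ℝ)⁻¹ * z) :=
      ((contDiff_cutoff 0 (m := 1)).differentiable (by simp) _).hasDerivAt
    have h2 : HasDerivAt (fun z : ℝ => (n + 1 : ℝ)⁻¹ * z) (n + 1 : ℝ)⁻¹ z := by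
      simpa using (hasDerivAt_id z).const_mul (n + 1 : ℝ)⁻¹
    exact h1.comp z h2
  rw [hd.deriv, norm_mul]
  have h3 : ‖(n + 1 : ℝ)⁻¹‖ ≤ 1 := by
    rw [Real.norm_of_nonneg (by positivity)]
    exact inv_le_one_of_one_le₀ (by linarith [(Nat.cast_nonneg n : (0 : ℝ) ≤ n)])
  exact (mul_le_of_le_one_right (norm_nonneg _) h3).trans (hM _)

/-- If `A = B'` in the sense of distributions, with `A`, `B` bounded and continuous, then this holds
for test functions that are integrable with their derivative. -/
lemma integral_test_extend {A B : ℝ → ℂ} (hA : Continuous A) (hB : Continuous B) {M : ℝ}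
    (hAM : ∀ z, ‖A z‖ ≤ M) (hBM : ∀ z, ‖B z‖ ≤ M)
    (h : ∀ η : ℝ → ℝ, ContDiff ℝ ((⊤ : ℕ∞) : WithTop ℕ∞) η → HasCompactSupport η →
      ∫ z, ((η z : ℝ) : ℂ) * A z + ((deriv η z : ℝ) : ℂ) * B z = 0)
    {η : ℝ → ℝ} (hη : ContDiff ℝ ((⊤ : ℕ∞) : WithTop ℕ∞) η) (hηi : Integrable η)
    (hηi' : Integrable (deriv η)) :
    ∫ z, ((η z : ℝ) : ℂ) * A z + ((deriv η z : ℝ) : ℂ) * B z = 0 := by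
  obtain ⟨K, hK⟩ := exists_norm_deriv_cutoff_le
  have hK0 : 0 ≤ K := (norm_nonneg _).trans (hK 0 0)
  have hM0 : 0 ≤ M := (norm_nonneg _).trans (hAM 0)
  have hηd : Continuous (deriv η) := hη.continuous_deriv (by simp)
  have hderiv (n : ℕ) (z : ℝ) : deriv (fun z => cutoff n z * η z) z =
      deriv (cutoff n) z * η z + cutoff n z * deriv η z :=
    deriv_fun_mul ((contDiff_cutoff n (m := 1)).differentiable (by simp) z)
      (hη.differentiable (by simp) z)
  have hlim : Tendsto (fun n => ∫ z, (((cutoff n z * η z : ℝ)) : ℂ) * A z +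
      ((deriv (fun z => cutoff n z * η z) z : ℝ) : ℂ) * B z) atTop
      (𝓝 (∫ z, ((η z : ℝ) : ℂ) * A z + ((deriv η z : ℝ) : ℂ) * B z)) := by
    -- The majorant is uniform in `n`: `K` bounds all derivatives of the cutoffs, and `M` bounds `A`
    -- and `B`.
    refine tendsto_integral_of_dominated_convergence
      (fun z => (‖η z‖ + (K * ‖η z‖ + ‖deriv η z‖)) * M) (fun n => ?_)
      ((hηi.norm.add ((hηi.norm.const_mul K).add hηi'.norm)).mul_const M) (fun n => ?_) ?_
    · have h1 : Continuous (cutoff n) := (contDiff_cutoff n (m := 1)).continuous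
      have h2 : Continuous (deriv (cutoff n)) := (contDiff_cutoff n (m := 1)).continuous_deriv le_rfl
      have h3 : Continuous η := hη.continuous
      simp only [hderiv]
      exact (by fun_prop : Continuous _).aestronglyMeasurable
    · refine Eventually.of_forall fun z => ?_
      rw [hderiv]
      have hc : ‖cutoff n z‖ ≤ 1 := by
        rw [Real.norm_of_nonneg (cutoff_nonneg n z)]
        exact cutoff_le_one n z
      have h1 : ‖((cutoff n z * η z : ℝ) : ℂ) * A z‖ ≤ ‖η z‖ * M := by
        rw [norm_mul, Complex.norm_real, norm_mul]
        exact mul_le_mul (mul_le_of_le_one_left (norm_nonneg _) hc) (hAM z) (norm_nonneg _)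
          (norm_nonneg _)
      have h2 : ‖((deriv (cutoff n) z * η z + cutoff n z * deriv η z : ℝ) : ℂ) * B z‖ ≤
          (K * ‖η z‖ + ‖deriv η z‖) * M := by
        rw [norm_mul, Complex.norm_real]
        refine mul_le_mul ((norm_add_le _ _).trans ?_) (hBM z) (norm_nonneg _) (by positivity)
        rw [norm_mul, norm_mul]
        exact add_le_add (mul_le_mul_of_nonneg_right (hK n z) (norm_nonneg _))
          (mul_le_of_le_one_left (norm_nonneg _) hc)
      refine (norm_add_le _ _).trans ((add_le_add h1 h2).trans_eq ?_)
      ring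
    · refine Eventually.of_forall fun z => tendsto_const_nhds.congr' ?_
      filter_upwards [eventually_cutoff_eq_one z] with n hn
      have h1 : cutoff n z = 1 := hn.self_of_nhds
      have h2 : deriv (cutoff n) z = 0 := by rw [hn.deriv_eq, deriv_const]
      rw [hderiv, h1, h2, zero_mul, zero_add, one_mul, one_mul]
  refine tendsto_nhds_unique hlim (tendsto_const_nhds.congr fun n => (h _ ?_ ?_).symm)
  · exact (contDiff_cutoff n).mul hη
  · exact (hasCompactSupport_cutoff n).mul_right

/-- Real and imaginary parts of `η` are tested separately. Complex test functions are needed because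
the Schwartz functions obtained by Fourier inversion are complex. -/
lemma integral_test_extend_complex {A B : ℝ → ℂ} (hA : Continuous A) (hB : Continuous B) {M : ℝ}
    (hAM : ∀ z, ‖A z‖ ≤ M) (hBM : ∀ z, ‖B z‖ ≤ M)
    (h : ∀ η : ℝ → ℝ, ContDiff ℝ ((⊤ : ℕ∞) : WithTop ℕ∞) η → HasCompactSupport η →
      ∫ z, ((η z : ℝ) : ℂ) * A z + ((deriv η z : ℝ) : ℂ) * B z = 0)
    {η : ℝ → ℂ} (hη : ContDiff ℝ ((⊤ : ℕ∞) : WithTop ℕ∞) η) (hηi : Integrable η)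
    (hηi' : Integrable (deriv η)) :
    ∫ z, η z * A z + deriv η z * B z = 0 := by
  have hd (z : ℝ) : HasDerivAt η (deriv η z) z := (hη.differentiable (by simp) z).hasDerivAt
  have hdr (z : ℝ) : HasDerivAt (fun z => (η z).re) (deriv η z).re z :=
    Complex.reCLM.hasFDerivAt.comp_hasDerivAt z (hd z)
  have hdi (z : ℝ) : HasDerivAt (fun z => (η z).im) (deriv η z).im z :=
    Complex.imCLM.hasFDerivAt.comp_hasDerivAt z (hd z)
  have er : deriv (fun z => (η z).re) = fun z => (deriv η z).re := funext fun z => (hdr z).deriv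
  have ei : deriv (fun z => (η z).im) = fun z => (deriv η z).im := funext fun z => (hdi z).deriv
  have hre := integral_test_extend hA hB hAM hBM h (η := fun z => (η z).re)
    (Complex.reCLM.contDiff.comp hη) hηi.re (by rw [er]; exact hηi'.re)
  have him := integral_test_extend hA hB hAM hBM h (η := fun z => (η z).im)
    (Complex.imCLM.contDiff.comp hη) hηi.im (by rw [ei]; exact hηi'.im)
  rw [er] at hre
  rw [ei] at him
  have hint {f g : ℝ → ℂ} (hf : Integrable f) (hg : Integrable g) :
      Integrable fun z => f z * A z + g z * B z :=
    (hf.mul_bdd (c := M) hA.aestronglyMeasurable (Eventually.of_forall hAM)).add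
      (hg.mul_bdd (c := M) hB.aestronglyMeasurable (Eventually.of_forall hBM))
  have h1 := hint (f := fun z => ((η z).re : ℂ)) (g := fun z => ((deriv η z).re : ℂ))
    hηi.re.ofReal hηi'.re.ofReal
  have h2 := hint (f := fun z => ((η z).im : ℂ)) (g := fun z => ((deriv η z).im : ℂ))
    hηi.im.ofReal hηi'.im.ofReal
  have e : (fun z => η z * A z + deriv η z * B z) = fun z =>
      (((η z).re : ℂ) * A z + ((deriv η z).re : ℂ) * B z) +
      Complex.I * (((η z).im : ℂ) * A z + ((deriv η z).im : ℂ) * B z) := by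
    ext z
    nth_rewrite 1 [← Complex.re_add_im (η z), ← Complex.re_add_im (deriv η z)]
    ring
  rw [e, integral_add h1 (h2.const_mul _), integral_const_mul, hre, him]
  simp

/-- Fubini, with a kernel of modulus one: the transform is moved onto the test function. -/
lemma integral_mul_invFT {η α : ℝ → ℂ} (hη : Integrable η) (hα : Integrable α freqMeasure) :
    ∫ z : ℝ, η z * invFT α z =
      ∫ ζ : ℝ, (∫ z : ℝ, Complex.exp (Complex.I * z * ζ) * η z) * α ζ ∂freqMeasure := by
  have hi : Integrable (Function.uncurry fun (z ζ : ℝ) =>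
      Complex.exp (Complex.I * z * ζ) * (η z * α ζ)) (volume.prod freqMeasure) := by
    refine (hη.mul_prod hα).bdd_mul (c := 1) (f := fun x : ℝ × ℝ => Complex.exp (Complex.I * x.1 * x.2)) ?_ ?_
    · exact (by fun_prop : Continuous fun x : ℝ × ℝ =>
        Complex.exp (Complex.I * x.1 * x.2)).aestronglyMeasurable
    · exact Eventually.of_forall fun x => (norm_exp_I_mul_mul x.1 x.2).le
  calc ∫ z : ℝ, η z * invFT α z
      = ∫ z : ℝ, ∫ ζ : ℝ, Complex.exp (Complex.I * z * ζ) * (η z * α ζ) ∂freqMeasure := by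
        congr 1
        ext z
        rw [invFT, ← integral_const_mul]
        congr 1
        ext ζ
        rw [smul_eq_mul]
        ring
    _ = ∫ ζ : ℝ, (∫ z : ℝ, Complex.exp (Complex.I * z * ζ) * (η z * α ζ)) ∂freqMeasure :=
        integral_integral_swap hi
    _ = _ := by
        congr 1
        ext ζ
        rw [← integral_mul_const]
        congr 1
        ext z
        ring

open scoped FourierTransform SchwartzMap in
/-- Every smooth compactly supported function is `∫ e^{izζ} η(z) dz` for a Schwartz function. -/
lemma exists_schwartz_integral_exp_eq {ξ : ℝ → ℝ} (hξ : ContDiff ℝ ((⊤ : ℕ∞) : WithTop ℕ∞) ξ)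
    (hξc : HasCompactSupport ξ) :
    ∃ η : 𝓢(ℝ, ℂ), ∀ ζ : ℝ, ∫ z : ℝ, Complex.exp (Complex.I * z * ζ) * η z = (ξ ζ : ℂ) := by
  -- The argument is scaled by `2π` because `𝓕⁻` has the kernel `exp(2πi z x)`.
  have h1 : ContDiff ℝ ((⊤ : ℕ∞) : WithTop ℕ∞) (fun x : ℝ => ((ξ (2 * Real.pi * x) : ℝ) : ℂ)) :=
    Complex.ofRealCLM.contDiff.comp (hξ.comp (by fun_prop))
  have h2 : HasCompactSupport (fun x : ℝ => ((ξ (2 * Real.pi * x) : ℝ) : ℂ)) := by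
    have h := hξc.comp_homeomorph (Homeomorph.mulLeft₀ (2 * Real.pi) (by positivity))
    exact h.comp_left (g := ((↑) : ℝ → ℂ)) Complex.ofReal_zero
  set f : 𝓢(ℝ, ℂ) := h2.toSchwartzMap h1 with hf
  refine ⟨𝓕 f, fun ζ => ?_⟩
  have h3 : 𝓕⁻ (𝓕 f) = f := FourierTransform.fourierInv_fourier_eq f
  have h4 := DFunLike.congr_fun h3 (ζ / (2 * Real.pi))
  rw [SchwartzMap.fourierInv_coe, Real.fourierInv_eq'] at h4
  have h5 : f (ζ / (2 * Real.pi)) = (ξ ζ : ℂ) := by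
    change ((ξ (2 * Real.pi * (ζ / (2 * Real.pi))) : ℝ) : ℂ) = _
    rw [mul_div_cancel₀ _ (by positivity)]
  rw [← h5, ← h4]
  congr 1
  ext z
  rw [smul_eq_mul]
  congr 2
  simp only [RCLike.inner_apply, conj_trivial]
  have : (Real.pi : ℂ) ≠ 0 := by exact_mod_cast Real.pi_ne_zero
  push_cast
  field_simp

lemma integral_exp_mul_deriv {η : ℝ → ℂ} (hη : Differentiable ℝ η) (hηi : Integrable η)
    (hηi' : Integrable (deriv η)) (ζ : ℝ) :
    ∫ z : ℝ, Complex.exp (Complex.I * z * ζ) * deriv η z =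
      -(Complex.I * ζ) * ∫ z : ℝ, Complex.exp (Complex.I * z * ζ) * η z := by
  have hu (z : ℝ) : HasDerivAt (fun z : ℝ => Complex.exp (Complex.I * z * ζ))
      (Complex.exp (Complex.I * z * ζ) * (Complex.I * ζ)) z := by
    have h := ((((hasDerivAt_id z).ofReal_comp).const_mul Complex.I).mul_const (ζ : ℂ)).cexp
    refine h.congr_deriv ?_
    simp
  have hb {f : ℝ → ℂ} (hf : Integrable f) :
      Integrable fun z : ℝ => Complex.exp (Complex.I * z * ζ) * f z :=
    hf.bdd_mul (c := 1) (by fun_prop : Continuous fun z : ℝ =>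
      Complex.exp (Complex.I * z * ζ)).aestronglyMeasurable
      (Eventually.of_forall fun z => (norm_exp_I_mul_mul z ζ).le)
  have key := integral_mul_deriv_eq_deriv_mul_of_integrable (fun z _ => hu z)
    (fun z _ => (hη z).hasDerivAt) (hb hηi')
    (((hb hηi).const_mul (Complex.I * ζ)).congr (Eventually.of_forall fun z => by
      simp only [Pi.mul_apply]; ring)) (hb hηi)
  rw [key, ← integral_neg, ← integral_const_mul]
  congr 1
  ext z
  ring

/-- If the inverse Fourier transform of `α` is the distributional derivative of that of `γ`, then
`α = iζ γ`. -/
theorem ae_eq_of_weak_deriv_invFT {α γ : ℝ → ℂ} (hα : Integrable α freqMeasure)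
    (hγ : Integrable γ freqMeasure)
    (h : ∀ η : ℝ → ℝ, ContDiff ℝ ((⊤ : ℕ∞) : WithTop ℕ∞) η → HasCompactSupport η →
      ∫ z : ℝ, ((η z : ℝ) : ℂ) * invFT α z + ((deriv η z : ℝ) : ℂ) * invFT γ z = 0) :
    ∀ᵐ ζ ∂freqMeasure, α ζ - Complex.I * ζ * γ ζ = 0 := by
  -- It suffices to integrate against smooth compactly supported functions `ξ` of the frequency.
  -- Each is the transform of a Schwartz function of `z`, which is admissible after the extension of
  -- the class of test functions.
  refine ae_eq_zero_of_integral_contDiff_smul_eq_zero ?_ fun ξ hξ hξc => ?_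
  · have h1 : LocallyIntegrable (fun ζ : ℝ => (Complex.I * ζ) • γ ζ) freqMeasure :=
      hγ.locallyIntegrable.continuous_smul (by fun_prop)
    exact hα.locallyIntegrable.sub h1
  · obtain ⟨η, hη⟩ := exists_schwartz_integral_exp_eq hξ hξc
    have hηi : Integrable η := η.integrable
    have hηi' : Integrable (deriv η) := (SchwartzMap.derivCLM ℂ ℂ η).integrable
    have hsm : ContDiff ℝ ((⊤ : ℕ∞) : WithTop ℕ∞) η := η.smooth _
    have key := integral_test_extend_complex (continuous_invFT hα) (continuous_invFT hγ)
      (M := max (∫ ζ, ‖α ζ‖ ∂freqMeasure) (∫ ζ, ‖γ ζ‖ ∂freqMeasure))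
      (fun z => (norm_invFT_le z).trans (le_max_left _ _))
      (fun z => (norm_invFT_le z).trans (le_max_right _ _)) h hsm hηi hηi'
    have hbdd {f δ : ℝ → ℂ} (hf : Integrable f) (hδ : Integrable δ freqMeasure) :
        Integrable fun z => f z * invFT δ z :=
      hf.mul_bdd (c := ∫ ζ, ‖δ ζ‖ ∂freqMeasure) (continuous_invFT hδ).aestronglyMeasurable
        (Eventually.of_forall fun z => norm_invFT_le z)
    have hξb : ∃ K, ∀ ζ, ‖ξ ζ‖ ≤ K := hξ.continuous.bounded_above_of_compact_support hξc
    -- Integrability of `ζ γ` is not known; the compact support of `ξ` controls the factor `ζ`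
    -- coming from the derivative.
    have hξb' : ∃ K, ∀ ζ, ‖ζ * ξ ζ‖ ≤ K :=
      (continuous_id.mul hξ.continuous).bounded_above_of_compact_support hξc.mul_left
    obtain ⟨K, hK⟩ := hξb
    obtain ⟨K', hK'⟩ := hξb'
    have hξm : Continuous ξ := hξ.continuous
    have hi1 : Integrable (fun ζ => (ξ ζ : ℂ) * α ζ) freqMeasure :=
      hα.bdd_mul (c := K) (by fun_prop : Continuous fun ζ => (ξ ζ : ℂ)).aestronglyMeasurable
        (Eventually.of_forall fun ζ => by rw [Complex.norm_real]; exact hK ζ)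
    have hi2 : Integrable (fun ζ : ℝ => ((ζ * ξ ζ : ℝ) : ℂ) * γ ζ) freqMeasure :=
      hγ.bdd_mul (c := K') (by fun_prop : Continuous fun ζ => ((ζ * ξ ζ : ℝ) : ℂ)).aestronglyMeasurable
        (Eventually.of_forall fun ζ => by rw [Complex.norm_real]; exact hK' ζ)
    rw [integral_add (hbdd hηi hα) (hbdd hηi' hγ), integral_mul_invFT hηi hα,
      integral_mul_invFT hηi' hγ] at key
    simp only [integral_exp_mul_deriv η.differentiable hηi hηi', hη] at key
    have e : (fun ζ : ℝ => -(Complex.I * ζ) * (ξ ζ : ℂ) * γ ζ) =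
        fun ζ : ℝ => -Complex.I * (((ζ * ξ ζ : ℝ) : ℂ) * γ ζ) := by
      ext ζ
      push_cast
      ring
    rw [e, integral_const_mul, neg_mul, ← sub_eq_add_neg] at key
    rw [← key, ← integral_const_mul, ← integral_sub hi1 (hi2.const_mul _)]
    congr 1
    ext ζ
    rw [Complex.real_smul]
    push_cast
    ring

end AxisymBS

end

noncomputable section

namespace AxisymBS

open scoped Topology

/-! ### Weighted pairings on `L^∞(1, ∞)` -/

lemma ae_norm_le_LInf (F : LInf) : ∀ᵐ r ∂(volume.restrict (Ioi (1 : ℝ))), ‖F r‖ ≤ ‖F‖ := by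
  have h := ae_le_eLpNormEssSup (f := F) (μ := volume.restrict (Ioi (1 : ℝ)))
  filter_upwards [h] with r hr
  rw [Lp.norm_def, eLpNorm_exponent_top, ← toReal_enorm (F r)]
  refine ENNReal.toReal_mono ?_ hr
  rw [← eLpNorm_exponent_top]
  exact Lp.eLpNorm_ne_top F

lemma ae_norm_unweight_le (σ : ℝ) (F : LInf) :
    ∀ᵐ r ∂(volume.restrict (Ioi (1 : ℝ))), ‖unweight σ F r‖ ≤ r ^ (-σ) * ‖F‖ := by
  filter_upwards [ae_norm_le_LInf F, ae_restrict_mem measurableSet_Ioi] with r hr hr1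
  have : 0 ≤ r ^ (-σ) := Real.rpow_nonneg (zero_lt_one.trans (mem_Ioi.1 hr1)).le _
  rw [unweight, norm_mul, Complex.norm_real, Real.norm_of_nonneg this]
  gcongr

lemma integrableOn_mul_unweight {σ : ℝ} {k : ℝ → ℂ}
    (hk : IntegrableOn (fun r => k r * ((r ^ (-σ) : ℝ) : ℂ)) (Ioi 1)) (F : LInf) :
    IntegrableOn (fun r => k r * unweight σ F r) (Ioi 1) := by
  have h := hk.mul_bdd (c := ‖F‖) (Lp.aestronglyMeasurable F) (ae_norm_le_LInf F)
  exact h.congr (Eventually.of_forall fun r => by simp only [unweight]; ring)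

/-- The functional `F ↦ ∫₁^∞ k(r) r^(-σ) F(r) dr`. -/
def pairing (σ : ℝ) (k : ℝ → ℂ)
    (hk : IntegrableOn (fun r => k r * ((r ^ (-σ) : ℝ) : ℂ)) (Ioi 1)) : LInf →L[ℂ] ℂ :=
  LinearMap.mkContinuous
    { toFun := fun F => ∫ r in Ioi (1 : ℝ), k r * unweight σ F r
      map_add' := fun F G => by
        rw [← integral_add (integrableOn_mul_unweight hk F) (integrableOn_mul_unweight hk G)]
        refine integral_congr_ae ?_
        filter_upwards [Lp.coeFn_add F G] with r hr
        simp only [unweight, hr, Pi.add_apply]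
        ring
      map_smul' := fun c F => by
        rw [RingHom.id_apply, smul_eq_mul, ← integral_const_mul]
        refine integral_congr_ae ?_
        filter_upwards [Lp.coeFn_smul c F] with r hr
        simp only [unweight, hr, Pi.smul_apply, smul_eq_mul]
        ring }
    (∫ r in Ioi (1 : ℝ), ‖k r * ((r ^ (-σ) : ℝ) : ℂ)‖) fun F => by
      change ‖∫ r in Ioi (1 : ℝ), k r * unweight σ F r‖ ≤ _
      rw [← integral_mul_const]
      refine norm_integral_le_of_norm_le (hk.norm.mul_const _) ?_
      filter_upwards [ae_norm_le_LInf F] with r hr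
      rw [unweight, ← mul_assoc, norm_mul]
      gcongr

@[simp] lemma pairing_apply {σ : ℝ} {k : ℝ → ℂ}
    (hk : IntegrableOn (fun r => k r * ((r ^ (-σ) : ℝ) : ℂ)) (Ioi 1)) (F : LInf) :
    pairing σ k hk F = ∫ r in Ioi (1 : ℝ), k r * unweight σ F r := rfl

lemma continuousOn_rpow_Ici (σ : ℝ) : ContinuousOn (fun r : ℝ => r ^ σ) (Ici 1) :=
  continuousOn_id.rpow_const fun _ hr => Or.inl (zero_lt_one.trans_le (mem_Ici.1 hr)).ne'

lemma integrableOn_indicator_mul_rpow {k : ℝ → ℂ} (hk : Continuous k) (σ R : ℝ) :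
    IntegrableOn (fun r => (Ioc 1 R).indicator k r * ((r ^ (-σ) : ℝ) : ℂ)) (Ioi 1) := by
  have h1 : IntegrableOn (fun r => k r * ((r ^ (-σ) : ℝ) : ℂ)) (Ioc 1 R) := by
    refine IntegrableOn.mono_set (ContinuousOn.integrableOn_Icc ?_) Ioc_subset_Icc_self
    exact hk.continuousOn.mul (Complex.continuous_ofReal.comp_continuousOn
      ((continuousOn_rpow_Ici (-σ)).mono Icc_subset_Ici_self))
  have h2 := (integrable_indicator_iff measurableSet_Ioc).2 h1
  refine (h2.integrableOn (s := Ioi 1)).congr (Eventually.of_forall fun r => ?_)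
  by_cases hr : r ∈ Ioc 1 R <;> simp [hr]

lemma integrableOn_mul_rpow_of_hasCompactSupport {k : ℝ → ℂ} (hk : Continuous k)
    (hkc : HasCompactSupport k) (σ : ℝ) :
    IntegrableOn (fun r => k r * ((r ^ (-σ) : ℝ) : ℂ)) (Ioi 1) := by
  obtain ⟨R, hR⟩ := hkc.isCompact.isBounded.subset_closedBall 0
  refine (integrableOn_indicator_mul_rpow hk σ R).congr ?_
  filter_upwards [ae_restrict_mem measurableSet_Ioi] with r hr
  by_cases h : r ∈ Ioc 1 R
  · rw [indicator_of_mem h]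
  · rw [indicator_of_notMem h]
    have : r ∉ tsupport k := fun h' => h ⟨hr, by
      have := hR h'
      rw [mem_closedBall_zero_iff] at this
      exact (le_abs_self r).trans this⟩
    rw [image_eq_zero_of_notMem_tsupport this]

lemma integral_indicator_mul_unweight {k : ℝ → ℂ} (σ : ℝ) {R : ℝ} (hR : 1 ≤ R) (F : LInf) :
    ∫ r in Ioi (1 : ℝ), (Ioc 1 R).indicator k r * unweight σ F r =
      ∫ r in (1 : ℝ)..R, k r * unweight σ F r := by
  rw [intervalIntegral.integral_of_le hR, ← integral_indicator measurableSet_Ioi,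
    ← integral_indicator measurableSet_Ioc]
  congr 1
  ext r
  by_cases hr : r ∈ Ioc 1 R
  · have : r ∈ Ioi (1 : ℝ) := hr.1
    simp [hr, this]
  · simp [hr]

lemma intervalIntegrable_mul_unweight {k : ℝ → ℂ} (hk : Continuous k) (σ : ℝ) (F : LInf) {R : ℝ}
    (hR : 1 ≤ R) : IntervalIntegrable (fun r => k r * unweight σ F r) volume 1 R := by
  rw [intervalIntegrable_iff_integrableOn_Ioc_of_le hR]
  refine ((integrableOn_mul_unweight (integrableOn_indicator_mul_rpow hk σ R) F).mono_set
    Ioc_subset_Ioi_self).congr ?_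
  filter_upwards [ae_restrict_mem measurableSet_Ioc] with r hr
  rw [indicator_of_mem hr]

lemma intervalIntegrable_unweight (σ : ℝ) (F : LInf) {R : ℝ} (hR : 1 ≤ R) :
    IntervalIntegrable (unweight σ F) volume 1 R := by
  simpa using intervalIntegrable_mul_unweight (k := fun _ => 1) continuous_const σ F hR

/-- The integrand is bounded by a multiple of `s^(1-ρ)`, which is integrable at infinity because `ρ
> 2`. -/
lemma integrableOn_id_mul_unweight {ρ : ℝ} (hρ : 2 < ρ) (F : LInf) :
    IntegrableOn (fun s : ℝ => (s : ℂ) * unweight ρ F s) (Ioi 1) := by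
  refine integrableOn_mul_unweight (k := fun s : ℝ => (s : ℂ)) ?_ F
  have h : IntegrableOn (fun s : ℝ => ((s ^ (1 - ρ) : ℝ) : ℂ)) (Ioi 1) :=
    (integrableOn_Ioi_rpow_of_lt (by linarith) zero_lt_one).ofReal
  refine h.congr ?_
  filter_upwards [ae_restrict_mem measurableSet_Ioi] with s hs
  have hs0 : 0 < s := zero_lt_one.trans (mem_Ioi.1 hs)
  rw [← Complex.ofReal_mul, sub_eq_add_neg, Real.rpow_add hs0, Real.rpow_one]

/-- `∫₁^R k(r) r^(-σ) F(r) dr`, as a functional of `F`. -/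
def truncPairing (σ : ℝ) {k : ℝ → ℂ} (hk : Continuous k) (R : ℝ) : LInf →L[ℂ] ℂ :=
  pairing σ _ (integrableOn_indicator_mul_rpow hk σ R)

lemma truncPairing_apply (σ : ℝ) {k : ℝ → ℂ} (hk : Continuous k) {R : ℝ} (hR : 1 ≤ R) (F : LInf) :
    truncPairing σ hk R F = ∫ r in (1 : ℝ)..R, k r * unweight σ F r :=
  integral_indicator_mul_unweight σ hR F

/-! ### The radial primitive -/

/-- `∫₁^r s f(s) ds` for `f = s^(1-ρ) F`. -/
def radialPrimitive (ρ : ℝ) (F : LInf) (r : ℝ) : ℂ :=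
  ∫ s in (1 : ℝ)..r, (s : ℂ) * unweight (ρ - 1) F s

lemma radialPrimitive_eq_truncPairing (ρ : ℝ) (F : LInf) {r : ℝ} (hr : 1 ≤ r) :
    radialPrimitive ρ F r = truncPairing (ρ - 1) Complex.continuous_ofReal r F :=
  (truncPairing_apply (ρ - 1) Complex.continuous_ofReal hr F).symm

lemma continuousOn_radialPrimitive (ρ : ℝ) (F : LInf) :
    ContinuousOn (radialPrimitive ρ F) (Ici 1) :=
  continuousOn_primitive_Ici fun _ hR =>
    intervalIntegrable_mul_unweight Complex.continuous_ofReal (ρ - 1) F hR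

lemma norm_radialPrimitive_le_integral (ρ : ℝ) (F : LInf) {r : ℝ} (hr : 1 ≤ r) :
    ‖radialPrimitive ρ F r‖ ≤ (∫ s in (1 : ℝ)..r, s ^ (2 - ρ)) * ‖F‖ := by
  rw [radialPrimitive, ← intervalIntegral.integral_mul_const]
  refine intervalIntegral.norm_integral_le_of_norm_le hr ?_ ?_
  · have h := ae_norm_unweight_le (ρ - 1) F
    rw [ae_restrict_iff' measurableSet_Ioi] at h
    filter_upwards [h] with s hs hsr
    have hs0 : 0 < s := zero_lt_one.trans hsr.1
    rw [norm_mul, Complex.norm_real, Real.norm_of_nonneg hs0.le,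
      show (2 - ρ) = 1 + -(ρ - 1) by ring, Real.rpow_add hs0, Real.rpow_one, mul_assoc]
    exact mul_le_mul_of_nonneg_left (hs hsr.1) hs0.le
  · refine ContinuousOn.intervalIntegrable (ContinuousOn.mul ?_ continuousOn_const)
    refine (continuousOn_rpow_Ici (2 - ρ)).mono ?_
    rw [uIcc_of_le hr]
    exact Icc_subset_Ici_self

lemma norm_radialPrimitive_le {ρ : ℝ} (hρ : ρ < 3) (F : LInf) {r : ℝ} (hr : 1 ≤ r) :
    ‖radialPrimitive ρ F r‖ ≤ r ^ (3 - ρ) / (3 - ρ) * ‖F‖ := by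
  refine (norm_radialPrimitive_le_integral ρ F hr).trans ?_
  refine mul_le_mul_of_nonneg_right ?_ (norm_nonneg _)
  rw [integral_rpow (Or.inl (by linarith)), show 2 - ρ + 1 = 3 - ρ by ring, Real.one_rpow]
  have : 0 < 3 - ρ := by linarith
  gcongr
  linarith

/-- The integrand has size at most `s^(2-ρ) ‖F‖ ≤ ‖F‖`. Linear vanishing at `r = 1` is what yields
the zero trace of the streamfunction. -/
lemma norm_radialPrimitive_le_sub_one {ρ : ℝ} (hρ : 2 ≤ ρ) (F : LInf) {r : ℝ} (hr : 1 ≤ r) :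
    ‖radialPrimitive ρ F r‖ ≤ (r - 1) * ‖F‖ := by
  refine (norm_radialPrimitive_le_integral ρ F hr).trans ?_
  refine mul_le_mul_of_nonneg_right ?_ (norm_nonneg _)
  have h1 : ∫ s in (1 : ℝ)..r, s ^ (2 - ρ) ≤ ∫ _ in (1 : ℝ)..r, (1 : ℝ) := by
    refine intervalIntegral.integral_mono_on hr (ContinuousOn.intervalIntegrable
      ((continuousOn_rpow_Ici (2 - ρ)).mono (by rw [uIcc_of_le hr]; exact Icc_subset_Ici_self)))
      (by simp) fun s hs => Real.rpow_le_one_of_one_le_of_nonpos hs.1 (by linarith)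
  simpa using h1

lemma norm_LInf_le {F : LInf} {C : ℝ} (hC : 0 ≤ C)
    (h : ∀ᵐ r ∂(volume.restrict (Ioi (1 : ℝ))), ‖F r‖ ≤ C) : ‖F‖ ≤ C := by
  rw [Lp.norm_def, eLpNorm_exponent_top]
  exact ENNReal.toReal_le_of_le_ofReal hC (eLpNormEssSup_le_of_ae_bound h)

lemma norm_rpow_mul_radialPrimitive_le {ρ : ℝ} (hρ : ρ < 3) (F : LInf) {r : ℝ} (hr : 1 < r) :
    ‖((r ^ (ρ - 3) : ℝ) : ℂ) * radialPrimitive ρ F r‖ ≤ 1 / (3 - ρ) * ‖F‖ := by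
  have hr0 : 0 < r := zero_lt_one.trans hr
  rw [norm_mul, Complex.norm_real, Real.norm_of_nonneg (Real.rpow_nonneg hr0.le _)]
  refine (mul_le_mul_of_nonneg_left (norm_radialPrimitive_le hρ F hr.le)
    (Real.rpow_nonneg hr0.le _)).trans_eq ?_
  rw [← mul_assoc, ← mul_div_assoc, ← Real.rpow_add hr0]
  simp

lemma memLp_rpow_mul_radialPrimitive {ρ : ℝ} (hρ : ρ < 3) (F : LInf) :
    MemLp (fun r : ℝ => ((r ^ (ρ - 3) : ℝ) : ℂ) * radialPrimitive ρ F r) ⊤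
      (volume.restrict (Ioi (1 : ℝ))) := by
  refine memLp_top_of_bound (C := 1 / (3 - ρ) * ‖F‖) ?_ ?_
  · refine ContinuousOn.aestronglyMeasurable ?_ measurableSet_Ioi
    exact (Complex.continuous_ofReal.comp_continuousOn
      ((continuousOn_rpow_Ici (ρ - 3)).mono Ioi_subset_Ici_self)).mul
      ((continuousOn_radialPrimitive ρ F).mono Ioi_subset_Ici_self)
  · filter_upwards [ae_restrict_mem measurableSet_Ioi] with r hr
    exact norm_rpow_mul_radialPrimitive_le hρ F hr

/-- The bounded operator `F ↦ r^(ρ-2) r⁻¹ ∫₁^r s^(2-ρ) F(s) ds`. -/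
def averageOp {ρ : ℝ} (hρ : ρ < 3) : LInf →L[ℂ] LInf :=
  LinearMap.mkContinuous
    { toFun := fun F => (memLp_rpow_mul_radialPrimitive hρ F).toLp _
      map_add' := fun F G => by
        rw [← MemLp.toLp_add]
        refine MemLp.toLp_congr _ _ ?_
        filter_upwards [ae_restrict_mem measurableSet_Ioi] with r hr
        have hr1 : 1 ≤ r := (mem_Ioi.1 hr).le
        simp only [Pi.add_apply, radialPrimitive_eq_truncPairing ρ _ hr1, map_add]
        ring
      map_smul' := fun c F => by
        rw [RingHom.id_apply, ← MemLp.toLp_const_smul]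
        refine MemLp.toLp_congr _ _ ?_
        filter_upwards [ae_restrict_mem measurableSet_Ioi] with r hr
        have hr1 : 1 ≤ r := (mem_Ioi.1 hr).le
        simp only [Pi.smul_apply, radialPrimitive_eq_truncPairing ρ _ hr1, map_smul, smul_eq_mul]
        ring }
    (1 / (3 - ρ)) fun F => by
      have h3 : 0 < 3 - ρ := by linarith
      refine norm_LInf_le (by positivity) ?_
      filter_upwards [(memLp_rpow_mul_radialPrimitive hρ F).coeFn_toLp,
        ae_restrict_mem measurableSet_Ioi] with r hr hr1
      change ‖((memLp_rpow_mul_radialPrimitive hρ F).toLp _ : LInf) r‖ ≤ _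
      rw [hr]
      exact norm_rpow_mul_radialPrimitive_le hρ F hr1

lemma unweight_averageOp {ρ : ℝ} (hρ : ρ < 3) (F : LInf) :
    ∀ᵐ r ∂(volume.restrict (Ioi (1 : ℝ))),
      unweight (ρ - 2) (averageOp hρ F) r = radialPrimitive ρ F r / r := by
  filter_upwards [(memLp_rpow_mul_radialPrimitive hρ F).coeFn_toLp,
    ae_restrict_mem measurableSet_Ioi] with r hr hr1
  have hr0 : 0 < r := zero_lt_one.trans hr1
  have e : averageOp hρ F = (memLp_rpow_mul_radialPrimitive hρ F).toLp _ := rfl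
  rw [unweight, e, hr, ← mul_assoc, ← Complex.ofReal_mul, ← Real.rpow_add hr0,
    show -(ρ - 2) + (ρ - 3) = -1 by ring, Real.rpow_neg_one, Complex.ofReal_inv, div_eq_inv_mul]

/-! ### Elements of `X` as densities with respect to the frequency measure -/

section Total

variable {ρ : ℝ} (μ : XMeas ρ)

/-- The density of `h dΛ + ∑ₘ bₘ δₘ` with respect to `freqMeasure`. -/
def XMeas.total : ℝ → LInf := glue μ.g μ.a

lemma XMeas.integrable_total : Integrable μ.total freqMeasure :=
  integrable_glue μ.integrable_g μ.summable_a

/-- The factor `(2π)^(-1/2)`. -/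
def fourierConst : ℂ := (((Real.sqrt (2 * Real.pi))⁻¹ : ℝ) : ℂ)

lemma XMeas.invFourier_eq (z : ℝ) : μ.invFourier z = fourierConst • invFT μ.total z := by
  have e : invFT μ.total z =
      ∫ ζ : ℝ, Complex.exp (Complex.I * z * ζ) • μ.total ζ ∂freqMeasure := rfl
  rw [e, integral_freqMeasure (integrable_exp_smul μ.integrable_total z), XMeas.invFourier,
    fourierConst]
  congr 2
  · refine integral_congr_ae ?_
    filter_upwards [glue_ae_eq μ.g μ.a] with ζ hζ
    rw [XMeas.total, hζ]
  · refine tsum_congr fun m => ?_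
    rw [XMeas.total, glue_intCast, Complex.ofReal_intCast]
    congr 2
    ring

/-- The coefficients `d`, as a function on the frequencies. -/
def XMeas.freqD (ζ : ℝ) : ℂ :=
  if ζ = 0 then dZero (unweight ρ (μ.total 0)) else dPos |ζ| (unweight ρ (μ.total ζ))

/-- `ψ̂`, as a function on the frequencies. -/
def XMeas.freqPsi (ζ r : ℝ) : ℂ :=
  if ζ = 0 then psiHatZero (unweight ρ (μ.total 0)) r else psiHatPos |ζ| (unweight ρ (μ.total ζ)) r

lemma XMeas.freqD_intCast (m : ℤ) : μ.freqD m = dAtom μ m := by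
  have h0 : μ.total 0 = μ.a 0 := by simpa [XMeas.total] using glue_intCast μ.g μ.a 0
  rw [freqD, dAtom, h0, XMeas.total, glue_intCast]
  simp only [Int.cast_eq_zero]
  rfl

lemma XMeas.freqPsi_intCast (m : ℤ) (r : ℝ) : μ.freqPsi m r = psiAtom μ m r := by
  have h0 : μ.total 0 = μ.a 0 := by simpa [XMeas.total] using glue_intCast μ.g μ.a 0
  rw [freqPsi, psiAtom, h0, XMeas.total, glue_intCast]
  simp only [Int.cast_eq_zero]
  rfl

lemma XMeas.ae_total_eq : ∀ᵐ ζ : ℝ, ζ ≠ 0 ∧ μ.total ζ = μ.g ζ := by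
  filter_upwards [glue_ae_eq μ.g μ.a, (countable_singleton (0 : ℝ)).ae_notMem volume] with ζ h h0
  exact ⟨h0, h⟩

lemma XMeas.ae_freqD_eq : ∀ᵐ ζ : ℝ, μ.freqD ζ = dDens μ ζ := by
  filter_upwards [μ.ae_total_eq] with ζ hζ
  rw [freqD, if_neg hζ.1, hζ.2]
  rfl

lemma XMeas.ae_freqPsi_eq : ∀ᵐ ζ : ℝ, ∀ r, μ.freqPsi ζ r = psiDens μ ζ r := by
  filter_upwards [μ.ae_total_eq] with ζ hζ r
  rw [freqPsi, if_neg hζ.1, hζ.2]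
  rfl

/-- Integrability allows the integral over `freqMeasure` to be split into an integral and a series.
In the application it comes from the identification of `ψ̂` with `P / r`, not from Bessel estimates.
-/
lemma XMeas.streamfunction_eq {r : ℝ} (h : Integrable (fun ζ => μ.freqPsi ζ r) freqMeasure)
    (z : ℝ) : streamfunction μ (r, z) = fourierConst * invFT (fun ζ => μ.freqPsi ζ r) z := by
  rw [invFT, integral_freqMeasure (integrable_exp_smul h z), streamfunction, fourierConst]
  congr 2
  · refine integral_congr_ae ?_
    filter_upwards [μ.ae_freqPsi_eq] with ζ hζ
    rw [hζ, smul_eq_mul]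
  · refine tsum_congr fun m => ?_
    rw [μ.freqPsi_intCast, Complex.ofReal_intCast, smul_eq_mul]
    congr 2
    ring

lemma XMeas.dDens_dAtom_eq_zero (h : ∀ᵐ ζ ∂freqMeasure, μ.freqD ζ = 0) :
    (∀ᵐ ζ : ℝ, dDens μ ζ = 0) ∧ ∀ m : ℤ, dAtom μ m = 0 := by
  obtain ⟨h1, h2⟩ := ae_freqMeasure_iff.1 h
  refine ⟨?_, fun m => by rw [← μ.freqD_intCast, h2 m]⟩
  filter_upwards [h1, μ.ae_freqD_eq] with ζ hζ hζ'
  rw [← hζ', hζ]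

/-- The image of an element of `X` under a bounded operator. -/
def XMeas.map {σ : ℝ} (L : LInf →L[ℂ] LInf) : XMeas σ where
  g ζ := L (μ.g ζ)
  a m := L (μ.a m)
  integrable_g := L.integrable_comp μ.integrable_g
  summable_a := by
    refine Summable.of_nonneg_of_le (fun m => norm_nonneg _) (fun m => L.le_opNorm (μ.a m)) ?_
    exact μ.summable_a.mul_left _

lemma XMeas.invFourier_map {σ : ℝ} (L : LInf →L[ℂ] LInf) (z : ℝ) :
    (μ.map L : XMeas σ).invFourier z = L (μ.invFourier z) := by
  have h : (μ.map L : XMeas σ).total = fun ζ => L (μ.total ζ) := by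
    ext1 ζ
    simp only [XMeas.total, glue, XMeas.map]
    split_ifs <;> rfl
  rw [XMeas.invFourier_eq, XMeas.invFourier_eq, map_smul, map_invFT L μ.integrable_total, h]

end Total

end AxisymBS

end

noncomputable section

namespace AxisymBS

open scoped Topology

/-! ### Weak derivatives on the half plane -/

lemma isOpen_halfPlane : IsOpen halfPlane := isOpen_Ioi.prod isOpen_univ

lemma measurableSet_halfPlane : MeasurableSet halfPlane := isOpen_halfPlane.measurableSet

lemma hpVol_eq_prod : hpVol = (volume.restrict (Ioi (1 : ℝ))).prod (volume : Measure ℝ) := by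
  rw [hpVol, halfPlane, Measure.volume_eq_prod, ← Measure.prod_restrict, Measure.restrict_univ]

lemma ae_hpVol_mem : ∀ᵐ x ∂hpVol, x ∈ halfPlane := ae_restrict_mem measurableSet_halfPlane

/-- Smooth compactly supported test functions on the plane. -/
def IsTest (φ : ℝ × ℝ → ℝ) : Prop :=
  ContDiff ℝ ((⊤ : ℕ∞) : WithTop ℕ∞) φ ∧ HasCompactSupport φ

lemma IsTest.differentiableAt {φ : ℝ × ℝ → ℝ} (hφ : IsTest φ) (x : ℝ × ℝ) :
    DifferentiableAt ℝ φ x := hφ.1.differentiable (by simp) x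

lemma IsTest.continuous_fderiv_apply {φ : ℝ × ℝ → ℝ} (hφ : IsTest φ) (e : ℝ × ℝ) :
    Continuous fun x => fderiv ℝ φ x e :=
  (hφ.1.continuous_fderiv (by simp)).clm_apply continuous_const

lemma IsTest.hasCompactSupport_fderiv_apply {φ : ℝ × ℝ → ℝ} (hφ : IsTest φ) (e : ℝ × ℝ) :
    HasCompactSupport fun x => fderiv ℝ φ x e :=
  hφ.2.fderiv_apply ℝ e

lemma MemL2loc.integrableOn_inter_closedBall {u : ℝ × ℝ → ℂ} (hu : MemL2loc u) (R : ℝ) :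
    IntegrableOn u (halfPlane ∩ Metric.closedBall 0 R) := by
  have : IsFiniteMeasure ((volume : Measure (ℝ × ℝ)).restrict (halfPlane ∩ Metric.closedBall 0 R)) :=
    ⟨by
      rw [Measure.restrict_apply_univ]
      exact (measure_mono inter_subset_right).trans_lt
        (isCompact_closedBall (0 : ℝ × ℝ) R).measure_lt_top⟩
  exact (hu R).integrable (by norm_num)

lemma MemL2loc.integrable_mul {u : ℝ × ℝ → ℂ} (hu : MemL2loc u) {φ : ℝ × ℝ → ℝ}
    (hφ : Continuous φ) (hφc : HasCompactSupport φ) :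
    Integrable (fun x => (φ x : ℂ) * u x) hpVol := by
  obtain ⟨R, hR⟩ := hφc.isCompact.isBounded.subset_closedBall 0
  obtain ⟨K, hK⟩ := hφ.bounded_above_of_compact_support hφc
  have h1 : IntegrableOn (fun x => (φ x : ℂ) * u x) (halfPlane ∩ Metric.closedBall 0 R) :=
    (hu.integrableOn_inter_closedBall R).bdd_mul (c := K)
      (Complex.continuous_ofReal.comp hφ).aestronglyMeasurable
      (Eventually.of_forall fun x => by rw [Complex.norm_real]; exact hK x)
  refine h1.of_forall_sdiff_eq_zero measurableSet_halfPlane fun x hx => ?_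
  have : x ∉ tsupport φ := fun h => hx.2 ⟨hx.1, hR h⟩
  rw [image_eq_zero_of_notMem_tsupport this, Complex.ofReal_zero, zero_mul]

lemma integrable_mul_of_tsupport_subset {u : ℝ × ℝ → ℂ} (hu : LocallyIntegrableOn u halfPlane)
    {φ : ℝ × ℝ → ℝ} (hφ : Continuous φ) (hφc : HasCompactSupport φ) (hs : tsupport φ ⊆ halfPlane) :
    Integrable (fun x => (φ x : ℂ) * u x) hpVol := by
  obtain ⟨K, hK⟩ := hφ.bounded_above_of_compact_support hφc
  have h1 : IntegrableOn (fun x => (φ x : ℂ) * u x) (tsupport φ) :=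
    (hu.integrableOn_compact_subset hs hφc.isCompact).bdd_mul (c := K)
      (Complex.continuous_ofReal.comp hφ).aestronglyMeasurable
      (Eventually.of_forall fun x => by rw [Complex.norm_real]; exact hK x)
  refine h1.of_forall_sdiff_eq_zero measurableSet_halfPlane fun x hx => ?_
  rw [image_eq_zero_of_notMem_tsupport hx.2, Complex.ofReal_zero, zero_mul]

/-- Uniqueness of weak derivatives. The Sobolev condition, the trace, the divergence and the
rotation each assert the existence of weak derivatives of their own, and these must be identified
with one another. -/
lemma HasWeakPartial.ae_eq {e : ℝ × ℝ} {u p p' : ℝ × ℝ → ℂ} (h : HasWeakPartial e u p)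
    (h' : HasWeakPartial e u p') : p =ᵐ[hpVol] p' := by
  have key := isOpen_halfPlane.ae_eq_zero_of_integral_contDiff_smul_eq_zero (μ := volume)
    (f := p - p') (h.2.1.sub h'.2.1) fun φ hφ hφc hs => ?_
  · rw [EventuallyEq, hpVol, ae_restrict_iff' measurableSet_halfPlane]
    filter_upwards [key] with x hx hxm using sub_eq_zero.1 (hx hxm)
  · have e1 : ∫ x, φ x • (p - p') x = ∫ x, ((φ x : ℂ) * p x - (φ x : ℂ) * p' x) ∂hpVol := by
      rw [hpVol, ← integral_indicator measurableSet_halfPlane]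
      congr 1
      ext x
      by_cases hx : x ∈ halfPlane
      · rw [indicator_of_mem hx, Pi.sub_apply, Complex.real_smul, mul_sub]
      · rw [indicator_of_notMem hx, image_eq_zero_of_notMem_tsupport fun hm => hx (hs hm), zero_smul]
    rw [e1, integral_sub (integrable_mul_of_tsupport_subset h.2.1 hφ.continuous hφc hs)
      (integrable_mul_of_tsupport_subset h'.2.1 hφ.continuous hφc hs)]
    have h1 := h.2.2 φ hφ hφc hs
    have h2 := h'.2.2 φ hφ hφc hs
    rw [h1] at h2
    linear_combination -h2

lemma MemL2loc.congr {u w : ℝ × ℝ → ℂ} (hu : MemL2loc u) (h : u =ᵐ[hpVol] w) : MemL2loc w :=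
  fun R => (hu R).ae_eq (ae_mono (Measure.restrict_mono inter_subset_left le_rfl) h)

lemma MemL2loc.sub {u w : ℝ × ℝ → ℂ} (hu : MemL2loc u) (hw : MemL2loc w) :
    MemL2loc fun x => u x - w x := fun R => (hu R).sub (hw R)

lemma MemW12loc.memL2loc_partial_r {u p : ℝ × ℝ → ℂ} (hu : MemW12loc u)
    (h : HasWeakPartial (1, 0) u p) : MemL2loc p := by
  obtain ⟨_, p', q', hp', _, hp, _⟩ := hu
  exact hp'.congr (hp.ae_eq h)

lemma MemW12loc.memL2loc_partial_z {u q : ℝ × ℝ → ℂ} (hu : MemW12loc u)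
    (h : HasWeakPartial (0, 1) u q) : MemL2loc q := by
  obtain ⟨_, p', q', _, hq', _, hq⟩ := hu
  exact hq'.congr (hq.ae_eq h)

/-- The test function `r φ`. -/
def radialMul (φ : ℝ × ℝ → ℝ) (x : ℝ × ℝ) : ℝ := x.1 * φ x

lemma IsTest.radialMul {φ : ℝ × ℝ → ℝ} (hφ : IsTest φ) : IsTest (radialMul φ) :=
  ⟨contDiff_fst.mul hφ.1, hφ.2.mul_left⟩

lemma tsupport_radialMul_subset (φ : ℝ × ℝ → ℝ) : tsupport (radialMul φ) ⊆ tsupport φ :=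
  closure_mono fun x hx => by
    rw [Function.mem_support] at hx ⊢
    exact right_ne_zero_of_mul hx

lemma IsTest.fderiv_radialMul {φ : ℝ × ℝ → ℝ} (hφ : IsTest φ) (x e : ℝ × ℝ) :
    fderiv ℝ (AxisymBS.radialMul φ) x e = x.1 * fderiv ℝ φ x e + φ x * e.1 := by
  have h := (hasFDerivAt_fst (𝕜 := ℝ) (p := x)).fun_mul (hφ.differentiableAt x).hasFDerivAt
  have e1 : AxisymBS.radialMul φ = fun y : ℝ × ℝ => y.1 * φ y := rfl
  rw [e1, h.fderiv]
  simp

/-- Tangential weak derivatives may be tested up to the boundary. -/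
lemma HasWeakPartial.integral_eq_of_tangential {u q : ℝ × ℝ → ℂ} (h : HasWeakPartial (0, 1) u q)
    (hu : MemL2loc u) (hq : MemL2loc q) {φ : ℝ × ℝ → ℝ} (hφ : IsTest φ) :
    ∫ x, ((fderiv ℝ φ x (0, 1) : ℝ) : ℂ) * u x ∂hpVol = - ∫ x, (φ x : ℂ) * q x ∂hpVol := by
  -- The cutoffs depend on `r` alone, so `∂_z` never falls on them and they can be removed by
  -- dominated convergence.
  set θ : ℕ → ℝ × ℝ → ℝ := fun n x => Real.smoothTransition (n * (x.1 - 1) - 1) with hθ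
  have hθs (n : ℕ) : ContDiff ℝ ((⊤ : ℕ∞) : WithTop ℕ∞) (θ n) :=
    Real.smoothTransition.contDiff.comp (by fun_prop)
  have hθb (n : ℕ) (x : ℝ × ℝ) : ‖((θ n x : ℝ) : ℂ)‖ ≤ 1 := by
    rw [Complex.norm_real, Real.norm_of_nonneg (Real.smoothTransition.nonneg _)]
    exact Real.smoothTransition.le_one _
  have hθ1 {x : ℝ × ℝ} (hx : x ∈ halfPlane) : Tendsto (fun n => ((θ n x : ℝ) : ℂ)) atTop (𝓝 1) := by
    refine tendsto_const_nhds.congr' ?_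
    have hx1 : 1 < x.1 := hx.1
    filter_upwards [((tendsto_natCast_atTop_atTop (R := ℝ)).atTop_mul_const
      (sub_pos.2 hx1)).eventually_ge_atTop 2] with n hn
    rw [hθ]
    simp only
    rw [Real.smoothTransition.one_of_one_le (by linarith), Complex.ofReal_one]
  have hlim {ψ : ℝ × ℝ → ℝ} {w : ℝ × ℝ → ℂ} (hi : Integrable (fun x => (ψ x : ℂ) * w x) hpVol) :
      Tendsto (fun n => ∫ x, ((θ n x : ℝ) : ℂ) * ((ψ x : ℂ) * w x) ∂hpVol) atTop
        (𝓝 (∫ x, (ψ x : ℂ) * w x ∂hpVol)) := by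
    refine tendsto_integral_of_dominated_convergence (fun x => ‖(ψ x : ℂ) * w x‖) (fun n => ?_)
      hi.norm (fun n => ?_) ?_
    · exact (Complex.continuous_ofReal.comp (hθs n).continuous).aestronglyMeasurable.mul
        hi.aestronglyMeasurable
    · refine Eventually.of_forall fun x => ?_
      rw [norm_mul]
      exact mul_le_of_le_one_left (norm_nonneg _) (hθb n x)
    · filter_upwards [ae_hpVol_mem] with x hx
      simpa using (hθ1 hx).mul_const ((ψ x : ℂ) * w x)
  have hi1 := hu.integrable_mul (hφ.continuous_fderiv_apply (0, 1))
    (hφ.hasCompactSupport_fderiv_apply (0, 1))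
  have hi2 := hq.integrable_mul hφ.1.continuous hφ.2
  refine tendsto_nhds_unique (hlim hi1) ((hlim hi2).neg.congr fun n => ?_)
  have ht : IsTest fun x => θ n x * φ x := ⟨(hθs n).mul hφ.1, hφ.2.mul_left⟩
  -- The support lies in the closed set `n (r - 1) ≥ 1`, which is contained in the open half plane;
  -- the `- 1` in the cutoff is there for this reason.
  have hs : tsupport (fun x => θ n x * φ x) ⊆ halfPlane := by
    have hsub : Function.support (fun x => θ n x * φ x) ⊆
        {x : ℝ × ℝ | (1 : ℝ) ≤ n * (x.1 - 1)} := fun x hx => by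
      by_contra hx'
      simp only [mem_ofPred_eq, not_le] at hx'
      refine (left_ne_zero_of_mul (Function.mem_support.1 hx)) ?_
      exact Real.smoothTransition.zero_of_nonpos (by linarith)
    have hcl : IsClosed {x : ℝ × ℝ | (1 : ℝ) ≤ n * (x.1 - 1)} :=
      isClosed_le continuous_const (by fun_prop)
    intro x hx
    have hx' : (1 : ℝ) ≤ n * (x.1 - 1) := closure_minimal hsub hcl hx
    refine ⟨?_, mem_univ _⟩
    by_contra hx1
    have : x.1 ≤ 1 := not_lt.1 hx1
    have : (n : ℝ) * (x.1 - 1) ≤ 0 :=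
      mul_nonpos_of_nonneg_of_nonpos (by positivity) (by linarith)
    linarith
  have key := h.2.2 _ ht.1 ht.2 hs
  have hfd (x : ℝ × ℝ) : fderiv ℝ (fun x => θ n x * φ x) x (0, 1) =
      θ n x * fderiv ℝ φ x (0, 1) := by
    have h1 : HasDerivAt Real.smoothTransition
        (deriv Real.smoothTransition (n * (x.1 - 1) - 1)) (n * (x.1 - 1) - 1) :=
      ((Real.smoothTransition.contDiff (n := 1)).differentiable (by simp) _).hasDerivAt
    have h2 : HasFDerivAt (fun x : ℝ × ℝ => (n : ℝ) * (x.1 - 1) - 1) _ x :=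
      ((((hasFDerivAt_fst (𝕜 := ℝ) (p := x)).sub_const 1).const_mul (n : ℝ)).sub_const 1)
    have hθc : θ n = Real.smoothTransition ∘ fun x : ℝ × ℝ => (n : ℝ) * (x.1 - 1) - 1 := rfl
    have hd := HasDerivAt.comp_hasFDerivAt x h1 h2
    rw [← hθc] at hd
    rw [(hd.fun_mul (hφ.differentiableAt x).hasFDerivAt).fderiv]
    simp
  simp only [hfd, Complex.ofReal_mul, mul_assoc] at key
  rw [key]

/-- Follows by testing with `r φ`. It compares the derivative of `r v^r` in the divergence with the
derivative of `v^r` in the trace formula. -/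
lemma HasWeakPartial.radialMul {u p : ℝ × ℝ → ℂ} (h : HasWeakPartial (1, 0) u p) :
    HasWeakPartial (1, 0) (fun x => (x.1 : ℂ) * u x) fun x => u x + (x.1 : ℂ) * p x := by
  have hmul {w : ℝ × ℝ → ℂ} (hw : LocallyIntegrableOn w halfPlane) :
      LocallyIntegrableOn (fun x : ℝ × ℝ => (x.1 : ℂ) * w x) halfPlane :=
    hw.continuousOn_mul (by fun_prop : Continuous fun x : ℝ × ℝ => (x.1 : ℂ)).continuousOn
      isOpen_halfPlane.isLocallyClosed
  refine ⟨hmul h.1, h.1.add (hmul h.2.1), fun φ hφ hφc hs => ?_⟩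
  have ht : IsTest φ := ⟨hφ, hφc⟩
  have hs' := (tsupport_radialMul_subset φ).trans hs
  have key := h.2.2 _ ht.radialMul.1 ht.radialMul.2 hs'
  have hd : tsupport (fun x => fderiv ℝ φ x (1, 0)) ⊆ halfPlane :=
    (tsupport_fderiv_apply_subset ℝ _).trans hs
  have i1 := integrable_mul_of_tsupport_subset h.1 hφ.continuous hφc hs
  have i2 := integrable_mul_of_tsupport_subset (hmul h.1) (ht.continuous_fderiv_apply (1, 0))
    (ht.hasCompactSupport_fderiv_apply (1, 0)) hd
  have i3 := integrable_mul_of_tsupport_subset (hmul h.2.1) hφ.continuous hφc hs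
  have e1 : ∫ x, ((fderiv ℝ (AxisymBS.radialMul φ) x (1, 0) : ℝ) : ℂ) * u x ∂hpVol =
      (∫ x, ((fderiv ℝ φ x (1, 0) : ℝ) : ℂ) * ((x.1 : ℂ) * u x) ∂hpVol) +
        ∫ x, (φ x : ℂ) * u x ∂hpVol := by
    rw [← integral_add i2 i1]
    congr 1
    ext x
    rw [ht.fderiv_radialMul]
    push_cast
    ring
  have e2 : ∫ x, ((AxisymBS.radialMul φ x : ℝ) : ℂ) * p x ∂hpVol =
      ∫ x, (φ x : ℂ) * ((x.1 : ℂ) * p x) ∂hpVol := by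
    congr 1
    ext x
    rw [AxisymBS.radialMul]
    push_cast
    ring
  have e3 : ∫ x, (φ x : ℂ) * (u x + (x.1 : ℂ) * p x) ∂hpVol =
      (∫ x, (φ x : ℂ) * u x ∂hpVol) + ∫ x, (φ x : ℂ) * ((x.1 : ℂ) * p x) ∂hpVol := by
    rw [← integral_add i1 i3]
    congr 1
    ext x
    ring
  rw [e1, e2] at key
  rw [e3]
  linear_combination key

/-! ### Divergence and rotation tested up to the boundary -/

section Field

variable {v : AxisymField}

/-- `div v = 0`, tested up to the boundary. -/
lemma AxisymField.DivFree.integral_eq_zero (hdiv : v.DivFree) (hvW : v.W12loc)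
    (hbdry : v.ZeroOnBoundary) {φ : ℝ × ℝ → ℝ} (hφ : IsTest φ) :
    ∫ x, ((x.1 * fderiv ℝ φ x (1, 0) : ℝ) : ℂ) * v.r x +
      ((x.1 * fderiv ℝ φ x (0, 1) : ℝ) : ℂ) * v.z x ∂hpVol = 0 := by
  obtain ⟨P, Q, hP, hQ, hPQ⟩ := hdiv
  obtain ⟨⟨_, _, p, hp, hpw, htr⟩, _, _⟩ := hbdry
  have hQ2 := hvW.2.2.memL2loc_partial_z hQ
  -- Both are `∂_r (r v^r)`, so `div v = 0` becomes `v^r + r p + r Q = 0`; the zero trace removes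
  -- the boundary term when `r φ` is used as a test function.
  have hPp := hP.ae_eq hpw.radialMul
  have ht := hφ.radialMul
  have key1 := htr _ ht.1 ht.2
  simp only [Pi.zero_apply, mul_zero, integral_zero, neg_zero] at key1
  have key2 := hQ.integral_eq_of_tangential hvW.2.2.1 hQ2 ht
  have i1 : Integrable (fun x => ((x.1 * fderiv ℝ φ x (1, 0) : ℝ) : ℂ) * v.r x) hpVol :=
    hvW.1.1.integrable_mul (continuous_fst.mul (hφ.continuous_fderiv_apply _))
      ((hφ.hasCompactSupport_fderiv_apply _).mul_left)
  have i2 : Integrable (fun x => ((x.1 * fderiv ℝ φ x (0, 1) : ℝ) : ℂ) * v.z x) hpVol :=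
    hvW.2.2.1.integrable_mul (continuous_fst.mul (hφ.continuous_fderiv_apply _))
      ((hφ.hasCompactSupport_fderiv_apply _).mul_left)
  have i3 : Integrable (fun x => (AxisymBS.radialMul φ x : ℂ) * Q x) hpVol :=
    hQ2.integrable_mul ht.1.continuous ht.2
  have e1 : ∫ x, ((fderiv ℝ (AxisymBS.radialMul φ) x (1, 0) : ℝ) : ℂ) * v.r x +
      (AxisymBS.radialMul φ x : ℂ) * p x ∂hpVol =
      ∫ x, ((x.1 * fderiv ℝ φ x (1, 0) : ℝ) : ℂ) * v.r x - (AxisymBS.radialMul φ x : ℂ) * Q x ∂hpVol := by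
    refine integral_congr_ae ?_
    filter_upwards [hPp, hPQ, ae_hpVol_mem] with x h1 h2 h3
    have hx0 : (x.1 : ℂ) ≠ 0 := by exact_mod_cast (zero_lt_one.trans h3.1).ne'
    rw [h1] at h2
    field_simp at h2
    rw [hφ.fderiv_radialMul, AxisymBS.radialMul]
    push_cast
    linear_combination (φ x : ℂ) * h2
  have e2 : ∫ x, ((fderiv ℝ (AxisymBS.radialMul φ) x (0, 1) : ℝ) : ℂ) * v.z x ∂hpVol =
      ∫ x, ((x.1 * fderiv ℝ φ x (0, 1) : ℝ) : ℂ) * v.z x ∂hpVol := by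
    congr 1
    ext x
    rw [hφ.fderiv_radialMul]
    simp
  rw [e1, integral_sub i1 i3] at key1
  rw [e2] at key2
  rw [integral_add i1 i2]
  linear_combination key1 + key2

lemma AxisymField.IsRotTheta.memL2loc {ω : ℝ × ℝ → ℂ} (hrot : v.IsRotTheta ω) (hvW : v.W12loc) :
    MemL2loc ω := by
  obtain ⟨p, q, hp, hq, hω⟩ := hrot
  exact ((hvW.1.memL2loc_partial_z hp).sub (hvW.2.2.memL2loc_partial_r hq)).congr hω.symm

/-- `(rot v)^θ = ω`, tested up to the boundary. -/
lemma AxisymField.IsRotTheta.integral_eq {ω : ℝ × ℝ → ℂ} (hrot : v.IsRotTheta ω) (hvW : v.W12loc)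
    (hbdry : v.ZeroOnBoundary) {φ : ℝ × ℝ → ℝ} (hφ : IsTest φ) :
    ∫ x, ((fderiv ℝ φ x (1, 0) : ℝ) : ℂ) * v.z x -
      ((fderiv ℝ φ x (0, 1) : ℝ) : ℂ) * v.r x ∂hpVol = ∫ x, (φ x : ℂ) * ω x ∂hpVol := by
  obtain ⟨p, q, hp, hq, hω⟩ := hrot
  obtain ⟨_, _, _, _, q', _, hq'w, htr⟩ := hbdry
  have hp2 := hvW.1.memL2loc_partial_z hp
  have hq2 := hvW.2.2.memL2loc_partial_r hq
  have hqq := hq.ae_eq hq'w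
  have key1 := htr _ hφ.1 hφ.2
  simp only [Pi.zero_apply, mul_zero, integral_zero, neg_zero] at key1
  have key2 := hp.integral_eq_of_tangential hvW.1.1 hp2 hφ
  have i1 := hvW.2.2.1.integrable_mul (hφ.continuous_fderiv_apply (1, 0))
    (hφ.hasCompactSupport_fderiv_apply (1, 0))
  have i2 := hvW.1.1.integrable_mul (hφ.continuous_fderiv_apply (0, 1))
    (hφ.hasCompactSupport_fderiv_apply (0, 1))
  have i3 := hp2.integrable_mul hφ.1.continuous hφ.2
  have i4 := hq2.integrable_mul hφ.1.continuous hφ.2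
  have e1 : ∫ x, (φ x : ℂ) * ω x ∂hpVol =
      (∫ x, (φ x : ℂ) * p x ∂hpVol) - ∫ x, (φ x : ℂ) * q x ∂hpVol := by
    rw [← integral_sub i3 i4]
    refine integral_congr_ae ?_
    filter_upwards [hω] with x hx
    rw [hx, mul_sub]
  have e2 : ∫ x, ((fderiv ℝ φ x (1, 0) : ℝ) : ℂ) * v.z x + (φ x : ℂ) * q' x ∂hpVol =
      (∫ x, ((fderiv ℝ φ x (1, 0) : ℝ) : ℂ) * v.z x ∂hpVol) + ∫ x, (φ x : ℂ) * q x ∂hpVol := by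
    rw [← integral_add i1 i4]
    refine integral_congr_ae ?_
    filter_upwards [hqq] with x hx
    rw [hx]
  rw [e2] at key1
  rw [e1, integral_sub i1 i2, key2]
  linear_combination key1

end Field

end AxisymBS

end

noncomputable section

namespace AxisymBS

open scoped Topology

/-! ### The equations for each frequency -/

/-! ### Test functions of product form -/

section ProductTest

variable {χ η : ℝ → ℝ}

lemma hasCompactSupport_prod (hχc : HasCompactSupport χ) (hηc : HasCompactSupport η) :
    HasCompactSupport fun x : ℝ × ℝ => χ x.1 * η x.2 := by
  refine HasCompactSupport.intro (hχc.isCompact.prod hηc.isCompact) fun x hx => ?_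
  rw [mem_prod, not_and_or] at hx
  rcases hx with h | h
  · rw [image_eq_zero_of_notMem_tsupport h, zero_mul]
  · rw [image_eq_zero_of_notMem_tsupport h, mul_zero]

lemma isTest_prod (hχ : ContDiff ℝ ((⊤ : ℕ∞) : WithTop ℕ∞) χ) (hχc : HasCompactSupport χ)
    (hη : ContDiff ℝ ((⊤ : ℕ∞) : WithTop ℕ∞) η) (hηc : HasCompactSupport η) :
    IsTest fun x => χ x.1 * η x.2 :=
  ⟨(hχ.comp contDiff_fst).mul (hη.comp contDiff_snd), hasCompactSupport_prod hχc hηc⟩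

lemma fderiv_prod_apply (hχ : Differentiable ℝ χ) (hη : Differentiable ℝ η) (x e : ℝ × ℝ) :
    fderiv ℝ (fun x : ℝ × ℝ => χ x.1 * η x.2) x e =
      χ x.1 * (deriv η x.2 * e.2) + η x.2 * (deriv χ x.1 * e.1) := by
  have h1 : HasFDerivAt (fun x : ℝ × ℝ => χ x.1) _ x :=
    (hχ x.1).hasDerivAt.comp_hasFDerivAt x (hasFDerivAt_fst (𝕜 := ℝ) (p := x))
  have h2 : HasFDerivAt (fun x : ℝ × ℝ => η x.2) _ x :=
    (hη x.2).hasDerivAt.comp_hasFDerivAt x (hasFDerivAt_snd (𝕜 := ℝ) (p := x))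
  rw [(h1.fun_mul h2).fderiv]
  simp

/-- The Fourier transform of a function tested with a product. -/
lemma integral_prod_test {σ : ℝ} {u : ℝ × ℝ → ℂ} {μ : XMeas σ} (hu : IsFourierTransform u μ)
    (hL : MemL2loc u) (hχ : Continuous χ) (hχc : HasCompactSupport χ) (hη : Continuous η)
    (hηc : HasCompactSupport η) :
    ∫ x, ((χ x.1 * η x.2 : ℝ) : ℂ) * u x ∂hpVol = fourierConst * ∫ z, (η z : ℂ) *
      invFT (fun ζ => ∫ r in Ioi (1 : ℝ), (χ r : ℂ) * unweight σ (μ.total ζ) r) z := by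
  have hi := hL.integrable_mul (φ := fun x => χ x.1 * η x.2)
    ((hχ.comp continuous_fst).mul (hη.comp continuous_snd)) (hasCompactSupport_prod hχc hηc)
  rw [hpVol_eq_prod] at hi ⊢
  -- The `r`-integral has to be the inner one: the inverse transform is known, for almost every `z`,
  -- as an `L^∞` class in `r`, on which the test in `r` is a functional.
  rw [integral_prod_symm _ hi, ← integral_const_mul]
  refine integral_congr_ae ?_
  filter_upwards [hu.2] with z hz
  have hk := integrableOn_mul_rpow_of_hasCompactSupport
    (Complex.continuous_ofReal.comp hχ) (hχc.comp_left (g := ((↑) : ℝ → ℂ)) Complex.ofReal_zero) σ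
  have e1 : ∫ r in Ioi (1 : ℝ), ((χ r * η z : ℝ) : ℂ) * u (r, z) =
      (η z : ℂ) * pairing σ _ hk (μ.invFourier z) := by
    rw [pairing_apply, ← integral_const_mul]
    refine integral_congr_ae ?_
    filter_upwards [hz] with r hr
    rw [hr]
    simp only [Function.comp]
    push_cast
    ring
  rw [e1, μ.invFourier_eq, map_smul, map_invFT _ μ.integrable_total, smul_eq_mul]
  simp only [pairing_apply, Function.comp]
  ring

lemma integrable_pairing_total {σ : ℝ} (μ : XMeas σ) (hχ : Continuous χ)
    (hχc : HasCompactSupport χ) :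
    Integrable (fun ζ => ∫ r in Ioi (1 : ℝ), (χ r : ℂ) * unweight σ (μ.total ζ) r) freqMeasure :=
  (pairing σ _ (integrableOn_mul_rpow_of_hasCompactSupport
    (Complex.continuous_ofReal.comp hχ) (hχc.comp_left (g := ((↑) : ℝ → ℂ)) Complex.ofReal_zero)
    σ)).integrable_comp μ.integrable_total

lemma integrableOn_test_mul_unweight (hχ : Continuous χ) (hχc : HasCompactSupport χ) (σ : ℝ)
    (F : LInf) : IntegrableOn (fun r => (χ r : ℂ) * unweight σ F r) (Ioi 1) :=
  integrableOn_mul_unweight (integrableOn_mul_rpow_of_hasCompactSupport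
    (Complex.continuous_ofReal.comp hχ) (hχc.comp_left (g := ((↑) : ℝ → ℂ)) Complex.ofReal_zero) σ) F

lemma integrable_test_mul_invFT {α : ℝ → ℂ} (hα : Integrable α freqMeasure) (hη : Continuous η)
    (hηc : HasCompactSupport η) : Integrable fun z => (η z : ℂ) * invFT α z :=
  Continuous.integrable_of_hasCompactSupport
    ((Complex.continuous_ofReal.comp hη).mul (continuous_invFT hα))
    (HasCompactSupport.mul_right (hηc.comp_left (g := ((↑) : ℝ → ℂ)) Complex.ofReal_zero))

end ProductTest

lemma fourierConst_ne_zero : fourierConst ≠ 0 := by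
  rw [fourierConst]
  exact_mod_cast (inv_pos.2 (Real.sqrt_pos.2 (by positivity))).ne'

/-! ### Integrated equations and decay at a single frequency -/

section Frequency

variable {ρ : ℝ} {v : AxisymField} {μr μz : XMeas (ρ - 1)} {μ : XMeas ρ} {ω : ℝ × ℝ → ℂ}

/-- For fixed `χ`, the test in `η` says that one inverse transform is the distributional derivative
of another, and uniqueness compares the densities. The weights `r χ'` and `r χ` come from the volume
element `r dr dz`. The exceptional null set depends on `χ`, and `χ(1)` is arbitrary. -/
lemma freq_div (hr : IsFourierTransform v.r μr) (hz : IsFourierTransform v.z μz)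
    (hvW : v.W12loc) (hdiv : v.DivFree) (hbdry : v.ZeroOnBoundary) {χ : ℝ → ℝ}
    (hχ : ContDiff ℝ ((⊤ : ℕ∞) : WithTop ℕ∞) χ) (hχc : HasCompactSupport χ) :
    ∀ᵐ ζ ∂freqMeasure, ∫ r in Ioi (1 : ℝ),
      ((deriv χ r : ℝ) : ℂ) * ((r : ℂ) * unweight (ρ - 1) (μr.total ζ) r) +
      (χ r : ℂ) * (-(Complex.I * ζ) * ((r : ℂ) * unweight (ρ - 1) (μz.total ζ) r)) = 0 := by
  set k₁ : ℝ → ℝ := fun r => r * deriv χ r with hk₁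
  set k₂ : ℝ → ℝ := fun r => r * χ r with hk₂
  have h1 : Continuous k₁ := continuous_id.mul (hχ.continuous_deriv (by simp))
  have h1c : HasCompactSupport k₁ := hχc.deriv.mul_left
  have h2 : Continuous k₂ := continuous_id.mul hχ.continuous
  have h2c : HasCompactSupport k₂ := hχc.mul_left
  have i1 := integrable_pairing_total μr h1 h1c
  have i2 := integrable_pairing_total μz h2 h2c
  have key := ae_eq_of_weak_deriv_invFT i1 i2 fun η hη hηc => ?_
  · filter_upwards [key] with ζ hζ
    rw [← hζ, ← integral_const_mul, ← integral_sub (integrableOn_test_mul_unweight h1 h1c _ _)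
      ((integrableOn_test_mul_unweight h2 h2c _ _).const_mul _)]
    congr 1
    ext r
    simp only [hk₁, hk₂]
    push_cast
    ring
  · have hηd : Continuous (deriv η) := hη.continuous_deriv (by simp)
    have ht := isTest_prod hχ hχc hη hηc
    have h0 := hdiv.integral_eq_zero hvW hbdry ht
    have e (x : ℝ × ℝ) : ((x.1 * fderiv ℝ (fun x : ℝ × ℝ => χ x.1 * η x.2) x (1, 0) : ℝ) : ℂ) * v.r x +
        ((x.1 * fderiv ℝ (fun x : ℝ × ℝ => χ x.1 * η x.2) x (0, 1) : ℝ) : ℂ) * v.z x =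
        ((k₁ x.1 * η x.2 : ℝ) : ℂ) * v.r x + ((k₂ x.1 * deriv η x.2 : ℝ) : ℂ) * v.z x := by
      rw [fderiv_prod_apply (hχ.differentiable (by simp)) (hη.differentiable (by simp)),
        fderiv_prod_apply (hχ.differentiable (by simp)) (hη.differentiable (by simp))]
      simp only [hk₁, hk₂]
      push_cast
      ring
    simp only [e] at h0
    rw [integral_add (hvW.1.1.integrable_mul (φ := fun x => k₁ x.1 * η x.2)
        ((h1.comp continuous_fst).mul (hη.continuous.comp continuous_snd))
        (hasCompactSupport_prod h1c hηc))
      (hvW.2.2.1.integrable_mul (φ := fun x => k₂ x.1 * deriv η x.2)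
        ((h2.comp continuous_fst).mul (hηd.comp continuous_snd))
        (hasCompactSupport_prod h2c hηc.deriv)),
      integral_prod_test hr hvW.1.1 h1 h1c hη.continuous hηc,
      integral_prod_test hz hvW.2.2.1 h2 h2c hηd hηc.deriv, ← mul_add] at h0
    rw [integral_add (integrable_test_mul_invFT i1 hη.continuous hηc)
      (integrable_test_mul_invFT i2 hηd hηc.deriv)]
    exact (mul_eq_zero.1 h0).resolve_left fourierConst_ne_zero

lemma freq_rot (hr : IsFourierTransform v.r μr) (hz : IsFourierTransform v.z μz)
    (hω : IsFourierTransform ω μ) (hvW : v.W12loc) (hrot : v.IsRotTheta ω)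
    (hbdry : v.ZeroOnBoundary) {χ : ℝ → ℝ}
    (hχ : ContDiff ℝ ((⊤ : ℕ∞) : WithTop ℕ∞) χ) (hχc : HasCompactSupport χ) :
    ∀ᵐ ζ ∂freqMeasure, ∫ r in Ioi (1 : ℝ),
      ((deriv χ r : ℝ) : ℂ) * unweight (ρ - 1) (μz.total ζ) r +
      (χ r : ℂ) * (Complex.I * ζ * unweight (ρ - 1) (μr.total ζ) r - unweight ρ (μ.total ζ) r)
        = 0 := by
  have h1 : Continuous (deriv χ) := hχ.continuous_deriv (by simp)
  have h1c : HasCompactSupport (deriv χ) := hχc.deriv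
  have h2 : Continuous χ := hχ.continuous
  have i1 := integrable_pairing_total μz h1 h1c
  have i2 := integrable_pairing_total μr h2 hχc
  have i3 := integrable_pairing_total μ h2 hχc
  have hsub (z : ℝ) := integral_sub (integrable_exp_smul i1 z) (integrable_exp_smul i3 z)
  -- Here `α = ∫ χ' c - ∫ χ h` and `γ = -∫ χ a`; the sign of `γ` is that of `∂_z φ` in the tested
  -- rotation.
  have key := ae_eq_of_weak_deriv_invFT (i1.sub i3) i2.neg fun η hη hηc => ?_
  · filter_upwards [key] with ζ hζ
    simp only [Pi.sub_apply, Pi.neg_apply] at hζ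
    have j1 := integrableOn_test_mul_unweight h1 h1c (ρ - 1) (μz.total ζ)
    have j2 := integrableOn_test_mul_unweight h2 hχc (ρ - 1) (μr.total ζ)
    have j3 := integrableOn_test_mul_unweight h2 hχc ρ (μ.total ζ)
    rw [← hζ, mul_neg, sub_neg_eq_add, ← integral_const_mul, ← integral_sub j1 j3,
      ← integral_add (by exact j1.sub j3) (by exact j2.const_mul _)]
    congr 1
    ext r
    ring
  · have hηd : Continuous (deriv η) := hη.continuous_deriv (by simp)
    have ht := isTest_prod hχ hχc hη hηc
    have h0 := hrot.integral_eq hvW hbdry ht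
    have e (x : ℝ × ℝ) : ((fderiv ℝ (fun x : ℝ × ℝ => χ x.1 * η x.2) x (1, 0) : ℝ) : ℂ) * v.z x -
        ((fderiv ℝ (fun x : ℝ × ℝ => χ x.1 * η x.2) x (0, 1) : ℝ) : ℂ) * v.r x =
        ((deriv χ x.1 * η x.2 : ℝ) : ℂ) * v.z x - ((χ x.1 * deriv η x.2 : ℝ) : ℂ) * v.r x := by
      rw [fderiv_prod_apply (hχ.differentiable (by simp)) (hη.differentiable (by simp)),
        fderiv_prod_apply (hχ.differentiable (by simp)) (hη.differentiable (by simp))]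
      push_cast
      ring
    simp only [e] at h0
    rw [integral_sub (hvW.2.2.1.integrable_mul (φ := fun x => deriv χ x.1 * η x.2)
        ((h1.comp continuous_fst).mul (hη.continuous.comp continuous_snd))
        (hasCompactSupport_prod h1c hηc))
      (hvW.1.1.integrable_mul (φ := fun x => χ x.1 * deriv η x.2)
        ((h2.comp continuous_fst).mul (hηd.comp continuous_snd))
        (hasCompactSupport_prod hχc hηc.deriv)),
      integral_prod_test hz hvW.2.2.1 h1 h1c hη.continuous hηc,
      integral_prod_test hr hvW.1.1 h2 hχc hηd hηc.deriv,
      integral_prod_test hω (hrot.memL2loc hvW) h2 hχc hη.continuous hηc, ← mul_sub] at h0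
    have h0' := mul_left_cancel₀ fourierConst_ne_zero h0
    have k1 := integrable_test_mul_invFT i1 hη.continuous hηc
    have k2 := integrable_test_mul_invFT i2 hηd hηc.deriv
    have k3 := integrable_test_mul_invFT i3 hη.continuous hηc
    rw [sub_eq_iff_eq_add] at h0'
    rw [← sub_eq_zero, ← integral_add k3 k2, ← integral_sub k1 (by exact k3.add k2)] at h0'
    rw [← h0']
    congr 1
    ext z
    have e1 : invFT ((fun ζ => ∫ r in Ioi (1 : ℝ), ((deriv χ r : ℝ) : ℂ) * unweight (ρ - 1) (μz.total ζ) r) -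
        fun ζ => ∫ r in Ioi (1 : ℝ), (χ r : ℂ) * unweight ρ (μ.total ζ) r) z =
        invFT (fun ζ => ∫ r in Ioi (1 : ℝ), ((deriv χ r : ℝ) : ℂ) * unweight (ρ - 1) (μz.total ζ) r) z -
        invFT (fun ζ => ∫ r in Ioi (1 : ℝ), (χ r : ℂ) * unweight ρ (μ.total ζ) r) z := by
      simp only [invFT, ← hsub, Pi.sub_apply, smul_sub]
    have e2 : invFT (-fun ζ => ∫ r in Ioi (1 : ℝ), (χ r : ℂ) * unweight (ρ - 1) (μr.total ζ) r) z =
        -invFT (fun ζ => ∫ r in Ioi (1 : ℝ), (χ r : ℂ) * unweight (ρ - 1) (μr.total ζ) r) z := by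
      simp only [invFT, Pi.neg_apply, smul_neg, integral_neg]
    rw [e1, e2]
    ring

/-- `∫₁^r (iζ a - h) ds`, the continuous representative of the axial velocity at frequency `ζ`. -/
def axialRep (ρ ζ : ℝ) (A H : LInf) (r : ℝ) : ℂ :=
  ∫ s in (1 : ℝ)..r, (Complex.I * ζ * unweight (ρ - 1) A s - unweight ρ H s)

/-- The equations `r a = -iζ ∫₁^r s c ds` and `c = ∫₁^r (iζ a - h) ds` at the frequency `ζ`. -/
structure IsFreqSolution (ρ ζ : ℝ) (A B H : LInf) : Prop where
  radial : ∀ᵐ r ∂(volume.restrict (Ioi (1 : ℝ))),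
    unweight (ρ - 1) A r = -(Complex.I * ζ) * (radialPrimitive ρ B r / r)
  axial : ∀ᵐ r ∂(volume.restrict (Ioi (1 : ℝ))), unweight (ρ - 1) B r = axialRep ρ ζ A H r

/-- The du Bois-Reymond lemma with the frequency as parameter, once for the divergence and once for
the rotation. The primitives start at `1` with value zero because the test functions need not vanish
there; this is where the no-slip condition enters. -/
lemma ae_isFreqSolution (hr : IsFourierTransform v.r μr) (hz : IsFourierTransform v.z μz)
    (hω : IsFourierTransform ω μ) (hvW : v.W12loc) (hdiv : v.DivFree) (hrot : v.IsRotTheta ω)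
    (hbdry : v.ZeroOnBoundary) :
    ∀ᵐ ζ ∂freqMeasure, IsFreqSolution ρ ζ (μr.total ζ) (μz.total ζ) (μ.total ζ) := by
  have hid (σ : ℝ) (F : LInf) (R : ℝ) (hR : 1 ≤ R) :
      IntervalIntegrable (fun r : ℝ => (r : ℂ) * unweight σ F r) volume 1 R :=
    intervalIntegrable_mul_unweight Complex.continuous_ofReal σ F hR
  have hD := ae_ae_eq_primitive (ν := freqMeasure)
    (f := fun ζ (r : ℝ) => (r : ℂ) * unweight (ρ - 1) (μr.total ζ) r)
    (w := fun (ζ : ℝ) (r : ℝ) => -(Complex.I * ζ) * ((r : ℂ) * unweight (ρ - 1) (μz.total ζ) r))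
    (fun ζ R hR => hid _ _ R hR) (fun ζ R hR => (hid _ _ R hR).const_mul _)
    fun χ hχ hχc => freq_div hr hz hvW hdiv hbdry hχ hχc
  have hR := ae_ae_eq_primitive (ν := freqMeasure)
    (f := fun ζ (r : ℝ) => unweight (ρ - 1) (μz.total ζ) r)
    (w := fun (ζ : ℝ) (r : ℝ) => Complex.I * ζ * unweight (ρ - 1) (μr.total ζ) r
      - unweight ρ (μ.total ζ) r)
    (fun ζ R hR => intervalIntegrable_unweight _ _ hR)
    (fun ζ R hR => ((intervalIntegrable_unweight _ _ hR).const_mul _).sub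
      (intervalIntegrable_unweight _ _ hR))
    fun χ hχ hχc => freq_rot hr hz hω hvW hrot hbdry hχ hχc
  filter_upwards [hD, hR] with ζ h1 h2
  refine ⟨?_, h2⟩
  filter_upwards [h1, ae_restrict_mem measurableSet_Ioi] with r hr1 hr0
  have : (r : ℂ) ≠ 0 := by exact_mod_cast (zero_lt_one.trans (mem_Ioi.1 hr0)).ne'
  rw [intervalIntegral.integral_const_mul] at hr1
  rw [← mul_div_assoc, eq_div_iff this, radialPrimitive, ← hr1, mul_comm]

lemma hasDerivAt_primitive_of_continuousOn {f : ℝ → ℂ} (hf : ContinuousOn f (Ioi 1)) {r : ℝ}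
    (hr : 1 < r) (hi : IntervalIntegrable f volume 1 r) :
    HasDerivAt (fun r => ∫ s in (1 : ℝ)..r, f s) (f r) r := by
  refine intervalIntegral.integral_hasDerivAt_right hi ?_ (hf.continuousAt (Ioi_mem_nhds hr))
  exact hf.stronglyMeasurableAtFilter isOpen_Ioi r hr

/-- The continuous functions `max ‖f‖ g` and `g` agree almost everywhere on an open set, hence
everywhere on it. -/
lemma norm_le_of_ae_norm_le {f : ℝ → ℂ} {g : ℝ → ℝ} (hf : ContinuousOn f (Ioi 1))
    (hg : ContinuousOn g (Ioi 1)) (h : ∀ᵐ r ∂(volume.restrict (Ioi (1 : ℝ))), ‖f r‖ ≤ g r) {r : ℝ}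
    (hr : 1 < r) : ‖f r‖ ≤ g r := by
  have h1 : (fun r => max ‖f r‖ (g r)) =ᵐ[volume.restrict (Ioi (1 : ℝ))] g := by
    filter_upwards [h] with r hr using max_eq_right hr
  have h2 := Measure.eqOn_open_of_ae_eq h1 isOpen_Ioi (hf.norm.sup hg) hg
  exact max_eq_right_iff.1 (h2 hr)

lemma intervalIntegral_congr_of_ae_Ioi {f g : ℝ → ℂ}
    (h : ∀ᵐ r ∂(volume.restrict (Ioi (1 : ℝ))), f r = g r) {r : ℝ} (hr : 1 ≤ r) :
    ∫ s in (1 : ℝ)..r, f s = ∫ s in (1 : ℝ)..r, g s := by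
  rw [intervalIntegral.integral_of_le hr, intervalIntegral.integral_of_le hr]
  exact integral_congr_ae (ae_mono (Measure.restrict_mono Ioc_subset_Ioi_self le_rfl) h)

/-! ### Consequences of the equations at one frequency -/

namespace IsFreqSolution

variable {ζ : ℝ} {A B H : LInf}

lemma continuousOn_axialRep (ρ ζ : ℝ) (A H : LInf) : ContinuousOn (axialRep ρ ζ A H) (Ici 1) :=
  continuousOn_primitive_Ici fun _ hR => ((intervalIntegrable_unweight _ _ hR).const_mul _).sub
      (intervalIntegrable_unweight _ _ hR)

variable (h : IsFreqSolution ρ ζ A B H)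

include h

lemma norm_axialRep_le {r : ℝ} (hr : 1 < r) : ‖axialRep ρ ζ A H r‖ ≤ r ^ (-(ρ - 1)) * ‖B‖ := by
  refine norm_le_of_ae_norm_le ((continuousOn_axialRep ρ ζ A H).mono Ioi_subset_Ici_self)
    (((continuousOn_rpow_Ici _).mono Ioi_subset_Ici_self).mul continuousOn_const) ?_ hr
  filter_upwards [h.axial, ae_norm_unweight_le (ρ - 1) B] with r h1 h2
  rwa [← h1]

/-- Up to a unit factor the left side is the continuous representative of `v̂^r`. The bound is used
twice: for the decay of `P` at `ζ ≠ 0`, and as an integrable majorant for `∂_z ψ`. -/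
lemma norm_mul_radialPrimitive_le {r : ℝ} (hr : 1 < r) :
    ‖(ζ : ℂ) * (radialPrimitive ρ B r / r)‖ ≤ r ^ (-(ρ - 1)) * ‖A‖ := by
  refine norm_le_of_ae_norm_le (f := fun r : ℝ => (ζ : ℂ) * (radialPrimitive ρ B r / r)) ?_
    (((continuousOn_rpow_Ici _).mono Ioi_subset_Ici_self).mul continuousOn_const) ?_ hr
  · refine continuousOn_const.mul (((continuousOn_radialPrimitive ρ B).mono
      Ioi_subset_Ici_self).div Complex.continuous_ofReal.continuousOn fun s hs => ?_)
    exact_mod_cast (zero_lt_one.trans (mem_Ioi.1 hs)).ne'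
  · filter_upwards [h.radial, ae_norm_unweight_le (ρ - 1) A] with r h1 h2
    rw [h1, norm_mul, norm_neg, norm_mul, Complex.norm_I, one_mul] at h2
    rwa [norm_mul]

lemma radialPrimitive_eq {r : ℝ} (hr : 1 ≤ r) :
    radialPrimitive ρ B r = ∫ s in (1 : ℝ)..r, (s : ℂ) * axialRep ρ ζ A H s := by
  refine intervalIntegral_congr_of_ae_Ioi ?_ hr
  filter_upwards [h.axial] with s hs
  rw [hs]

lemma hasDerivAt_radialPrimitive {r : ℝ} (hr : 1 < r) :
    HasDerivAt (radialPrimitive ρ B) ((r : ℂ) * axialRep ρ ζ A H r) r := by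
  have hc : ContinuousOn (fun s : ℝ => (s : ℂ) * axialRep ρ ζ A H s) (Ici 1) :=
    Complex.continuous_ofReal.continuousOn.mul (continuousOn_axialRep ρ ζ A H)
  have hsub : uIcc 1 r ⊆ Ici 1 := by
    rw [uIcc_of_le hr.le]
    exact Icc_subset_Ici_self
  refine (hasDerivAt_primitive_of_continuousOn (hc.mono Ioi_subset_Ici_self) hr
    (hc.mono hsub).intervalIntegrable).congr_of_eventuallyEq ?_
  filter_upwards [Ici_mem_nhds hr] with s hs using h.radialPrimitive_eq hs

/-- Elimination of `v̂^r`: `iζ · (-iζ) = ζ² = |ζ|²`. The modulus appears because the Bessel kernels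
use `κ = |ζ|`. -/
lemma axialRep_eq {r : ℝ} (hr : 1 ≤ r) : axialRep ρ ζ A H r =
    ∫ s in (1 : ℝ)..r, ((|ζ| : ℝ) : ℂ) ^ 2 * (radialPrimitive ρ B s / s) - unweight ρ H s := by
  refine intervalIntegral_congr_of_ae_Ioi ?_ hr
  filter_upwards [h.radial] with s hs
  have e : ((|ζ| : ℝ) : ℂ) ^ 2 = (ζ : ℂ) ^ 2 := by
    rw [← Complex.ofReal_pow, sq_abs, Complex.ofReal_pow]
  rw [hs, e]
  linear_combination (-(ζ : ℂ) ^ 2 * (radialPrimitive ρ B s / s)) * Complex.I_sq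

lemma tendsto_mul_axialRep (hρ : 2 < ρ) :
    Tendsto (fun r : ℝ => (r : ℂ) * axialRep ρ ζ A H r) atTop (𝓝 0) := by
  have h1 : Tendsto (fun r : ℝ => r ^ (-(ρ - 2)) * ‖B‖) atTop (𝓝 (0 * ‖B‖)) :=
    (tendsto_rpow_neg_atTop (by linarith)).mul_const _
  rw [zero_mul] at h1
  refine squeeze_zero_norm' ?_ h1
  filter_upwards [eventually_gt_atTop 1] with r hr
  have hr0 : 0 < r := by linarith
  rw [norm_mul, Complex.norm_real, Real.norm_of_nonneg hr0.le,
    show -(ρ - 2) = 1 + -(ρ - 1) by ring, Real.rpow_add hr0, Real.rpow_one, mul_assoc]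
  exact mul_le_mul_of_nonneg_left (h.norm_axialRep_le hr) hr0.le

/-- The radial equation bounds `ζ P` by `r · r^(1-ρ)`, and `ρ > 2`. Dividing by `ζ` excludes
frequency zero, where the decay of `P` is not needed. -/
lemma tendsto_radialPrimitive (hρ : 2 < ρ) (hζ : ζ ≠ 0) :
    Tendsto (radialPrimitive ρ B) atTop (𝓝 0) := by
  have h1 : Tendsto (fun r : ℝ => r ^ (-(ρ - 2)) * ‖A‖ / |ζ|) atTop (𝓝 (0 * ‖A‖ / |ζ|)) :=
    ((tendsto_rpow_neg_atTop (by linarith)).mul_const _).div_const _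
  rw [zero_mul, zero_div] at h1
  refine squeeze_zero_norm' ?_ h1
  filter_upwards [eventually_gt_atTop 1] with r hr
  have hr0 : 0 < r := by linarith
  have h2 := h.norm_mul_radialPrimitive_le hr
  rw [norm_mul, norm_div, Complex.norm_real, Complex.norm_real, Real.norm_of_nonneg hr0.le,
    Real.norm_eq_abs, ← mul_div_assoc, div_le_iff₀ hr0] at h2
  rw [le_div_iff₀ (abs_pos.2 hζ), show -(ρ - 2) = -(ρ - 1) + 1 by ring, Real.rpow_add hr0,
    Real.rpow_one]
  linarith

/-- At each frequency the coefficient `d` vanishes and `ψ̂ = r⁻¹ ∫₁^r s c ds`. -/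
theorem coefficients (hρ : 2 < ρ) :
    (if ζ = 0 then dZero (unweight ρ H) else dPos |ζ| (unweight ρ H)) = 0 ∧
    ∀ r, 1 < r → (if ζ = 0 then psiHatZero (unweight ρ H) r else psiHatPos |ζ| (unweight ρ H) r) =
      radialPrimitive ρ B r / r := by
  have hh : ∀ R, 1 ≤ R → IntervalIntegrable (unweight ρ H) volume 1 R :=
    fun R hR => intervalIntegrable_unweight ρ H hR
  by_cases hζ : ζ = 0
  · simp only [hζ, if_true]
    refine dZero_eq_zero_and_psiHatZero_eq hh (integrableOn_id_mul_unweight hρ H)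
      (fun r hr => h.radialPrimitive_eq hr) (h.tendsto_mul_axialRep hρ) fun r hr => ?_
    rw [h.axialRep_eq hr]
    simp [hζ]
  · simp only [hζ, if_false]
    exact dPos_eq_zero_and_psiHatPos_eq (abs_pos.2 hζ) hh (integrableOn_id_mul_unweight hρ H)
      (fun r hr => h.radialPrimitive_eq hr) (fun r hr => h.axialRep_eq hr)
      (continuousOn_radialPrimitive ρ B) (continuousOn_axialRep ρ ζ A H)
      (h.tendsto_mul_axialRep hρ) (h.tendsto_radialPrimitive hρ hζ)

end IsFreqSolution

end Frequency

end AxisymBS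

end

noncomputable section

namespace AxisymBS

open scoped Topology

/-! ### Superpositions over the frequencies -/

section Superposition

variable {Y Q : ℝ → ℝ → ℂ} {b : ℝ → ℝ}

lemma norm_fourierConst_mul_invFT_le (hb : Integrable b freqMeasure) {r : ℝ}
    (hY : ∀ᵐ ζ ∂freqMeasure, ‖Y ζ r‖ ≤ b ζ) (z : ℝ) :
    ‖fourierConst * invFT (fun ζ => Y ζ r) z‖ ≤ ‖fourierConst‖ * ∫ ζ, b ζ ∂freqMeasure := by
  rw [norm_mul]
  refine mul_le_mul_of_nonneg_left ?_ (norm_nonneg _)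
  refine norm_integral_le_of_norm_le hb ?_
  filter_upwards [hY] with ζ hζ
  rwa [norm_smul, norm_exp_I_mul_mul, one_mul]

lemma continuousOn_superposition (hb : Integrable b freqMeasure)
    (hm : ∀ r, 1 < r → AEStronglyMeasurable (fun ζ => Y ζ r) freqMeasure)
    (hc : ∀ᵐ ζ ∂freqMeasure, ContinuousOn (Y ζ) (Ioi 1))
    (hY : ∀ᵐ ζ ∂freqMeasure, ∀ r, 1 < r → ‖Y ζ r‖ ≤ b ζ) :
    ContinuousOn (fun x : ℝ × ℝ => fourierConst * invFT (fun ζ => Y ζ x.1) x.2) halfPlane := by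
  refine continuousOn_const.mul (continuousOn_of_dominated (bound := b) (fun x hx => ?_)
    (fun x hx => ?_) hb ?_)
  · exact (by fun_prop : Continuous fun ζ : ℝ =>
      Complex.exp (Complex.I * x.2 * ζ)).aestronglyMeasurable.smul (hm x.1 hx.1)
  · filter_upwards [hY] with ζ hζ
    rw [norm_smul, norm_exp_I_mul_mul, one_mul]
    exact hζ x.1 hx.1
  · filter_upwards [hc] with ζ hζ
    exact (by fun_prop : Continuous fun x : ℝ × ℝ =>
      Complex.exp (Complex.I * x.2 * ζ)).continuousOn.smul
      (hζ.comp continuous_fst.continuousOn fun x hx => hx.1)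

lemma hasDerivAt_superposition (hb : Integrable b freqMeasure)
    (hm : ∀ r, 1 < r → AEStronglyMeasurable (fun ζ => Y ζ r) freqMeasure)
    (hQ : ∀ r, 1 < r → Integrable (fun ζ => Q ζ r) freqMeasure)
    (hd : ∀ᵐ ζ ∂freqMeasure, ∀ r, 1 < r → HasDerivAt (Q ζ) (Y ζ r) r)
    (hY : ∀ᵐ ζ ∂freqMeasure, ∀ r, 1 < r → ‖Y ζ r‖ ≤ b ζ) {r : ℝ} (hr : 1 < r) (z : ℝ) :
    HasDerivAt (fun r => fourierConst * invFT (fun ζ => Q ζ r) z)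
      (fourierConst * invFT (fun ζ => Y ζ r) z) r := by
  have hexp : AEStronglyMeasurable (fun ζ : ℝ => Complex.exp (Complex.I * z * ζ)) freqMeasure :=
    (by fun_prop : Continuous fun ζ : ℝ => Complex.exp (Complex.I * z * ζ)).aestronglyMeasurable
  refine HasDerivAt.const_mul fourierConst ?_
  refine (hasDerivAt_integral_of_dominated_loc_of_deriv_le (s := Ioi 1) (bound := b)
    (F := fun r ζ => Complex.exp (Complex.I * z * ζ) • Q ζ r)
    (F' := fun r ζ => Complex.exp (Complex.I * z * ζ) • Y ζ r)
    (Ioi_mem_nhds hr) ?_ (integrable_exp_smul (hQ r hr) z) (hexp.smul (hm r hr)) ?_ hb ?_).2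
  · filter_upwards [Ioi_mem_nhds hr] with s hs using hexp.smul (hQ s hs).aestronglyMeasurable
  · filter_upwards [hY] with ζ hζ s hs
    rw [norm_smul, norm_exp_I_mul_mul, one_mul]
    exact hζ s hs
  · filter_upwards [hd] with ζ hζ s hs
    simpa only [smul_eq_mul] using (hζ s hs).const_mul (Complex.exp (Complex.I * z * ζ))

lemma hasDerivAt_superposition_snd {α : ℝ → ℂ} (hα : Integrable α freqMeasure)
    (hα' : Integrable (fun ζ : ℝ => (ζ : ℂ) * α ζ) freqMeasure) (z : ℝ) :
    HasDerivAt (fun z => fourierConst * invFT α z)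
      (fourierConst * invFT (fun ζ => Complex.I * ζ * α ζ) z) z := by
  have hexp (z : ℝ) : AEStronglyMeasurable (fun ζ : ℝ => Complex.exp (Complex.I * z * ζ)) freqMeasure :=
    (by fun_prop : Continuous fun ζ : ℝ => Complex.exp (Complex.I * z * ζ)).aestronglyMeasurable
  have hi : Integrable (fun ζ : ℝ => Complex.I * ζ * α ζ) freqMeasure :=
    (hα'.const_mul Complex.I).congr (Eventually.of_forall fun ζ => by simp only; ring)
  refine HasDerivAt.const_mul fourierConst ?_
  refine (hasDerivAt_integral_of_dominated_loc_of_deriv_le (s := univ)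
    (bound := fun ζ : ℝ => ‖Complex.I * ζ * α ζ‖)
    (F := fun (z ζ : ℝ) => Complex.exp (Complex.I * z * ζ) • α ζ)
    (F' := fun (z ζ : ℝ) => Complex.exp (Complex.I * z * ζ) • (Complex.I * ζ * α ζ))
    univ_mem ?_ (integrable_exp_smul hα z) ((hexp z).smul hi.aestronglyMeasurable) ?_ hi.norm ?_).2
  · exact Eventually.of_forall fun s => (hexp s).smul hα.aestronglyMeasurable
  · refine Eventually.of_forall fun ζ s _ => ?_
    rw [norm_smul, norm_exp_I_mul_mul, one_mul]
  · refine Eventually.of_forall fun ζ s _ => ?_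
    have h := ((((hasDerivAt_id s).ofReal_comp).const_mul Complex.I).mul_const (ζ : ℂ)).cexp.smul_const (α ζ)
    refine h.congr_deriv ?_
    simp
    ring

/-- If the densities have continuous representatives, then so has the inverse Fourier transform. -/
lemma ae_unweight_invFourier_eq {σ : ℝ} (μ : XMeas σ) (hb : Integrable b freqMeasure)
    (hm : ∀ r, 1 < r → AEStronglyMeasurable (fun ζ => Y ζ r) freqMeasure)
    (hc : ∀ᵐ ζ ∂freqMeasure, ContinuousOn (Y ζ) (Ioi 1))
    (hY : ∀ᵐ ζ ∂freqMeasure, ∀ r, 1 < r → ‖Y ζ r‖ ≤ b ζ)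
    (he : ∀ᵐ ζ ∂freqMeasure, ∀ᵐ r ∂(volume.restrict (Ioi (1 : ℝ))),
      unweight σ (μ.total ζ) r = Y ζ r) (z : ℝ) :
    ∀ᵐ r ∂(volume.restrict (Ioi (1 : ℝ))),
      unweight σ (μ.invFourier z) r = fourierConst * invFT (fun ζ => Y ζ r) z := by
  -- Elements of `L^∞` have no point values, but their integrals over `(1, r]` are bounded
  -- functionals. The identity is obtained by differentiating these in `r`, on one side by
  -- Lebesgue's theorem and on the other under the frequency integral.
  have h1 : Continuous fun _ : ℝ => (1 : ℂ) := continuous_const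
  have hp (F : LInf) {r : ℝ} (hr : 1 ≤ r) :
      truncPairing σ h1 r F = ∫ s in (1 : ℝ)..r, unweight σ F s := by
    rw [truncPairing_apply σ h1 hr]
    simp
  have hd : ∀ᵐ ζ ∂freqMeasure, ∀ r, 1 < r →
      HasDerivAt (fun r => truncPairing σ h1 r (μ.total ζ)) (Y ζ r) r := by
    filter_upwards [hc, he] with ζ hζc hζ r hr
    have hi : IntervalIntegrable (Y ζ) volume 1 r := by
      refine (intervalIntegrable_unweight σ (μ.total ζ) hr.le).congr_ae ?_
      rw [uIoc_of_le hr.le]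
      exact ae_mono (Measure.restrict_mono Ioc_subset_Ioi_self le_rfl) hζ
    refine (hasDerivAt_primitive_of_continuousOn hζc hr hi).congr_of_eventuallyEq ?_
    filter_upwards [Ioi_mem_nhds hr] with s hs
    rw [hp _ (mem_Ioi.1 hs).le]
    exact intervalIntegral_congr_of_ae_Ioi hζ (mem_Ioi.1 hs).le
  filter_upwards [ae_hasDerivAt_primitive (a := 1) (w := unweight σ (μ.invFourier z))
    fun R hR => intervalIntegrable_unweight σ _ hR, ae_restrict_mem measurableSet_Ioi] with r hr hr1
  have key := hasDerivAt_superposition hb hm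
    (fun s _ => (truncPairing σ h1 s).integrable_comp μ.integrable_total) hd hY hr1 z
  refine hr.unique (key.congr_of_eventuallyEq ?_)
  filter_upwards [Ioi_mem_nhds hr1] with s hs
  rw [← hp _ (mem_Ioi.1 hs).le, μ.invFourier_eq, map_smul, map_invFT _ μ.integrable_total,
    smul_eq_mul]

end Superposition

/-! ### Functions that are continuous on the half plane -/

lemma aestronglyMeasurable_hpVol {u : ℝ × ℝ → ℂ} (hu : ContinuousOn u halfPlane) :
    AEStronglyMeasurable u hpVol := hu.aestronglyMeasurable measurableSet_halfPlane

lemma locallyIntegrableOn_halfPlane {u : ℝ × ℝ → ℂ} (hu : ContinuousOn u halfPlane) :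
    LocallyIntegrableOn u halfPlane := hu.locallyIntegrableOn measurableSet_halfPlane

lemma memL2loc_of_continuousOn {u : ℝ × ℝ → ℂ} (hu : ContinuousOn u halfPlane) {M : ℝ}
    (hM : ∀ x ∈ halfPlane, ‖u x‖ ≤ M) : MemL2loc u := by
  intro R
  have : IsFiniteMeasure ((volume : Measure (ℝ × ℝ)).restrict (halfPlane ∩ Metric.closedBall 0 R)) :=
    ⟨by
      rw [Measure.restrict_apply_univ]
      exact (measure_mono inter_subset_right).trans_lt
        (isCompact_closedBall (0 : ℝ × ℝ) R).measure_lt_top⟩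
  refine MemLp.of_bound ((aestronglyMeasurable_hpVol hu).mono_measure
    (Measure.restrict_mono inter_subset_left le_rfl)) M ?_
  filter_upwards [ae_restrict_mem (measurableSet_halfPlane.inter measurableSet_closedBall)]
    with x hx using hM x hx.1

/-- Equality almost everywhere from equality on almost every line. -/
lemma ae_hpVol_of_ae_ae {f g : ℝ × ℝ → ℂ} (hf : AEStronglyMeasurable f hpVol)
    (hg : AEStronglyMeasurable g hpVol)
    (h : ∀ᵐ z : ℝ, ∀ᵐ r ∂(volume.restrict (Ioi (1 : ℝ))), f (r, z) = g (r, z)) :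
    f =ᵐ[hpVol] g := by
  have hsw (p : ℝ × ℝ → Prop) (hp : ∀ᵐ x ∂hpVol, p x) :
      ∀ᵐ z : ℝ, ∀ᵐ r ∂(volume.restrict (Ioi (1 : ℝ))), p (r, z) := by
    rw [hpVol_eq_prod] at hp
    exact Measure.ae_ae_of_ae_prod
      ((Measure.measurePreserving_swap (μ := (volume : Measure ℝ))
        (ν := volume.restrict (Ioi (1 : ℝ)))).quasiMeasurePreserving.ae hp)
  -- Passing from almost every line to almost every point requires the set of equality to be
  -- measurable, hence the measurable representatives.
  have hmk {F G : ℝ × ℝ → ℂ} (hF : StronglyMeasurable F) (hG : StronglyMeasurable G)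
      (hFG : ∀ᵐ z : ℝ, ∀ᵐ r ∂(volume.restrict (Ioi (1 : ℝ))), F (r, z) = G (r, z)) :
      ∀ᵐ x ∂hpVol, F x = G x := by
    have hmeas : MeasurableSet {x | F x = G x} := measurableSet_eq_fun hF.measurable hG.measurable
    rw [hpVol_eq_prod]
    exact (Measure.ae_prod_iff_ae_ae hmeas).2
      ((Measure.ae_ae_comm (p := fun r z => F (r, z) = G (r, z)) hmeas).2 hFG)
  have hlast := hmk hf.stronglyMeasurable_mk hg.stronglyMeasurable_mk (by
    filter_upwards [h, hsw _ hf.ae_eq_mk, hsw _ hg.ae_eq_mk] with z h1 h2 h3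
    filter_upwards [h1, h2, h3] with r k1 k2 k3
    rw [← k2, ← k3, k1])
  filter_upwards [hf.ae_eq_mk, hg.ae_eq_mk, hlast] with x h1 h2 h3
  rw [h1, h2, h3]

end AxisymBS

end

noncomputable section

namespace AxisymBS

open scoped Topology

/-! ### Green's formulas for functions with classical partial derivatives -/

section Green

variable {u p q : ℝ × ℝ → ℂ} {φ : ℝ × ℝ → ℝ}

lemma IsTest.hasDerivAt_fst (hφ : IsTest φ) (r z : ℝ) :
    HasDerivAt (fun r => ((φ (r, z) : ℝ) : ℂ)) ((fderiv ℝ φ (r, z) (1, 0) : ℝ) : ℂ) r :=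
  ((hφ.differentiableAt (r, z)).hasFDerivAt.comp_hasDerivAt r
    ((hasDerivAt_id r).prodMk (hasDerivAt_const r z))).ofReal_comp

lemma IsTest.hasDerivAt_snd (hφ : IsTest φ) (r z : ℝ) :
    HasDerivAt (fun z => ((φ (r, z) : ℝ) : ℂ)) ((fderiv ℝ φ (r, z) (0, 1) : ℝ) : ℂ) z :=
  ((hφ.differentiableAt (r, z)).hasFDerivAt.comp_hasDerivAt z
    ((hasDerivAt_const z r).prodMk (hasDerivAt_id z))).ofReal_comp

/-- Integration by parts in `r` for a function that is `O(r - 1)` at the boundary. -/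
lemma integral_fst_green (hu : MemL2loc u) (hp : MemL2loc p) {C : ℝ}
    (hC : ∀ x ∈ halfPlane, ‖u x‖ ≤ C * (x.1 - 1))
    (hd : ∀ r z, 1 < r → HasDerivAt (fun r => u (r, z)) (p (r, z)) r) (hφ : IsTest φ) :
    ∫ x, (((fderiv ℝ φ x (1, 0) : ℝ) : ℂ) * u x + (φ x : ℂ) * p x) ∂hpVol = 0 := by
  have hi := (hu.integrable_mul (hφ.continuous_fderiv_apply (1, 0))
    (hφ.hasCompactSupport_fderiv_apply (1, 0))).add (hp.integrable_mul hφ.1.continuous hφ.2)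
  rw [hpVol_eq_prod] at hi ⊢
  rw [integral_prod_symm _ (by exact hi)]
  refine integral_eq_zero_of_ae ?_
  obtain ⟨R, hR⟩ := hφ.2.isCompact.isBounded.subset_closedBall 0
  obtain ⟨K, hK⟩ := hφ.1.continuous.bounded_above_of_compact_support hφ.2
  filter_upwards [hi.prod_left_ae] with z hz
  -- The bound `O(r - 1)` removes the boundary term at `r = 1`, although `φ` need not vanish there.
  have h0 : Tendsto (fun r => ((φ (r, z) : ℝ) : ℂ) * u (r, z)) (𝓝[>] 1) (𝓝 0) := by
    have h1 : Tendsto (fun r : ℝ => K * (C * (r - 1))) (𝓝[>] 1) (𝓝 0) := by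
      have : Continuous fun r : ℝ => K * (C * (r - 1)) := by fun_prop
      simpa using (this.tendsto 1).mono_left nhdsWithin_le_nhds
    refine squeeze_zero_norm' ?_ h1
    filter_upwards [self_mem_nhdsWithin] with r hr
    rw [norm_mul, Complex.norm_real]
    exact mul_le_mul (hK _) (hC (r, z) ⟨hr, mem_univ _⟩) (norm_nonneg _)
      ((norm_nonneg _).trans (hK (r, z)))
  have h1 : Tendsto (fun r => ((φ (r, z) : ℝ) : ℂ) * u (r, z)) atTop (𝓝 0) := by
    refine tendsto_const_nhds.congr' ?_
    filter_upwards [eventually_gt_atTop R] with r hr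
    have : (r, z) ∉ tsupport φ := fun h => by
      have h2 := hR h
      rw [mem_closedBall_zero_iff, Prod.norm_def, max_le_iff] at h2
      exact absurd ((Real.le_norm_self r).trans h2.1) (not_le.2 hr)
    rw [image_eq_zero_of_notMem_tsupport this, Complex.ofReal_zero, zero_mul]
  have key := integral_Ioi_deriv_mul_eq_sub (fun r _ => hφ.hasDerivAt_fst r z)
    (fun r hr => hd r z hr) hz h0 h1
  rwa [sub_zero] at key

/-- A function with classical `r`-derivative that is `O(r - 1)` at the boundary vanishes there. -/
lemma vanishesOnBoundary_of_hasDerivAt (hu : MemL2loc u) (hp : MemL2loc p)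
    (huc : ContinuousOn u halfPlane) (hpc : ContinuousOn p halfPlane) {C : ℝ}
    (hC : ∀ x ∈ halfPlane, ‖u x‖ ≤ C * (x.1 - 1))
    (hd : ∀ r z, 1 < r → HasDerivAt (fun r => u (r, z)) (p (r, z)) r) :
    HasWeakPartial (1, 0) u p ∧ VanishesOnBoundary u := by
  have hw : HasWeakPartial (1, 0) u p := by
    refine ⟨locallyIntegrableOn_halfPlane huc, locallyIntegrableOn_halfPlane hpc,
      fun φ hφ hφc _ => ?_⟩
    have ht : IsTest φ := ⟨hφ, hφc⟩
    have h := integral_fst_green hu hp hC hd ht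
    rw [integral_add (hu.integrable_mul (ht.continuous_fderiv_apply (1, 0))
      (ht.hasCompactSupport_fderiv_apply (1, 0))) (hp.integrable_mul ht.1.continuous ht.2)] at h
    exact eq_neg_of_add_eq_zero_left h
  refine ⟨hw, hu, locallyIntegrable_zero, p, hp, hw, fun φ hφ hφc => ?_⟩
  rw [integral_fst_green hu hp hC hd ⟨hφ, hφc⟩]
  simp

/-- On almost every line `r = const`, both `φ u` and its `z`-derivative are integrable over the
whole line, so the derivative integrates to zero. -/
lemma hasWeakPartial_snd_of_hasDerivAt (hu : MemL2loc u) (hq : MemL2loc q)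
    (huc : ContinuousOn u halfPlane) (hqc : ContinuousOn q halfPlane)
    (hd : ∀ r z, 1 < r → HasDerivAt (fun z => u (r, z)) (q (r, z)) z) :
    HasWeakPartial (0, 1) u q := by
  refine ⟨locallyIntegrableOn_halfPlane huc, locallyIntegrableOn_halfPlane hqc,
    fun φ hφ hφc _ => ?_⟩
  have ht : IsTest φ := ⟨hφ, hφc⟩
  have i1 := hu.integrable_mul (ht.continuous_fderiv_apply (0, 1))
    (ht.hasCompactSupport_fderiv_apply (0, 1))
  have i2 := hq.integrable_mul hφ.continuous hφc
  rw [← add_eq_zero_iff_eq_neg, ← integral_add i1 i2]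
  have i3 := i1.add i2
  have j1 := hu.integrable_mul hφ.continuous hφc
  rw [hpVol_eq_prod] at i3 j1 ⊢
  rw [integral_prod _ (by exact i3)]
  refine integral_eq_zero_of_ae ?_
  filter_upwards [i3.prod_right_ae, j1.prod_right_ae, ae_restrict_mem measurableSet_Ioi]
    with r h3 h1 hr
  exact integral_eq_zero_of_hasDerivAt_of_integrable
    (fun z => (ht.hasDerivAt_snd r z).fun_mul (hd r z hr)) h3 h1

end Green

lemma invFT_sub {α β : ℝ → ℂ} (hα : Integrable α freqMeasure) (hβ : Integrable β freqMeasure)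
    (z : ℝ) : invFT (fun ζ => α ζ - β ζ) z = invFT α z - invFT β z := by
  simp only [invFT, smul_sub]
  exact integral_sub (integrable_exp_smul hα z) (integrable_exp_smul hβ z)

lemma invFT_mul_const (α : ℝ → ℂ) (c : ℂ) (z : ℝ) :
    invFT (fun ζ => α ζ * c) z = invFT α z * c := by
  simp only [invFT, smul_eq_mul, ← mul_assoc]
  exact integral_mul_const _ _

/-! ### The streamfunction built from the velocity -/

section Representation

variable {ρ : ℝ} (μr μz : XMeas (ρ - 1)) (μ : XMeas ρ)

/-- The streamfunction of a velocity field. -/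
def streamRep (x : ℝ × ℝ) : ℂ :=
  fourierConst * invFT (fun ζ => radialPrimitive ρ (μz.total ζ) x.1 / x.1) x.2

/-- The continuous representative of the radial velocity. -/
def radialField (x : ℝ × ℝ) : ℂ :=
  fourierConst * invFT (fun ζ => -(Complex.I * ζ) * (radialPrimitive ρ (μz.total ζ) x.1 / x.1)) x.2

/-- The continuous representative of the axial velocity. -/
def axialField (x : ℝ × ℝ) : ℂ :=
  fourierConst * invFT (fun ζ => axialRep ρ ζ (μr.total ζ) (μ.total ζ) x.1) x.2

lemma integrable_radialPrimitive_div {r : ℝ} (hr : 1 ≤ r) :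
    Integrable (fun ζ => radialPrimitive ρ (μz.total ζ) r / r) freqMeasure := by
  simp only [radialPrimitive_eq_truncPairing ρ _ hr]
  exact ((truncPairing (ρ - 1) Complex.continuous_ofReal r).integrable_comp
    μz.integrable_total).div_const _

lemma aestronglyMeasurable_freq_mul {r : ℝ} (hr : 1 ≤ r) :
    AEStronglyMeasurable (fun ζ : ℝ => (ζ : ℂ) * (radialPrimitive ρ (μz.total ζ) r / r))
      freqMeasure :=
  Complex.continuous_ofReal.aestronglyMeasurable.mul
    (integrable_radialPrimitive_div μz hr).aestronglyMeasurable

lemma aestronglyMeasurable_axialRep {r : ℝ} (hr : 1 ≤ r) :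
    AEStronglyMeasurable (fun ζ => axialRep ρ ζ (μr.total ζ) (μ.total ζ) r) freqMeasure := by
  have h1 : Continuous fun _ : ℝ => (1 : ℂ) := continuous_const
  have e (ζ : ℝ) : axialRep ρ ζ (μr.total ζ) (μ.total ζ) r =
      Complex.I * ζ * truncPairing (ρ - 1) h1 r (μr.total ζ) - truncPairing ρ h1 r (μ.total ζ) := by
    rw [truncPairing_apply _ h1 hr, truncPairing_apply _ h1 hr, axialRep,
      intervalIntegral.integral_sub ((intervalIntegrable_unweight _ _ hr).const_mul _)
        (intervalIntegrable_unweight _ _ hr), intervalIntegral.integral_const_mul]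
    simp
  simp only [e]
  exact ((by fun_prop : Continuous fun ζ : ℝ => Complex.I * ζ).aestronglyMeasurable.mul
    ((truncPairing (ρ - 1) h1 r).integrable_comp μr.integrable_total).aestronglyMeasurable).sub
    ((truncPairing ρ h1 r).integrable_comp μ.integrable_total).aestronglyMeasurable

lemma continuousOn_radialPrimitive_div (F : LInf) :
    ContinuousOn (fun r : ℝ => radialPrimitive ρ F r / r) (Ioi 1) :=
  ((continuousOn_radialPrimitive ρ F).mono Ioi_subset_Ici_self).div
    Complex.continuous_ofReal.continuousOn fun s hs => by
      exact_mod_cast (zero_lt_one.trans (mem_Ioi.1 hs)).ne'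

lemma norm_radialPrimitive_div_le (hρ2 : 2 ≤ ρ) (hρ3 : ρ < 3) (F : LInf) {r : ℝ} (hr : 1 ≤ r) :
    ‖radialPrimitive ρ F r / r‖ ≤ ‖F‖ / (3 - ρ) := by
  have hr0 : 0 < r := by linarith
  have h3 : 0 < 3 - ρ := by linarith
  rw [norm_div, Complex.norm_real, Real.norm_of_nonneg hr0.le, div_le_iff₀ hr0]
  refine (norm_radialPrimitive_le hρ3 F hr).trans ?_
  have h1 : r ^ (3 - ρ) ≤ r := by
    simpa using Real.rpow_le_rpow_of_exponent_le hr (by linarith : 3 - ρ ≤ 1)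
  calc r ^ (3 - ρ) / (3 - ρ) * ‖F‖ ≤ r / (3 - ρ) * ‖F‖ := by gcongr
    _ = ‖F‖ / (3 - ρ) * r := by ring

lemma rpow_weight_mul_le (hρ2 : 1 ≤ ρ) {r : ℝ} (hr : 1 ≤ r) (F : LInf) :
    r ^ (-(ρ - 1)) * ‖F‖ ≤ ‖F‖ :=
  mul_le_of_le_one_left (norm_nonneg _)
    (Real.rpow_le_one_of_one_le_of_nonpos hr (by linarith))

variable {μr μz μ}

lemma norm_streamRep_le_sub_one (hρ2 : 2 ≤ ρ) {x : ℝ × ℝ} (hx : x ∈ halfPlane) :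
    ‖streamRep μz x‖ ≤ ‖fourierConst‖ * (∫ ζ, ‖μz.total ζ‖ ∂freqMeasure) * (x.1 - 1) := by
  have hx1 : 1 < x.1 := hx.1
  have h := norm_fourierConst_mul_invFT_le (Y := fun ζ r => radialPrimitive ρ (μz.total ζ) r / r)
    (b := fun ζ => ‖μz.total ζ‖ * (x.1 - 1)) (r := x.1) (μz.integrable_total.norm.mul_const _)
    (Eventually.of_forall fun ζ => ?_) x.2
  · rwa [integral_mul_const, ← mul_assoc] at h
  · have hx0 : 0 < x.1 := by linarith
    rw [norm_div, Complex.norm_real, Real.norm_of_nonneg hx0.le]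
    refine (div_le_self (norm_nonneg _) hx1.le).trans ?_
    rw [mul_comm]
    exact norm_radialPrimitive_le_sub_one hρ2 _ hx1.le

lemma norm_streamRep_le (hρ2 : 2 ≤ ρ) (hρ3 : ρ < 3) {x : ℝ × ℝ} (hx : x ∈ halfPlane) :
    ‖streamRep μz x‖ ≤ ‖fourierConst‖ * ∫ ζ, ‖μz.total ζ‖ / (3 - ρ) ∂freqMeasure :=
  norm_fourierConst_mul_invFT_le (Y := fun ζ r => radialPrimitive ρ (μz.total ζ) r / r)
    (μz.integrable_total.norm.div_const _)
    (Eventually.of_forall fun _ => norm_radialPrimitive_div_le hρ2 hρ3 _ (mem_Ioi.1 hx.1).le) x.2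

lemma continuousOn_streamRep (hρ2 : 2 ≤ ρ) (hρ3 : ρ < 3) :
    ContinuousOn (streamRep μz) halfPlane :=
  continuousOn_superposition (Y := fun ζ r => radialPrimitive ρ (μz.total ζ) r / r)
    (b := fun ζ => ‖μz.total ζ‖ / (3 - ρ)) (μz.integrable_total.norm.div_const _)
    (fun _ hr => (integrable_radialPrimitive_div μz hr.le).aestronglyMeasurable)
    (Eventually.of_forall fun _ => continuousOn_radialPrimitive_div _)
    (Eventually.of_forall fun _ _ hr => norm_radialPrimitive_div_le hρ2 hρ3 _ hr.le)

/-- `ψ = r⁻¹ ∫₁^r s v^z ds`. -/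
lemma streamRep_eq {r : ℝ} (hr : 1 ≤ r) (z : ℝ) :
    streamRep μz (r, z) = radialPrimitive ρ (μz.invFourier z) r / r := by
  rw [streamRep, μz.invFourier_eq, radialPrimitive_eq_truncPairing ρ _ hr, map_smul,
    map_invFT _ μz.integrable_total, smul_eq_mul]
  simp only [radialPrimitive_eq_truncPairing ρ _ hr, div_eq_mul_inv]
  rw [invFT_mul_const, mul_assoc]

/-- The transform is the image of `v̂^z` under `averageOp`, whose boundedness costs one power of the
weight and needs `ρ < 3`. -/
lemma memFX_streamRep (hρ2 : 2 ≤ ρ) (hρ3 : ρ < 3) : MemFX (ρ - 2) (streamRep μz) := by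
  refine ⟨μz.map (averageOp hρ3), aestronglyMeasurable_hpVol (continuousOn_streamRep hρ2 hρ3),
    Eventually.of_forall fun z => ?_⟩
  rw [XMeas.invFourier_map]
  filter_upwards [unweight_averageOp hρ3 (μz.invFourier z), ae_restrict_mem measurableSet_Ioi]
    with r h1 h2
  rw [h1, streamRep_eq (mem_Ioi.1 h2).le]

/-! ### Derivatives of the streamfunction and recovery of the velocity -/

section FreqSolution

variable (h : ∀ᵐ ζ ∂freqMeasure, IsFreqSolution ρ ζ (μr.total ζ) (μz.total ζ) (μ.total ζ))

include h

lemma ae_norm_axialRep_le (hρ : 1 ≤ ρ) : ∀ᵐ ζ ∂freqMeasure, ∀ r, 1 < r →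
    ‖axialRep ρ ζ (μr.total ζ) (μ.total ζ) r‖ ≤ ‖μz.total ζ‖ := by
  filter_upwards [h] with ζ hζ r hr
  exact (hζ.norm_axialRep_le hr).trans (rpow_weight_mul_le hρ hr.le _)

lemma ae_norm_freq_mul_le (hρ : 1 ≤ ρ) : ∀ᵐ ζ : ℝ ∂freqMeasure, ∀ r, 1 < r →
    ‖-(Complex.I * ζ) * (radialPrimitive ρ (μz.total ζ) r / r)‖ ≤ ‖μr.total ζ‖ := by
  filter_upwards [h] with ζ hζ r hr
  have h1 := (hζ.norm_mul_radialPrimitive_le hr).trans (rpow_weight_mul_le hρ hr.le _)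
  rwa [norm_mul, norm_neg, norm_mul, Complex.norm_I, one_mul, ← norm_mul]

lemma norm_axialField_le (hρ : 1 ≤ ρ) {x : ℝ × ℝ} (hx : x ∈ halfPlane) :
    ‖axialField μr μ x‖ ≤ ‖fourierConst‖ * ∫ ζ, ‖μz.total ζ‖ ∂freqMeasure := by
  refine norm_fourierConst_mul_invFT_le
    (Y := fun ζ r => axialRep ρ ζ (μr.total ζ) (μ.total ζ) r) μz.integrable_total.norm ?_ x.2
  filter_upwards [ae_norm_axialRep_le h hρ] with ζ hζ using hζ _ hx.1

lemma continuousOn_axialField (hρ : 1 ≤ ρ) : ContinuousOn (axialField μr μ) halfPlane :=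
  continuousOn_superposition (Y := fun ζ r => axialRep ρ ζ (μr.total ζ) (μ.total ζ) r)
    μz.integrable_total.norm (fun _ hr => aestronglyMeasurable_axialRep μr μ hr.le)
    (Eventually.of_forall fun _ =>
      (IsFreqSolution.continuousOn_axialRep _ _ _ _).mono Ioi_subset_Ici_self)
    (ae_norm_axialRep_le h hρ)

lemma norm_radialField_le (hρ : 1 ≤ ρ) {x : ℝ × ℝ} (hx : x ∈ halfPlane) :
    ‖radialField μz x‖ ≤ ‖fourierConst‖ * ∫ ζ, ‖μr.total ζ‖ ∂freqMeasure := by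
  refine norm_fourierConst_mul_invFT_le
    (Y := fun (ζ r : ℝ) => -(Complex.I * ζ) * (radialPrimitive ρ (μz.total ζ) r / r))
    μr.integrable_total.norm ?_ x.2
  filter_upwards [ae_norm_freq_mul_le h hρ] with ζ hζ using hζ _ hx.1

omit h in
lemma aestronglyMeasurable_neg_I_mul {r : ℝ} (hr : 1 < r) : AEStronglyMeasurable
    (fun ζ : ℝ => -(Complex.I * ζ) * (radialPrimitive ρ (μz.total ζ) r / r)) freqMeasure :=
  (by fun_prop : Continuous fun ζ : ℝ => -(Complex.I * ζ)).aestronglyMeasurable.mul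
    (integrable_radialPrimitive_div μz hr.le).aestronglyMeasurable

lemma continuousOn_radialField (hρ : 1 ≤ ρ) : ContinuousOn (radialField μz) halfPlane :=
  continuousOn_superposition
    (Y := fun (ζ r : ℝ) => -(Complex.I * ζ) * (radialPrimitive ρ (μz.total ζ) r / r))
    μr.integrable_total.norm (fun _ hr => aestronglyMeasurable_neg_I_mul hr)
    (Eventually.of_forall fun _ => continuousOn_const.mul (continuousOn_radialPrimitive_div _))
    (ae_norm_freq_mul_le h hρ)

/-- At each frequency `(P/r)' = c - P/r²`. Both terms are bounded, uniformly in `r`, by multiples of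
the norm of `v̂^z`, which is integrable in `ζ`. -/
lemma hasDerivAt_streamRep_fst (hρ2 : 2 ≤ ρ) (hρ3 : ρ < 3) {r : ℝ} (hr : 1 < r) (z : ℝ) :
    HasDerivAt (fun r => streamRep μz (r, z))
      (axialField μr μ (r, z) - streamRep μz (r, z) / r) r := by
  have hρ : 1 ≤ ρ := by linarith
  have hA : Integrable (fun ζ => axialRep ρ ζ (μr.total ζ) (μ.total ζ) r) freqMeasure :=
    μz.integrable_total.norm.mono' (aestronglyMeasurable_axialRep μr μ hr.le) (by
      filter_upwards [ae_norm_axialRep_le h hρ] with ζ hζ using hζ r hr)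
  have hS (r : ℝ) (hr : 1 < r) := integrable_radialPrimitive_div μz hr.le
  have key := hasDerivAt_superposition
    (Q := fun ζ r => radialPrimitive ρ (μz.total ζ) r / r)
    (Y := fun ζ r => axialRep ρ ζ (μr.total ζ) (μ.total ζ) r
      - radialPrimitive ρ (μz.total ζ) r / r / r)
    (b := fun ζ => ‖μz.total ζ‖ + ‖μz.total ζ‖ / (3 - ρ))
    (μz.integrable_total.norm.add (μz.integrable_total.norm.div_const _))
    (fun r hr => (aestronglyMeasurable_axialRep μr μ hr.le).sub
      ((hS r hr).div_const _).aestronglyMeasurable) hS ?_ ?_ hr z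
  · refine key.congr_deriv ?_
    rw [invFT_sub hA ((hS r hr).div_const _), mul_sub]
    simp only [div_eq_mul_inv _ (r : ℂ), invFT_mul_const]
    simp only [streamRep, axialField, div_eq_mul_inv, invFT_mul_const, mul_assoc]
  · filter_upwards [h] with ζ hζ r hr
    have hr0 : (r : ℂ) ≠ 0 := by exact_mod_cast (zero_lt_one.trans hr).ne'
    refine ((hζ.hasDerivAt_radialPrimitive hr).fun_div
      (hasDerivAt_id r).ofReal_comp hr0).congr_deriv ?_
    simp only [id_eq]
    push_cast
    field_simp
  · filter_upwards [ae_norm_axialRep_le h hρ] with ζ hζ r hr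
    refine (norm_sub_le _ _).trans (add_le_add (hζ r hr) ?_)
    rw [norm_div, Complex.norm_real, Real.norm_of_nonneg (by linarith)]
    exact (div_le_self (norm_nonneg _) hr.le).trans (norm_radialPrimitive_div_le hρ2 hρ3 _ hr.le)

/-- Differentiating in `z` costs a factor `ζ`; integrability of `ζ P/r` comes from the bound by the
norm of `v̂^r`. -/
lemma hasDerivAt_streamRep_snd (hρ : 1 ≤ ρ) {r : ℝ} (hr : 1 < r) (z : ℝ) :
    HasDerivAt (fun z => streamRep μz (r, z)) (-radialField μz (r, z)) z := by
  have hI : Integrable (fun ζ : ℝ => (ζ : ℂ) * (radialPrimitive ρ (μz.total ζ) r / r))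
      freqMeasure := by
    refine μr.integrable_total.norm.mono' (aestronglyMeasurable_freq_mul μz hr.le) ?_
    filter_upwards [h] with ζ hζ
    exact (hζ.norm_mul_radialPrimitive_le hr).trans (rpow_weight_mul_le hρ hr.le _)
  refine (hasDerivAt_superposition_snd (integrable_radialPrimitive_div μz hr.le) hI z).congr_deriv ?_
  rw [radialField, ← mul_neg, invFT, invFT, ← integral_neg]
  congr 2
  ext ζ
  simp only [smul_eq_mul]
  ring

lemma ae_eq_axialField (hρ : 1 ≤ ρ) {u : ℝ × ℝ → ℂ} (hu : IsFourierTransform u μz) :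
    u =ᵐ[hpVol] axialField μr μ := by
  refine ae_hpVol_of_ae_ae hu.1 (aestronglyMeasurable_hpVol (continuousOn_axialField h hρ)) ?_
  filter_upwards [hu.2] with z hz
  filter_upwards [hz, ae_unweight_invFourier_eq
    (Y := fun ζ r => axialRep ρ ζ (μr.total ζ) (μ.total ζ) r) μz
    μz.integrable_total.norm (fun _ hr => aestronglyMeasurable_axialRep μr μ hr.le)
    (Eventually.of_forall fun _ =>
      (IsFreqSolution.continuousOn_axialRep _ _ _ _).mono Ioi_subset_Ici_self)
    (ae_norm_axialRep_le h hρ) (h.mono fun _ hζ => hζ.axial) z] with r h1 h2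
  rw [h1, h2, axialField]

lemma ae_eq_radialField (hρ : 1 ≤ ρ) {u : ℝ × ℝ → ℂ} (hu : IsFourierTransform u μr) :
    u =ᵐ[hpVol] radialField μz := by
  refine ae_hpVol_of_ae_ae hu.1 (aestronglyMeasurable_hpVol (continuousOn_radialField h hρ)) ?_
  filter_upwards [hu.2] with z hz
  filter_upwards [hz, ae_unweight_invFourier_eq
    (Y := fun (ζ r : ℝ) => -(Complex.I * ζ) * (radialPrimitive ρ (μz.total ζ) r / r)) μr
    μr.integrable_total.norm (fun _ hr => aestronglyMeasurable_neg_I_mul hr)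
    (Eventually.of_forall fun _ => continuousOn_const.mul (continuousOn_radialPrimitive_div _))
    (ae_norm_freq_mul_le h hρ) (h.mono fun _ hζ => hζ.radial) z] with r h1 h2
  rw [h1, h2, radialField]

/-- At almost every frequency the Bessel formula equals `P/r` for all `r > 1`, which also makes it
integrable in `ζ`. The equality therefore holds at every point, as classical differentiability of
`ψ` requires. -/
lemma streamfunction_eq_streamRep (hρ2 : 2 < ρ) {x : ℝ × ℝ} (hx : x ∈ halfPlane) :
    streamfunction μ x = streamRep μz x := by
  have he : (fun ζ => μ.freqPsi ζ x.1) =ᵐ[freqMeasure]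
      fun ζ => radialPrimitive ρ (μz.total ζ) x.1 / x.1 := by
    filter_upwards [h] with ζ hζ
    rw [← (hζ.coefficients hρ2).2 x.1 hx.1, XMeas.freqPsi]
    split_ifs with h0
    · rw [h0]
    · rfl
  rw [show x = (x.1, x.2) from rfl, μ.streamfunction_eq
    ((integrable_radialPrimitive_div μz (mem_Ioi.1 hx.1).le).congr he.symm), streamRep, invFT, invFT]
  congr 1
  refine integral_congr_ae ?_
  filter_upwards [he] with ζ hζ
  simp only [hζ]

lemma ae_freqD_eq_zero (hρ2 : 2 < ρ) : ∀ᵐ ζ ∂freqMeasure, μ.freqD ζ = 0 := by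
  filter_upwards [h] with ζ hζ
  rw [← (hζ.coefficients hρ2).1, XMeas.freqD]
  split_ifs with h0
  · rw [h0]
  · rfl

end FreqSolution

end Representation

end AxisymBS

end

/-! ### Boundary value problem, Biot-Savart law and vanishing coefficients -/

theorem proposition3p4 (ρ : ℝ) (hρ2 : 2 < ρ) (hρ3 : ρ < 3)
    (v : AxisymField) (hvFX : v.MemFX3 (ρ - 1)) (hvW : v.W12loc) (hswirl : v.NoSwirl)
    (hdiv : v.DivFree) (hbdry : v.ZeroOnBoundary)
    (ω : ℝ × ℝ → ℂ) (hrot : v.IsRotTheta ω)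
    (μ : XMeas ρ) (hω : IsFourierTransform ω μ) :
    -- the streamfunction solves its boundary value problem and is differentiable in `r` and `z`
    (SolvesStreamEq ρ ω (streamfunction μ) ∧
      ∀ r z : ℝ, 1 < r →
        DifferentiableAt ℝ (fun r' : ℝ => streamfunction μ (r', z)) r ∧
        DifferentiableAt ℝ (fun z' : ℝ => streamfunction μ (r, z')) z) ∧
    -- the Biot-Savart law
    v.EqAE (biotSavart μ) ∧
    -- the boundary coefficients vanish
    (∀ᵐ ζ : ℝ, dDens μ ζ = 0) ∧
    (∀ m : ℤ, dAtom μ m = 0) := by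
  obtain ⟨⟨μr, hr⟩, _, ⟨μz, hz⟩⟩ := hvFX
  have h := ae_isFreqSolution hr hz hω hvW hdiv hrot hbdry
  have hρ : 1 ≤ ρ := by linarith
  have hψ {x : ℝ × ℝ} (hx : x ∈ halfPlane) : streamfunction μ x = streamRep μz x :=
    streamfunction_eq_streamRep h hρ2 hx
  have hcψ : ContinuousOn (streamfunction μ) halfPlane :=
    (continuousOn_streamRep hρ2.le hρ3).congr fun x hx => hψ hx
  have hcV := continuousOn_axialField h hρ
  have hcU := continuousOn_radialField h hρ
  have hLψ : MemL2loc (streamfunction μ) := memL2loc_of_continuousOn hcψ fun x hx => by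
    rw [hψ hx]
    exact norm_streamRep_le hρ2.le hρ3 hx
  have hLq : MemL2loc fun x => -radialField μz x :=
    memL2loc_of_continuousOn hcU.neg fun x hx => by
      rw [norm_neg]
      exact norm_radialField_le h hρ hx
  have hcd : ContinuousOn (fun x : ℝ × ℝ => streamfunction μ x / (x.1 : ℂ)) halfPlane :=
    hcψ.div (Complex.continuous_ofReal.comp continuous_fst).continuousOn fun x hx => by
      exact_mod_cast (zero_lt_one.trans hx.1).ne'
  have hLp : MemL2loc fun x => axialField μr μ x - streamfunction μ x / (x.1 : ℂ) := by
    refine (memL2loc_of_continuousOn hcV fun x hx => norm_axialField_le h hρ hx).sub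
      (memL2loc_of_continuousOn (M := ‖fourierConst‖ * ∫ ζ, ‖μz.total ζ‖ / (3 - ρ) ∂freqMeasure) hcd
        fun x hx => ?_)
    have hx1 : 1 < x.1 := hx.1
    rw [hψ hx, norm_div, Complex.norm_real, Real.norm_of_nonneg (by linarith)]
    exact (div_le_self (norm_nonneg _) hx1.le).trans (norm_streamRep_le hρ2.le hρ3 hx)
  have hdr (r z : ℝ) (hr : 1 < r) : HasDerivAt (fun r => streamfunction μ (r, z))
      (axialField μr μ (r, z) - streamfunction μ (r, z) / (r : ℂ)) r := by
    rw [hψ (x := (r, z)) ⟨hr, mem_univ _⟩]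
    refine (hasDerivAt_streamRep_fst h hρ2.le hρ3 hr z).congr_of_eventuallyEq ?_
    filter_upwards [Ioi_mem_nhds hr] with s hs using hψ ⟨hs, mem_univ _⟩
  have hdz (r z : ℝ) (hr : 1 < r) : HasDerivAt (fun z => streamfunction μ (r, z))
      (-radialField μz (r, z)) z := by
    refine (hasDerivAt_streamRep_snd h hρ hr z).congr_of_eventuallyEq ?_
    exact Eventually.of_forall fun s => hψ ⟨hr, mem_univ _⟩
  have hC (x : ℝ × ℝ) (hx : x ∈ halfPlane) : ‖streamfunction μ x‖ ≤
      ‖fourierConst‖ * (∫ ζ, ‖μz.total ζ‖ ∂freqMeasure) * (x.1 - 1) := by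
    rw [hψ hx]
    exact norm_streamRep_le_sub_one hρ2.le hx
  obtain ⟨hwr, hvan⟩ := vanishesOnBoundary_of_hasDerivAt hLψ hLp hcψ (hcV.sub hcd) hC hdr
  have hvr := ae_eq_radialField h hρ hr
  have hvz := ae_eq_axialField h hρ hz
  refine ⟨⟨⟨?_, hLψ, hvan, _, _, hLp, hLq, hwr,
    hasWeakPartial_snd_of_hasDerivAt hLψ hLq hcψ hcU.neg hdz, fun φ hφ hφc _ => ?_⟩,
    fun r z hr => ⟨(hdr r z hr).differentiableAt, (hdz r z hr).differentiableAt⟩⟩, ⟨?_, hswirl, ?_⟩,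
    μ.dDens_dAtom_eq_zero (ae_freqD_eq_zero h hρ2)⟩
  · obtain ⟨ν, _, hν⟩ := memFX_streamRep (μz := μz) hρ2.le hρ3
    refine ⟨ν, aestronglyMeasurable_hpVol hcψ, ?_⟩
    filter_upwards [hν] with z hz
    filter_upwards [hz, ae_restrict_mem measurableSet_Ioi] with r h1 h2
    rw [← h1, hψ ⟨h2, mem_univ _⟩]
  · have ht : IsTest φ := ⟨hφ, hφc⟩
    -- The rotation tested with `r φ` differs from the weak form with weight `r` by exactly `∫ (ψ
    -- ∂_r φ + φ ∂_r ψ)`, which is zero.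
    have hG := integral_fst_green hLψ hLp hC hdr ht
    have hR := hrot.integral_eq hvW hbdry ht.radialMul
    have hv := hvW.2.2.1.integrable_mul (ht.radialMul.continuous_fderiv_apply (1, 0))
      (ht.radialMul.hasCompactSupport_fderiv_apply (1, 0))
    have hu := hvW.1.1.integrable_mul (ht.radialMul.continuous_fderiv_apply (0, 1))
      (ht.radialMul.hasCompactSupport_fderiv_apply (0, 1))
    have hi := (hLψ.integrable_mul (ht.continuous_fderiv_apply (1, 0))
      (ht.hasCompactSupport_fderiv_apply (1, 0))).add (hLp.integrable_mul hφ.continuous hφc)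
    have e : ∫ x, (x.1 : ℂ) * ((φ x : ℂ) * ω x) ∂hpVol =
        ∫ x, ((radialMul φ x : ℝ) : ℂ) * ω x ∂hpVol := by
      simp only [radialMul, Complex.ofReal_mul, mul_assoc]
    rw [e, ← hR, ← sub_zero (∫ x, _ - _ ∂hpVol), ← hG,
      ← integral_sub (by exact hv.sub hu) (by exact hi)]
    refine integral_congr_ae ?_
    filter_upwards [hvr, hvz, ae_hpVol_mem] with x h1 h2 hx
    have hx0 : (x.1 : ℂ) ≠ 0 := by exact_mod_cast (zero_lt_one.trans hx.1).ne'
    rw [h1, h2, ht.fderiv_radialMul, ht.fderiv_radialMul]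
    push_cast
    field_simp
    ring
  · filter_upwards [hvr, ae_hpVol_mem] with x h1 hx
    have hd : deriv (fun z : ℝ => streamfunction μ (x.1, z)) x.2 = -radialField μz x :=
      (hdz x.1 x.2 hx.1).deriv
    simp only [biotSavart]
    rw [h1, hd, neg_neg]
  · filter_upwards [hvz, ae_hpVol_mem] with x h1 hx
    have hx0 : (x.1 : ℂ) ≠ 0 := by exact_mod_cast (zero_lt_one.trans hx.1).ne'
    have hd := (hasDerivAt_id x.1).ofReal_comp.fun_mul (hdr x.1 x.2 hx.1)
    simp only [id_eq] at hd
    simp only [biotSavart]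
    rw [h1, hd.deriv, Complex.ofReal_one]
    field_simp
    ring
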